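/- Consider a rooted tree in which some nodes are marked, and which changes under the following operations, where $U$ is any node present at that moment (a node counts as an ancestor of itself): \begin{itemize} \item $\mathrm{NMA}(U)$: report the nearest marked ancestor of $U$ (or that there is none); \item $\mathrm{mark}(U)$: mark $U$; \item $\mathrm{addLeaf}(U)$: add a new unmarked leaf as a child of $U$, and return it; \item $\mathrm{demoteMark}(U)$: if $U$ is marked, unmark $U$ and mark all children of $U$ (if $U$ is unmarked, do nothing). \end{itemize} These operations can be performed in $O(1)$ amortized time on a growing tree, assuming that each of the four operations is executed at most $n$ times, where $n$ is the final size of the tree. Precisely: the machine is a word RAM with $w$-bit words and unit-cost arithmetic, bitwise, shift, comparison and memory instructions, and its memory initially contains only zeros besides the input. The nodes of the initial tree are numbered so that parents precede their children, and new leaves receive the next free number. There are a data structure, consisting of one fixed program that sets it up for a given initial tree and one fixed program for each of the four operations, and constants $c, C$ such that the following holds. Let $\mathcal T$ be any nonempty finite rooted tree with $n_0$ nodes, any of which may be marked, given by its parent pointers and marks. Let $o_1,\dots,o_m$ be any sequence of the above operations, each applied to a node that exists at that moment, such that the tree after $o_m$ has $n$ nodes and each of the four kinds of operation occurs at most $n$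 times. Let $w \ge \log_2 n + c$. Then the data structure, which gets the operations one at a time and is told neither $n$ nor the later operations, answers all of them correctly, and for every $0 \le k \le m$ the set-up and the operations $o_1,\dots,o_k$ together take at most $C\,(n_0+k)$ steps. -/

import Mathlib

/-! ## Marked rooted trees and the four operations -/

/-- The data of a finite rooted tree with some marked nodes. The nodes are `0, …, size - 1`, the root
is `0`, and `parent v` is the parent of a non-root node `v`; values of `parent` at the root and of
`parent` and `marked` at numbers that are not nodes carry no meaning. -/
structure MTree where
  size : ℕ
  parent : ℕ → ℕ
  marked : ℕ → Bool

namespace MTree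

/-- There is a root, and every other node has a parent that comes earlier in the numbering
(so following parents always leads to the root). -/
def IsTree (T : MTree) : Prop :=
  0 < T.size ∧ ∀ v, 0 < v → v < T.size → T.parent v < v

/-- `T.IsChild v u`: the node `v` is a child of `u`. -/
def IsChild (T : MTree) (v u : ℕ) : Prop :=
  0 < v ∧ v < T.size ∧ T.parent v = u

instance (T : MTree) (v u : ℕ) : Decidable (T.IsChild v u) := by
  unfold IsChild; infer_instance

/-- `T.IsAncestor u v`: the node `u` is an ancestor of `v`; every node is an ancestor of itself. -/
inductive IsAncestor (T : MTree) (u : ℕ) : ℕ → Prop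
  | refl : IsAncestor T u u
  | step {v p : ℕ} : T.IsChild v p → IsAncestor T u p → IsAncestor T u v

/-- `T.IsNMA v r`: `r` is the nearest marked ancestor of `v`, with `none` if there is none. -/
def IsNMA (T : MTree) (v : ℕ) : Option ℕ → Prop
  | some u => T.IsAncestor u v ∧ T.marked u = true ∧
      ∀ x, T.IsAncestor x v → T.marked x = true → T.IsAncestor x u
  | none => ∀ x, T.IsAncestor x v → T.marked x = false

/-- Mark the node `u`. -/
def mark (T : MTree) (u : ℕ) : MTree :=
  { T with marked := Function.update T.marked u true }

/-- Add an unmarked leaf as a new child of `u`; the new node is number `T.size`. -/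
def addLeaf (T : MTree) (u : ℕ) : MTree where
  size := T.size + 1
  parent := Function.update T.parent T.size u
  marked := Function.update T.marked T.size false

/-- If `u` is marked, unmark `u` and mark all children of `u`; otherwise do nothing. -/
def demoteMark (T : MTree) (u : ℕ) : MTree :=
  if T.marked u = true then
    { T with marked := fun v =>
        if v = u then false else if T.IsChild v u then true else T.marked v }
  else T

end MTree

inductive OpKind
  | nma
  | mark
  | addLeaf
  | demoteMark
  deriving DecidableEq

/-- An operation together with the node to which it is applied. -/
structure TreeOp where
  kind : OpKind
  node : ℕ

/-- The effect of an operation on the tree. -/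
def MTree.apply (T : MTree) (op : TreeOp) : MTree :=
  match op.kind with
  | .nma => T
  | .mark => T.mark op.node
  | .addLeaf => T.addLeaf op.node
  | .demoteMark => T.demoteMark op.node

/-- The tree after a sequence of operations. -/
def MTree.applyAll (T : MTree) (ops : List TreeOp) : MTree :=
  ops.foldl MTree.apply T

/-- Every operation of the sequence is applied to a node that exists at that moment. -/
def MTree.Admissible : MTree → List TreeOp → Prop
  | _, [] => True
  | T, op :: ops => op.node < T.size ∧ (T.apply op).Admissible ops

/-! ## Word RAM -/

namespace WordRAM

/-- Registers and memory cells; all of them hold `w`-bit words, i.e. numbers below `2 ^ w`. -/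
structure State where
  reg : ℕ → ℕ
  mem : ℕ → ℕ

def State.setReg (s : State) (d x : ℕ) : State :=
  { s with reg := Function.update s.reg d x }

def State.setMem (s : State) (a x : ℕ) : State :=
  { s with mem := Function.update s.mem a x }

/-- The binary machine operations: arithmetic, bitwise operations, shifts and comparisons. -/
inductive BinOp
  | add | sub | mul | div | mod
  | and | or | xor | shl | shr
  | lt | eq

/-- The result of an operation on two `w`-bit words (before reduction modulo `2 ^ w`).
Subtraction wraps around; division by `0` gives `0`, and `a mod 0 = a`. -/
def BinOp.raw (w : ℕ) : BinOp → ℕ → ℕ → ℕ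
  | .add, a, b => a + b
  | .sub, a, b => a + 2 ^ w - b
  | .mul, a, b => a * b
  | .div, a, b => a / b
  | .mod, a, b => a % b
  | .and, a, b => a &&& b
  | .or, a, b => a ||| b
  | .xor, a, b => a ^^^ b
  | .shl, a, b => a <<< b
  | .shr, a, b => a >>> b
  | .lt, a, b => if a < b then 1 else 0
  | .eq, a, b => if a = b then 1 else 0

def BinOp.eval (w : ℕ) (o : BinOp) (a b : ℕ) : ℕ :=
  o.raw w a b % 2 ^ w

/-- Programs. A program is a finite object that does not depend on the word length `w`, and it
names only finitely many registers. -/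
inductive Prog
  | skip
  /-- `r_d := k` -/
  | const (d k : ℕ)
  /-- `r_d := w` -/
  | wordLength (d : ℕ)
  /-- `r_d := o (r_a, r_b)` -/
  | op (o : BinOp) (d a b : ℕ)
  /-- `r_d := mem[r_a]` -/
  | load (d a : ℕ)
  /-- `mem[r_a] := r_b` -/
  | store (a b : ℕ)
  | seq (p q : Prog)
  /-- if `r_a ≠ 0` then `p` else `q` -/
  | cond (a : ℕ) (p q : Prog)
  /-- while `r_a ≠ 0` do `p` -/
  | loop (a : ℕ) (p : Prog)

/-- `Exec w p s s' t`: on a machine with word length `w`, the program `p` started in the state `s`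
halts in the state `s'` after `t` steps. Each instruction and each test takes one step. -/
inductive Exec (w : ℕ) : Prog → State → State → ℕ → Prop
  | skip (s : State) : Exec w .skip s s 1
  | const (d k : ℕ) (s : State) : Exec w (.const d k) s (s.setReg d (k % 2 ^ w)) 1
  | wordLength (d : ℕ) (s : State) : Exec w (.wordLength d) s (s.setReg d w) 1
  | op (o : BinOp) (d a b : ℕ) (s : State) :
      Exec w (.op o d a b) s (s.setReg d (o.eval w (s.reg a) (s.reg b))) 1
  | load (d a : ℕ) (s : State) : Exec w (.load d a) s (s.setReg d (s.mem (s.reg a))) 1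
  | store (a b : ℕ) (s : State) : Exec w (.store a b) s (s.setMem (s.reg a) (s.reg b)) 1
  | seq {p q : Prog} {s s' s'' : State} {t t' : ℕ} :
      Exec w p s s' t → Exec w q s' s'' t' → Exec w (.seq p q) s s'' (t + t')
  | cond_true {a : ℕ} {p q : Prog} {s s' : State} {t : ℕ} :
      s.reg a ≠ 0 → Exec w p s s' t → Exec w (.cond a p q) s s' (t + 1)
  | cond_false {a : ℕ} {p q : Prog} {s s' : State} {t : ℕ} :
      s.reg a = 0 → Exec w q s s' t → Exec w (.cond a p q) s s' (t + 1)
  | loop_stop {a : ℕ} {p : Prog} {s : State} :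
      s.reg a = 0 → Exec w (.loop a p) s s 1
  | loop_step {a : ℕ} {p : Prog} {s s' s'' : State} {t t' : ℕ} :
      s.reg a ≠ 0 → Exec w p s s' t → Exec w (.loop a p) s' s'' t' →
        Exec w (.loop a p) s s'' (t + 1 + t')

/-- The machine is deterministic: final state and number of steps are determined by the start. -/
theorem Exec.unique {w : ℕ} {p : Prog} {s s₁ s₂ : State} {t₁ t₂ : ℕ}
    (h₁ : Exec w p s s₁ t₁) (h₂ : Exec w p s s₂ t₂) : s₁ = s₂ ∧ t₁ = t₂ := by
  induction h₁ generalizing s₂ t₂ with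
  | skip | const | wordLength | op | load | store => cases h₂; exact ⟨rfl, rfl⟩
  | seq _ _ ih ih' =>
    cases h₂ with
    | seq g g' =>
      obtain ⟨rfl, rfl⟩ := ih g
      obtain ⟨rfl, rfl⟩ := ih' g'
      exact ⟨rfl, rfl⟩
  | cond_true h _ ih =>
    cases h₂ with
    | cond_true _ g => obtain ⟨rfl, rfl⟩ := ih g; exact ⟨rfl, rfl⟩
    | cond_false g => exact absurd g h
  | cond_false h _ ih =>
    cases h₂ with
    | cond_true g => exact absurd h g
    | cond_false _ g => obtain ⟨rfl, rfl⟩ := ih g; exact ⟨rfl, rfl⟩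
  | loop_stop h =>
    cases h₂ with
    | loop_stop => exact ⟨rfl, rfl⟩
    | loop_step g => exact absurd h g
  | loop_step h _ _ ih ih' =>
    cases h₂ with
    | loop_stop g => exact absurd g h
    | loop_step _ g g' =>
      obtain ⟨rfl, rfl⟩ := ih g
      obtain ⟨rfl, rfl⟩ := ih' g'
      exact ⟨rfl, rfl⟩

end WordRAM

/-! ## Data structures for the four operations -/

open WordRAM in
/-- A data structure: a program that sets it up for the initial tree, and one for each operation.
Between two operations, registers and memory are kept. -/
structure NMAStructure where
  init : Prog
  proc : OpKind → Prog

/-- The word that names a node: node `v` is named by `v + 1`, and `0` is the null pointer. -/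
def handle : Option ℕ → ℕ
  | none => 0
  | some v => v + 1

/-- The parent of `v`, or `none` for the root. -/
def MTree.parent? (T : MTree) (v : ℕ) : Option ℕ :=
  if v = 0 then none else some (T.parent v)

namespace WordRAM

/-- The start of the computation: register `0` holds the number of nodes of the initial tree, and
for each node `v`, cell `2 * v` holds the name of the parent of `v`, and cell `2 * v + 1` holds `1`
if `v` is marked and `0` otherwise. All other registers and cells are `0`. -/
def start (w : ℕ) (T : MTree) : State where
  reg := fun i => if i = 0 then T.size % 2 ^ w else 0
  mem := fun a =>
    if a / 2 < T.size then
      (if a % 2 = 0 then handle (T.parent? (a / 2)) else (T.marked (a / 2)).toNat) % 2 ^ w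
    else 0

end WordRAM

/-- The word `x` is a correct answer to the operation `op` on the tree `T`: a query has to return
the name of the nearest marked ancestor (the null pointer if there is none), and `addLeaf` the name
of the new leaf. -/
def CorrectAnswer (T : MTree) (op : TreeOp) (x : ℕ) : Prop :=
  match op.kind with
  | .nma => ∃ r, T.IsNMA op.node r ∧ x = handle r
  | .mark => True
  | .addLeaf => x = handle (some T.size)
  | .demoteMark => True

open WordRAM in
/-- `Serves w D T s ops ts`: from the machine state `s`, which stands for the current tree `T`, the
data structure `D` executes the operations `ops` one after the other (each is started with the name
of its node in register `0`, and leaves its answer there), all answers are correct, and `ts` lists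
the numbers of steps taken by the single operations. -/
inductive Serves (w : ℕ) (D : NMAStructure) :
    MTree → State → List TreeOp → List ℕ → Prop
  | nil (T : MTree) (s : State) : Serves w D T s [] []
  | cons {T : MTree} {s s' : State} {op : TreeOp} {ops : List TreeOp} {t : ℕ} {ts : List ℕ} :
      Exec w (D.proc op.kind) (s.setReg 0 (handle (some op.node) % 2 ^ w)) s' t →
      CorrectAnswer T op (s'.reg 0) →
      Serves w D (T.apply op) s' ops ts →
      Serves w D T s (op :: ops) (t :: ts)

/-! The difficulty is that marks can disappear. It is removed by spending extra nodes. Every tree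
node has a handle, and every handle has a current node in an auxiliary forest in which marks are
only ever added. To demote the mark of `u`, all children of its current node are marked, and `u`
receives a new unmarked leaf below the current node of its parent; the old node stays marked
forever. This is sound because only an unmarked handle needs its node to hang below the current node
of its parent (`Handles.par`): a search stops at a marked one, and all children of `u` have just
become marked. A demotion adds at most one forest node, so at most `2 * n + 1` nodes ever exist;
here the bound on the number of operations enters. A node `0`, marked from the start, lies above the
root and yields the null answer.

For marks that only grow, the forest is divided into microtrees of at most `B = w - 6` nodes, and a
new microtree is opened only below a full one. The nodes of a microtree get bits from the highest
downwards in the order of insertion, so a descendant has a lower bit than its ancestors, and the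
nearest marked ancestor inside the microtree is the lowest common bit of an ancestor mask and a mark
mask (`Micro.nearest_of_cov`). A table indexed by powers of two turns that bit into a position. A
node is covered if it has a marked ancestor in its microtree. The full microtrees form a contracted
forest; the edge above a microtree is cut as soon as the parent of its root is covered. The cuts
leave components, each with a label through which its root is known. A search looks into its own
microtree, then into the one above, which is full, and then jumps to the parent of the top of the
component, which is covered. Three local lookups suffice (`Forest.runs_findProg`).

Cuts are only added, so components only split. The Euler tours of the two parts are walked in
parallel, and only the part whose tour ends first is relabelled, at a cost proportional to the
smaller size (`Components.runs_cutProg`). The potential `phi`, with `phi a + phi b + min a b ≤ phi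
(a + b)`, pays for this (`phi_add'`). A newly full microtree raises it by at most `log N`, which is
less than `B` and was saved by the insertions that filled the microtree (`Forest.runs_join`).
Marking visits only nodes that become covered, each once, together with their children
(`Forest.runs_markProg`). Summing amortized costs over any prefix of the operations gives the bound
(`serves_opProg`).

The algorithm is written in a small language with arrays and exact arithmetic, which is compiled to
the word RAM with constant slowdown (`AProg.Run.exec_compile`). -/

set_option linter.unusedSimpArgs false

/-! ## A structured language with arrays, compiled to the word RAM -/

namespace WordRAM

/-- Exact arithmetic on words; it agrees with `BinOp.eval` where `BinOp.Fits` holds. -/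
def BinOp.val : BinOp → ℕ → ℕ → ℕ
  | .sub, a, b => a - b
  | o, a, b => o.raw 0 a b

def BinOp.Fits (w : ℕ) : BinOp → ℕ → ℕ → Prop
  | .add, a, b => a + b < 2 ^ w
  | .sub, a, b => b ≤ a
  | .mul, a, b => a * b < 2 ^ w
  | .shl, a, b => a <<< b < 2 ^ w
  | _, _, _ => True

theorem BinOp.eval_eq_val {w : ℕ} (hw : 0 < w) {o : BinOp} {a b : ℕ} (ha : a < 2 ^ w)
    (hb : b < 2 ^ w) (h : o.Fits w a b) : o.eval w a b = o.val a b := by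
  have h1 : 1 < 2 ^ w := Nat.one_lt_two_pow hw.ne'
  cases o <;> simp only [BinOp.Fits] at h <;> simp only [BinOp.eval, BinOp.val, BinOp.raw]
  case sub =>
    rw [show a + 2 ^ w - b = (a - b) + 2 ^ w by omega, Nat.add_mod_right, Nat.mod_eq_of_lt]
    omega
  all_goals apply Nat.mod_eq_of_lt
  case add => exact h
  case mul => exact h
  case div => exact (Nat.div_le_self a b).trans_lt ha
  case mod => exact (Nat.mod_le a b).trans_lt ha
  case and => exact Nat.and_le_left.trans_lt ha
  case or => exact Nat.or_lt_two_pow ha hb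
  case xor => exact Nat.xor_lt_two_pow ha hb
  case shl => exact h
  case shr => exact (Nat.shiftRight_le a b).trans_lt ha
  case lt => split_ifs <;> omega
  case eq => split_ifs <;> omega

theorem BinOp.eval_lt {w : ℕ} (o : BinOp) (a b : ℕ) : o.eval w a b < 2 ^ w :=
  Nat.mod_lt _ (by positivity)

/-- The state of a structured program: variables, arrays, and the read-only input. -/
structure AState where
  var : ℕ → ℕ
  arr : ℕ → ℕ → ℕ
  inp : ℕ → ℕ

def AState.setVar (h : AState) (d x : ℕ) : AState :=
  { h with var := Function.update h.var d x }

def AState.setArr (h : AState) (k i x : ℕ) : AState :=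
  { h with arr := Function.update h.arr k (Function.update (h.arr k) i x) }

namespace AState

variable (h : AState) (d x k i j : ℕ)

@[simp] theorem setVar_var : (h.setVar d x).var i = if i = d then x else h.var i := by
  simp [setVar, Function.update_apply]

@[simp] theorem setVar_arr : (h.setVar d x).arr = h.arr := rfl

@[simp] theorem setVar_inp : (h.setVar d x).inp = h.inp := rfl

@[simp] theorem setArr_var : (h.setArr k i x).var = h.var := rfl

@[simp] theorem setArr_inp : (h.setArr k i x).inp = h.inp := rfl

@[simp] theorem setArr_arr :
    (h.setArr k i x).arr j = if j = k then Function.update (h.arr k) i x else h.arr j := by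
  simp only [setArr, Function.update_apply]

end AState

/-- Expressions. -/
inductive AExp
  | v (i : ℕ)
  | c (k : ℕ)
  | wl
  | op (o : BinOp) (a b : AExp)
  | ld (k : ℕ) (a : AExp)
  | inp (a : AExp)

namespace AExp

/-- Length of the arrays. -/
def _root_.WordRAM.lim (w : ℕ) : ℕ := 2 ^ (w - 6)

def ev (w : ℕ) (h : AState) : AExp → ℕ
  | v i => h.var i
  | c k => k
  | wl => w
  | op o a b => o.val (a.ev w h) (b.ev w h)
  | ld k a => h.arr k (a.ev w h)
  | inp a => h.inp (a.ev w h)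

/-- No overflow and no access out of bounds. -/
def Ok (w : ℕ) (h : AState) : AExp → Prop
  | v _ => True
  | c _ => True
  | wl => True
  | op o a b => a.Ok w h ∧ b.Ok w h ∧ o.Fits w (a.ev w h) (b.ev w h)
  | ld _ a => a.Ok w h ∧ a.ev w h < lim w
  | inp a => a.Ok w h ∧ a.ev w h < 2 ^ (w - 1)

/-- Only the variables, constants and arrays that the compiler supports are used. -/
def Wf : AExp → Bool
  | v i => decide (i < 100)
  | c k => decide (k < 64)
  | wl => true
  | op _ a b => a.Wf && b.Wf
  | ld k a => decide (k < 32) && a.Wf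
  | inp a => a.Wf

/-- Replaces the index in register `d` by the address of that cell of array `k`. -/
def _root_.WordRAM.addrProg (k d : ℕ) : Prog :=
  .seq (.const (d + 1) 5) <| .seq (.op .shl d d (d + 1)) <|
  .seq (.const (d + 1) k) <| .seq (.op .add d d (d + 1)) <|
  .seq (.wordLength (d + 1)) <| .seq (.const (d + 2) 1) <|
  .seq (.op .sub (d + 1) (d + 1) (d + 2)) <| .seq (.op .shl (d + 1) (d + 2) (d + 1)) <|
  .op .add d d (d + 1)

def compile : AExp → ℕ → Prog
  | v i, d => .op .or d i i
  | c k, d => .const d k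
  | wl, d => .wordLength d
  | op o a b, d => .seq (a.compile d) <| .seq (b.compile (d + 1)) <| .op o d d (d + 1)
  | ld k a, d => .seq (a.compile d) <| .seq (addrProg k d) <| .load d d
  | inp a, d => .seq (a.compile d) <| .load d d

def cost : AExp → ℕ
  | v _ => 1
  | c _ => 1
  | wl => 1
  | op _ a b => a.cost + (b.cost + 1)
  | ld _ a => a.cost + 10
  | inp a => a.cost + 1

end AExp

/-- The cell `i` of array `k`. -/
def cell (w k i : ℕ) : ℕ := 2 ^ (w - 1) + (i * 32 + k)

theorem cell_inj {w k i k' i' : ℕ} (hk : k < 32) (hk' : k' < 32)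
    (h : cell w k i = cell w k' i') : k = k' ∧ i = i' := by
  unfold cell at h; omega

/-- Thirty-two interleaved arrays of length `lim w` exactly fill the upper half of the address
space; the lower half keeps the input. -/
theorem lim_mul {w : ℕ} (hw : 7 ≤ w) : lim w * 32 = 2 ^ (w - 1) := by
  unfold lim
  rw [show w - 1 = (w - 6) + 5 by omega, pow_add]
  norm_num

theorem two_mul_half {w : ℕ} (hw : 7 ≤ w) : 2 ^ (w - 1) + 2 ^ (w - 1) = 2 ^ w := by
  rw [← two_mul, ← pow_succ']; congr 1; omega

/-- The machine state `s` represents the state `h` of a structured program. -/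
structure View (w : ℕ) (s : State) (h : AState) : Prop where
  var : ∀ i < 100, s.reg i = h.var i
  arr : ∀ k < 32, ∀ i, s.mem (cell w k i) = h.arr k i
  inp : ∀ a < 2 ^ (w - 1), s.mem a = h.inp a
  reg_lt : ∀ i, s.reg i < 2 ^ w
  mem_lt : ∀ a, s.mem a < 2 ^ w

theorem State.setReg_reg (s : State) (d x i : ℕ) :
    (s.setReg d x).reg i = if i = d then x else s.reg i := by
  simp [State.setReg, Function.update_apply]

@[simp] theorem State.setReg_mem (s : State) (d x : ℕ) : (s.setReg d x).mem = s.mem := rfl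

theorem View.setTemp {w : ℕ} {s : State} {h : AState} (V : View w s h) {d x : ℕ} (hd : 100 ≤ d)
    (hx : x < 2 ^ w) : View w (s.setReg d x) h where
  var i hi := by rw [State.setReg_reg, if_neg (by omega)]; exact V.var i hi
  arr := V.arr
  inp := V.inp
  reg_lt i := by rw [State.setReg_reg]; split_ifs; exacts [hx, V.reg_lt i]
  mem_lt := V.mem_lt

theorem View.setVar {w : ℕ} {s : State} {h : AState} (V : View w s h) {d x : ℕ}
    (hx : x < 2 ^ w) : View w (s.setReg d x) (h.setVar d x) where
  var i hi := by rw [State.setReg_reg, AState.setVar_var, V.var i hi]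
  arr := V.arr
  inp := V.inp
  reg_lt i := by rw [State.setReg_reg]; split_ifs; exacts [hx, V.reg_lt i]
  mem_lt := V.mem_lt

theorem View.setArr {w : ℕ} {s : State} {h : AState} (V : View w s h) {k i x : ℕ} (hk : k < 32)
    (hx : x < 2 ^ w) : View w (s.setMem (cell w k i) x) (h.setArr k i x) where
  var := V.var
  arr k' hk' i' := by
    simp only [State.setMem, AState.setArr_arr, Function.update_apply]
    by_cases e : k' = k ∧ i' = i
    · obtain ⟨rfl, rfl⟩ := e; simp
    · rw [if_neg (fun e' => e (cell_inj hk' hk e')), V.arr k' hk' i']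
      by_cases e1 : k' = k
      · subst e1; rw [if_pos rfl, Function.update_of_ne (fun e2 => e ⟨rfl, e2⟩)]
      · rw [if_neg e1]
  inp a ha := by
    simp only [State.setMem, Function.update_apply]
    rw [if_neg (by unfold cell; omega)]; exact V.inp a ha
  reg_lt := V.reg_lt
  mem_lt a := by
    simp only [State.setMem, Function.update_apply]
    split_ifs
    exacts [hx, V.mem_lt a]

/-- The offset `2 ^ (w - 1)` is computed from the word length, since the program must not depend on
`w`. -/
theorem exec_addrProg {w : ℕ} (hw : 7 ≤ w) {s : State} {h : AState} (V : View w s h) {k d i : ℕ}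
    (hk : k < 32) (hd : 100 ≤ d) (hi : i < lim w) (hr : s.reg d = i) :
    ∃ s', Exec w (addrProg k d) s s' 9 ∧ View w s' h ∧ s'.reg d = cell w k i ∧
      ∀ r < d, s'.reg r = s.reg r := by
  have h1 := lim_mul hw
  have h2 := two_mul_half hw
  have h7 : 2 ^ 7 ≤ 2 ^ w := Nat.pow_le_pow_right (by norm_num) hw
  have hwl : w < 2 ^ w := Nat.lt_two_pow_self
  have hc : cell w k i < 2 ^ w := by unfold cell; omega
  have e5 : (5 : ℕ) % 2 ^ w = 5 := Nat.mod_eq_of_lt (by omega)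
  have ek : k % 2 ^ w = k := Nat.mod_eq_of_lt (by omega)
  have e1 : 1 % 2 ^ w = 1 := Nat.mod_eq_of_lt (by omega)
  have o1 : BinOp.eval w .shl i 5 = i * 32 := by
    rw [BinOp.eval, BinOp.raw, Nat.shiftLeft_eq, Nat.mod_eq_of_lt]
    omega
  have o2 : BinOp.eval w .add (i * 32) k = i * 32 + k :=
    Nat.mod_eq_of_lt (show i * 32 + k < 2 ^ w by omega)
  have o3 : BinOp.eval w .sub w 1 = w - 1 := by
    rw [BinOp.eval, BinOp.raw, show w + 2 ^ w - 1 = (w - 1) + 2 ^ w by omega, Nat.add_mod_right,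
      Nat.mod_eq_of_lt]
    omega
  have o4 : BinOp.eval w .shl 1 (w - 1) = 2 ^ (w - 1) := by
    rw [BinOp.eval, BinOp.raw, Nat.shiftLeft_eq, one_mul, Nat.mod_eq_of_lt]; omega
  have o5 : BinOp.eval w .add (i * 32 + k) (2 ^ (w - 1)) = cell w k i := by
    rw [BinOp.eval, BinOp.raw, add_comm]; exact Nat.mod_eq_of_lt hc
  refine ⟨_, .seq (.const _ _ _) <| .seq (.op _ _ _ _ _) <| .seq (.const _ _ _) <|
    .seq (.op _ _ _ _ _) <| .seq (.wordLength _ _) <| .seq (.const _ _ _) <|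
    .seq (.op _ _ _ _ _) <| .seq (.op _ _ _ _ _) <| .op _ _ _ _ _, ?_, ?_, ?_⟩
  · have m : ∀ a, a % 2 ^ w < 2 ^ w := fun a => Nat.mod_lt _ (by positivity)
    exact ((((((((V.setTemp (by omega) (m _)).setTemp (by omega) (BinOp.eval_lt _ _ _)).setTemp
      (by omega) (m _)).setTemp (by omega) (BinOp.eval_lt _ _ _)).setTemp (by omega) hwl).setTemp
      (by omega) (m _)).setTemp (by omega) (BinOp.eval_lt _ _ _)).setTemp (by omega)
      (BinOp.eval_lt _ _ _)).setTemp (by omega) (BinOp.eval_lt _ _ _)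
  · simp [State.setReg_reg, hr, e5, ek, e1, o1, o2, o3, o4, o5]
  · intro r hr'
    have a1 : r ≠ d := by omega
    have a2 : r ≠ d + 1 := by omega
    have a3 : r ≠ d + 2 := by omega
    simp [State.setReg_reg, a1, a2, a3]

/-- The registers from `100` on serve as an evaluation stack. Since registers below `d` are
preserved, a second operand can be evaluated in `d + 1` while the first one rests in `d`. -/
theorem AExp.exec_compile {w : ℕ} (hw : 7 ≤ w) {h : AState} (e : AExp) (he : e.Wf = true)
    (ho : e.Ok w h) {s : State} (V : View w s h) {d : ℕ} (hd : 100 ≤ d) :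
    ∃ s', Exec w (e.compile d) s s' e.cost ∧ View w s' h ∧ s'.reg d = e.ev w h ∧
      ∀ r < d, s'.reg r = s.reg r := by
  have h7 : 2 ^ 7 ≤ 2 ^ w := Nat.pow_le_pow_right (by norm_num) hw
  induction e generalizing s d with
  | v i =>
    simp only [Wf, decide_eq_true_eq] at he
    refine ⟨_, .op _ _ _ _ _, V.setTemp hd (BinOp.eval_lt _ _ _), ?_, ?_⟩
    · rw [State.setReg_reg, if_pos rfl, BinOp.eval_eq_val (o := .or) (by omega) (V.reg_lt _) (V.reg_lt _)
        trivial, V.var i he]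
      simp [BinOp.val, BinOp.raw, ev]
    · intro r hr; rw [State.setReg_reg, if_neg hr.ne]
  | c k =>
    simp only [Wf, decide_eq_true_eq] at he
    refine ⟨_, .const _ _ _, V.setTemp hd (Nat.mod_lt _ (by positivity)), ?_, ?_⟩
    · rw [State.setReg_reg, if_pos rfl, Nat.mod_eq_of_lt (by omega)]; rfl
    · intro r hr; rw [State.setReg_reg, if_neg hr.ne]
  | wl =>
    refine ⟨_, .wordLength _ _, V.setTemp hd Nat.lt_two_pow_self, ?_, ?_⟩
    · rw [State.setReg_reg, if_pos rfl]; rfl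
    · intro r hr; rw [State.setReg_reg, if_neg hr.ne]
  | op o a b iha ihb =>
    simp only [Wf, Bool.and_eq_true] at he
    obtain ⟨oa, ob, of⟩ := ho
    obtain ⟨s1, x1, V1, r1, k1⟩ := iha he.1 oa V hd
    obtain ⟨s2, x2, V2, r2, k2⟩ := ihb he.2 ob V1 (d := d + 1) (by omega)
    refine ⟨_, .seq x1 (.seq x2 (.op _ _ _ _ _)), V2.setTemp hd (BinOp.eval_lt _ _ _), ?_, ?_⟩
    · have r1' : s2.reg d = a.ev w h := by rw [k2 d (by omega), r1]
      rw [State.setReg_reg, if_pos rfl,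
        BinOp.eval_eq_val (by omega) (V2.reg_lt _) (V2.reg_lt _) (by rw [r1', r2]; exact of),
        r1', r2]
      rfl
    · intro r hr; rw [State.setReg_reg, if_neg hr.ne, k2 r (by omega), k1 r hr]
  | ld k a iha =>
    simp only [Wf, Bool.and_eq_true, decide_eq_true_eq] at he
    obtain ⟨s1, x1, V1, r1, k1⟩ := iha he.2 ho.1 V hd
    obtain ⟨s2, x2, V2, r2, k2⟩ := exec_addrProg hw V1 he.1 hd ho.2 r1
    refine ⟨_, .seq x1 (.seq x2 (.load _ _ _)), V2.setTemp hd (V2.mem_lt _), ?_, ?_⟩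
    · rw [State.setReg_reg, if_pos rfl, r2, V2.arr k he.1]; rfl
    · intro r hr; rw [State.setReg_reg, if_neg hr.ne, k2 r hr, k1 r hr]
  | inp a iha =>
    obtain ⟨s1, x1, V1, r1, k1⟩ := iha he ho.1 V hd
    refine ⟨_, .seq x1 (.load _ _ _), V1.setTemp hd (V1.mem_lt _), ?_, ?_⟩
    · rw [State.setReg_reg, if_pos rfl, r1, V1.inp _ ho.2]; rfl
    · intro r hr; rw [State.setReg_reg, if_neg hr.ne, k1 r hr]

/-! ### Structured programs, their cost and their compilation -/

/-- Structured programs. -/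
inductive AProg
  | set (d : ℕ) (e : AExp)
  | st (k : ℕ) (i e : AExp)
  | seq (p q : AProg)
  | ite (e : AExp) (p q : AProg)
  | while (e : AExp) (p : AProg)

infixr:60 ";;" => AProg.seq

namespace AProg

inductive Run (w : ℕ) : AProg → AState → AState → ℕ → Prop
  | set {d : ℕ} {e : AExp} {h : AState} : e.Ok w h →
      Run w (.set d e) h (h.setVar d (e.ev w h)) 1
  | st {k : ℕ} {i e : AExp} {h : AState} : i.Ok w h → e.Ok w h → i.ev w h < lim w →
      Run w (.st k i e) h (h.setArr k (i.ev w h) (e.ev w h)) 1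
  | seq {p q : AProg} {h h' h'' : AState} {t t' : ℕ} :
      Run w p h h' t → Run w q h' h'' t' → Run w (p;;q) h h'' (t + t')
  | ite_true {e : AExp} {p q : AProg} {h h' : AState} {t : ℕ} : e.Ok w h → e.ev w h ≠ 0 →
      Run w p h h' t → Run w (.ite e p q) h h' (t + 1)
  | ite_false {e : AExp} {p q : AProg} {h h' : AState} {t : ℕ} : e.Ok w h → e.ev w h = 0 →
      Run w q h h' t → Run w (.ite e p q) h h' (t + 1)
  | while_done {e : AExp} {p : AProg} {h : AState} : e.Ok w h → e.ev w h = 0 →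
      Run w (.while e p) h h 1
  | while_step {e : AExp} {p : AProg} {h h' h'' : AState} {t t' : ℕ} : e.Ok w h → e.ev w h ≠ 0 →
      Run w p h h' t → Run w (.while e p) h' h'' t' → Run w (.while e p) h h'' (t + t' + 1)

def Wf : AProg → Bool
  | set d e => decide (d < 100) && e.Wf
  | st k i e => decide (k < 32) && i.Wf && e.Wf
  | seq p q => p.Wf && q.Wf
  | ite e p q => e.Wf && p.Wf && q.Wf
  | .while e p => e.Wf && p.Wf

def compile : AProg → Prog
  | set d e => .seq (e.compile 100) (.op .or d 100 100)
  | st k i e => .seq (i.compile 100) <| .seq (addrProg k 100) <| .seq (e.compile 101) <|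
      .store 100 101
  | seq p q => .seq p.compile q.compile
  | ite e p q => .seq (e.compile 100) (.cond 100 p.compile q.compile)
  | .while e p => .seq (e.compile 100) (.loop 100 (.seq p.compile (e.compile 100)))

/-- The number of machine steps per step of the structured program. -/
def factor : AProg → ℕ
  | set _ e => e.cost + 1
  | st _ i e => i.cost + e.cost + 10
  | seq p q => max p.factor q.factor
  | ite e p q => max (e.cost + 1) (max p.factor q.factor)
  | .while e p => max (e.cost + 1) p.factor

/-- The slowdown is the largest cost of a single statement or test, since `Run` counts one step for
each of them. -/
theorem Run.exec_compile {w : ℕ} (hw : 7 ≤ w) {p : AProg} {h h' : AState} {t : ℕ}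
    (r : Run w p h h' t) (hp : p.Wf = true) {K : ℕ} (hK : p.factor ≤ K) {s : State}
    (V : View w s h) : ∃ s' t', Exec w p.compile s s' t' ∧ View w s' h' ∧ t' ≤ K * t := by
  induction r generalizing s with
  | @set d e h ho =>
    simp only [Wf, Bool.and_eq_true, decide_eq_true_eq] at hp
    obtain ⟨s1, x1, V1, r1, -⟩ := e.exec_compile hw hp.2 ho V le_rfl
    have : BinOp.eval w .or (s1.reg 100) (s1.reg 100) = e.ev w h := by
      rw [BinOp.eval_eq_val (o := .or) (by omega) (V1.reg_lt _) (V1.reg_lt _) trivial, r1]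
      simp [BinOp.val, BinOp.raw]
    refine ⟨_, _, .seq x1 (.op _ _ _ _ _), ?_, by simpa [factor] using hK⟩
    rw [this]
    exact V1.setVar (by rw [← r1]; exact V1.reg_lt _)
  | @st k i e h oi oe hi =>
    simp only [Wf, Bool.and_eq_true, decide_eq_true_eq] at hp
    obtain ⟨s1, x1, V1, r1, -⟩ := i.exec_compile hw hp.1.2 oi V le_rfl
    obtain ⟨s2, x2, V2, r2, -⟩ := exec_addrProg hw V1 hp.1.1 le_rfl hi r1
    obtain ⟨s3, x3, V3, r3, k3⟩ := e.exec_compile hw hp.2 oe V2 (d := 101) (by omega)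
    refine ⟨_, _, .seq x1 (.seq x2 (.seq x3 (.store _ _ _))), ?_, ?_⟩
    · rw [k3 100 (by omega), r2, r3]
      exact V3.setArr hp.1.1 (by rw [← r3]; exact V3.reg_lt _)
    · simp only [factor] at hK; omega
  | seq _ _ ih ih' =>
    simp only [Wf, Bool.and_eq_true] at hp
    simp only [factor, max_le_iff] at hK
    obtain ⟨s1, t1, x1, V1, l1⟩ := ih hp.1 hK.1 V
    obtain ⟨s2, t2, x2, V2, l2⟩ := ih' hp.2 hK.2 V1
    exact ⟨s2, _, .seq x1 x2, V2, by rw [mul_add]; omega⟩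
  | @ite_true e p q h h' t ho hne _ ih =>
    simp only [Wf, Bool.and_eq_true] at hp
    simp only [factor, max_le_iff] at hK
    obtain ⟨s1, x1, V1, r1, -⟩ := e.exec_compile hw hp.1.1 ho V le_rfl
    obtain ⟨s2, t2, x2, V2, l2⟩ := ih hp.1.2 hK.2.1 V1
    exact ⟨s2, _, .seq x1 (.cond_true (by rwa [r1]) x2), V2, by rw [mul_add]; omega⟩
  | @ite_false e p q h h' t ho hne _ ih =>
    simp only [Wf, Bool.and_eq_true] at hp
    simp only [factor, max_le_iff] at hK
    obtain ⟨s1, x1, V1, r1, -⟩ := e.exec_compile hw hp.1.1 ho V le_rfl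
    obtain ⟨s2, t2, x2, V2, l2⟩ := ih hp.2 hK.2.2 V1
    exact ⟨s2, _, .seq x1 (.cond_false (by rwa [r1]) x2), V2, by rw [mul_add]; omega⟩
  | @while_done e p h ho hz =>
    simp only [Wf, Bool.and_eq_true] at hp
    simp only [factor, max_le_iff] at hK
    obtain ⟨s1, x1, V1, r1, -⟩ := e.exec_compile hw hp.1 ho V le_rfl
    exact ⟨s1, _, .seq (t' := 1) x1 (by constructor; rw [r1, hz]), V1, by omega⟩
  | @while_step e p h h' h'' t t' ho hne _ _ ih ih' =>
    have hp' := hp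
    simp only [Wf, Bool.and_eq_true] at hp
    have hK' := hK
    simp only [factor, max_le_iff] at hK
    obtain ⟨s1, x1, V1, r1, -⟩ := e.exec_compile hw hp.1 ho V le_rfl
    obtain ⟨s2, t2, x2, V2, l2⟩ := ih hp.2 hK.2 V1
    obtain ⟨s3, t3, x3, V3, l3⟩ := ih' hp' hK' V2
    -- The compiled loop tests before entering and again after each pass; the entering test of the
    -- remaining loop is the closing test of the pass just made.
    simp only [compile] at x3
    cases x3 with
    | seq y z =>
      refine ⟨s3, _, .seq x1 (.loop_step (by rwa [r1]) (.seq x2 y) z), V3, ?_⟩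
      rw [mul_add, mul_add]; omega

/-! ### Total correctness with running time -/

/-- The program halts with a final state and a number of steps that satisfy `Q`. -/
def Runs (w : ℕ) (p : AProg) (h : AState) (Q : AState → ℕ → Prop) : Prop :=
  ∃ h' t, Run w p h h' t ∧ Q h' t

variable {w : ℕ} {h : AState} {Q : AState → ℕ → Prop} {p q : AProg} {e i : AExp}

theorem Runs.mono {Q' : AState → ℕ → Prop} (r : Runs w p h Q) (H : ∀ h' t, Q h' t → Q' h' t) :
    Runs w p h Q' :=
  let ⟨h', t, x, y⟩ := r; ⟨h', t, x, H _ _ y⟩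

/-- As rewrite rules, this and the next two equivalences reduce straight-line code to its bound
conditions and a claim about an explicit final state. -/
theorem runs_set {d : ℕ} : Runs w (.set d e) h Q ↔ e.Ok w h ∧ Q (h.setVar d (e.ev w h)) 1 := by
  constructor
  · rintro ⟨h', t, x, y⟩; cases x; exact ⟨by assumption, y⟩
  · rintro ⟨x, y⟩; exact ⟨_, _, .set x, y⟩

theorem runs_st {k : ℕ} : Runs w (.st k i e) h Q ↔ i.Ok w h ∧ e.Ok w h ∧ i.ev w h < lim w ∧
    Q (h.setArr k (i.ev w h) (e.ev w h)) 1 := by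
  constructor
  · rintro ⟨h', t, x, y⟩; cases x; exact ⟨by assumption, by assumption, by assumption, y⟩
  · rintro ⟨x, y, z, u⟩; exact ⟨_, _, .st x y z, u⟩

theorem runs_seq : Runs w (p;;q) h Q ↔
    Runs w p h fun h1 t1 => Runs w q h1 fun h2 t2 => Q h2 (t1 + t2) := by
  constructor
  · rintro ⟨h', t, x, y⟩
    cases x with
    | seq x1 x2 => exact ⟨_, _, x1, _, _, x2, y⟩
  · rintro ⟨h1, t1, x1, h2, t2, x2, y⟩; exact ⟨_, _, .seq x1 x2, y⟩

theorem runs_ite_of_ne (ho : e.Ok w h) (hne : e.ev w h ≠ 0)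
    (H : Runs w p h fun h' t => Q h' (t + 1)) : Runs w (.ite e p q) h Q := by
  obtain ⟨h', t, x, y⟩ := H; exact ⟨_, _, .ite_true ho hne x, y⟩

theorem runs_ite_of_eq (ho : e.Ok w h) (hz : e.ev w h = 0)
    (H : Runs w q h fun h' t => Q h' (t + 1)) : Runs w (.ite e p q) h Q := by
  obtain ⟨h', t, x, y⟩ := H; exact ⟨_, _, .ite_false ho hz x, y⟩

theorem runs_while_of_eq (ho : e.Ok w h) (hz : e.ev w h = 0) (H : Q h 1) :
    Runs w (.while e p) h Q :=
  ⟨_, _, .while_done ho hz, H⟩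

theorem runs_while_of_ne (ho : e.Ok w h) (hne : e.ev w h ≠ 0)
    (H : Runs w p h fun h1 t1 => Runs w (.while e p) h1 fun h2 t2 => Q h2 (t1 + t2 + 1)) :
    Runs w (.while e p) h Q := by
  obtain ⟨h', t, x, h'', t', x', y⟩ := H; exact ⟨_, _, .while_step ho hne x x', y⟩

end AProg

end WordRAM

/-! ## Ordered forests and linked Euler tours -/

/-- Finite ordered forests: `node M c r` is the tree with root `M` over the forest `c`, followed by
the forest `r`. -/
inductive Grove
  | nil
  | node (M : ℕ) (c r : Grove)

namespace Grove

def verts : Grove → List ℕ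
  | nil => []
  | node M c r => M :: (c.verts ++ r.verts)

/-- The Euler tour; `2 * M` opens and `2 * M + 1` closes the node `M`. -/
def tour : Grove → List ℕ
  | nil => []
  | node M c r => 2 * M :: (c.tour ++ (2 * M + 1) :: r.tour)

/-- Adds the leaf `y` below `p`. -/
def ins (p y : ℕ) : Grove → Grove
  | nil => nil
  | node M c r => if M = p then node M (node y nil c) r else node M (c.ins p y) (r.ins p y)

/-- The forest below the node `x`. -/
def sub (x : ℕ) : Grove → Grove
  | nil => nil
  | node M c r => if M = x then c else if x ∈ c.verts then c.sub x else r.sub x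

/-- Removes the tree rooted at `x`. -/
def del (x : ℕ) : Grove → Grove
  | nil => nil
  | node M c r => if M = x then r else node M (c.del x) (r.del x)

/-- All roots have parent `t` with respect to `up`, and all other nodes their true parents. -/
def Anchored (up : ℕ → ℕ) : ℕ → Grove → Prop
  | _, nil => True
  | t, node M c r => up M = t ∧ Anchored up M c ∧ Anchored up t r

variable {up : ℕ → ℕ} {x y p t : ℕ}

theorem mem_tour {f : Grove} : t ∈ f.tour ↔ t / 2 ∈ f.verts := by
  induction f with
  | nil => simp [tour, verts]
  | node M c r ihc ihr =>
    simp only [tour, verts, List.mem_cons, List.mem_append, ihc, ihr]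
    constructor
    · rintro (h | h | h | h)
      · left; omega
      · tauto
      · left; omega
      · tauto
    · rintro (h | h | h)
      · rcases Nat.mod_two_eq_zero_or_one t with e | e
        · left; omega
        · right; right; left; omega
      · tauto
      · tauto

theorem length_tour (f : Grove) : f.tour.length = 2 * f.verts.length := by
  induction f with
  | nil => rfl
  | node M c r ihc ihr => simp [tour, verts, ihc, ihr]; omega

theorem nodup_tour {f : Grove} (h : f.verts.Nodup) : f.tour.Nodup := by
  induction f with
  | nil => simp [tour]
  | node M c r ihc ihr =>
    simp only [verts, List.nodup_cons, List.nodup_append, List.mem_append, not_or] at h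
    obtain ⟨⟨h1, h2⟩, h3, h4, h5⟩ := h
    simp only [tour, List.nodup_cons, List.nodup_append, List.mem_append, List.mem_cons, not_or,
      mem_tour]
    refine ⟨⟨?_, ?_, ?_⟩, ihc h3, ⟨?_, ihr h4⟩, ?_⟩
    · rwa [Nat.mul_div_cancel_left _ (by omega)]
    · omega
    · rwa [Nat.mul_div_cancel_left _ (by omega)]
    · rwa [show (2 * M + 1) / 2 = M by omega]
    · rintro a ha b (rfl | hb) rfl
      · rw [show (2 * M + 1) / 2 = M by omega] at ha; exact h1 ha
      · exact h5 _ ha _ hb rfl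

theorem del_of_notMem {f : Grove} (h : x ∉ f.verts) : f.del x = f := by
  induction f with
  | nil => rfl
  | node M c r ihc ihr =>
    simp only [verts, List.mem_cons, List.mem_append, not_or] at h
    rw [del, if_neg (Ne.symm h.1), ihc h.2.1, ihr h.2.2]

theorem ins_of_notMem {f : Grove} (h : p ∉ f.verts) : f.ins p y = f := by
  induction f with
  | nil => rfl
  | node M c r ihc ihr =>
    simp only [verts, List.mem_cons, List.mem_append, not_or] at h
    rw [ins, if_neg (Ne.symm h.1), ihc h.2.1, ihr h.2.2]

theorem verts_ins {f : Grove} (hn : f.verts.Nodup) (h : p ∈ f.verts) :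
    (f.ins p y).verts.Perm (y :: f.verts) := by
  induction f with
  | nil => simp [verts] at h
  | node M c r ihc ihr =>
    rw [ins]
    simp only [verts, List.nodup_cons, List.nodup_append, List.mem_append, not_or,
      List.mem_cons] at h hn
    split_ifs with e
    · simp only [verts, List.nil_append, List.cons_append]
      exact List.Perm.swap _ _ _
    · rcases h with h | h | h
      · exact absurd h.symm e
      · have : p ∉ r.verts := fun h' => hn.2.2.2 _ h _ h' rfl
        rw [ins_of_notMem this]
        simp only [verts]
        refine (List.Perm.cons M ((ihc hn.2.1 h).append_right _)).trans ?_
        simpa using List.Perm.swap _ _ _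
      · have : p ∉ c.verts := fun h' => hn.2.2.2 _ h' _ h rfl
        rw [ins_of_notMem this]
        simp only [verts]
        refine (List.Perm.cons M (((ihr hn.2.2.1 h).append_left _).trans
          List.perm_middle)).trans ?_
        exact List.Perm.swap _ _ _

/-- As `ins` adds a first child, the tour only gains two adjacent entries right after the opening of
`p`. -/
theorem tour_ins {f : Grove} (hn : f.verts.Nodup) (h : p ∈ f.verts) :
    ∃ A B, f.tour = A ++ 2 * p :: B ∧
      (f.ins p y).tour = A ++ 2 * p :: 2 * y :: (2 * y + 1) :: B := by
  induction f with
  | nil => simp [verts] at h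
  | node M c r ihc ihr =>
    rw [ins]
    simp only [verts, List.nodup_cons, List.nodup_append, List.mem_append, not_or,
      List.mem_cons] at h hn
    split_ifs with e
    · subst e
      exact ⟨[], _, rfl, by simp [tour]⟩
    · rcases h with h | h | h
      · exact absurd h.symm e
      · have : p ∉ r.verts := fun h' => hn.2.2.2 _ h _ h' rfl
        rw [ins_of_notMem this]
        obtain ⟨A, B, e1, e2⟩ := ihc hn.2.1 h
        exact ⟨2 * M :: A, B ++ (2 * M + 1) :: r.tour, by simp [tour, e1], by simp [tour, e2]⟩
      · have : p ∉ c.verts := fun h' => hn.2.2.2 _ h' _ h rfl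
        rw [ins_of_notMem this]
        obtain ⟨A, B, e1, e2⟩ := ihr hn.2.2.1 h
        exact ⟨2 * M :: (c.tour ++ (2 * M + 1) :: A), B, by simp [tour, e1], by simp [tour, e2]⟩

theorem Anchored.ins {f : Grove} (hy : up y = p) (h : Anchored up t f) :
    Anchored up t (f.ins p y) := by
  induction f generalizing t with
  | nil => trivial
  | node M c r ihc ihr =>
    obtain ⟨h1, h2, h3⟩ := h
    rw [Grove.ins]
    split_ifs with e
    · subst e; exact ⟨h1, ⟨hy, trivial, h2⟩, h3⟩
    · exact ⟨h1, ihc h2, ihr h3⟩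

theorem verts_del {f : Grove} (hn : f.verts.Nodup) (h : x ∈ f.verts) :
    f.verts.Perm ((node x (f.sub x) nil).verts ++ (f.del x).verts) := by
  induction f with
  | nil => simp [verts] at h
  | node M c r ihc ihr =>
    rw [sub, del]
    simp only [verts, List.nodup_cons, List.nodup_append, List.mem_append, not_or,
      List.mem_cons] at h hn
    simp only [verts, List.append_nil] at ihc ihr ⊢
    split_ifs with e h'
    · subst e; exact List.Perm.refl _
    · have : x ∉ r.verts := fun h'' => hn.2.2.2 _ h' _ h'' rfl
      rw [del_of_notMem this]
      simp only [verts]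
      refine (List.Perm.cons M ((ihc hn.2.1 h').append_right _)).trans ?_
      rw [List.append_assoc]
      exact (List.perm_middle (l₁ := x :: (c.sub x).verts)).symm
    · have h : x ∈ r.verts := by
        rcases h with h | h | h
        exacts [absurd h.symm e, absurd h h', h]
      rw [del_of_notMem h']
      simp only [verts]
      refine (List.Perm.cons M (((ihr hn.2.2.1 h).append_left _))).trans ?_
      refine List.Perm.trans ?_ (List.perm_middle (l₁ := x :: (r.sub x).verts)).symm
      refine List.Perm.cons M ?_
      rw [← List.append_assoc, ← List.append_assoc]
      exact (List.perm_append_comm).append_right _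

/-- The tour of a subtree is a contiguous segment of the whole tour, so that a subtree can be
removed with two pointer changes. -/
theorem tour_del {f : Grove} (hn : f.verts.Nodup) (h : x ∈ f.verts) :
    ∃ A B, f.tour = A ++ (node x (f.sub x) nil).tour ++ B ∧ (f.del x).tour = A ++ B := by
  induction f with
  | nil => simp [verts] at h
  | node M c r ihc ihr =>
    rw [sub, del]
    simp only [verts, List.nodup_cons, List.nodup_append, List.mem_append, not_or,
      List.mem_cons] at h hn
    split_ifs with e h'
    · subst e; exact ⟨[], r.tour, by simp [tour], rfl⟩
    · have : x ∉ r.verts := fun h'' => hn.2.2.2 _ h' _ h'' rfl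
      rw [del_of_notMem this]
      obtain ⟨A, B, e1, e2⟩ := ihc hn.2.1 h'
      exact ⟨2 * M :: A, B ++ (2 * M + 1) :: r.tour, by rw [tour, e1]; simp, by simp [tour, e2]⟩
    · have h : x ∈ r.verts := by
        rcases h with h | h | h
        exacts [absurd h.symm e, absurd h h', h]
      rw [del_of_notMem h']
      obtain ⟨A, B, e1, e2⟩ := ihr hn.2.2.1 h
      exact ⟨2 * M :: (c.tour ++ (2 * M + 1) :: A), B, by rw [tour, e1]; simp, by simp [tour, e2]⟩

theorem Anchored.sub {f : Grove} (h : Anchored up t f) : Anchored up x (f.sub x) := by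
  induction f generalizing t with
  | nil => trivial
  | node M c r ihc ihr =>
    obtain ⟨h1, h2, h3⟩ := h
    rw [Grove.sub]
    split_ifs with e
    · subst e; exact h2
    · exact ihc h2
    · exact ihr h3

theorem Anchored.del {f : Grove} (h : Anchored up t f) : Anchored up t (f.del x) := by
  induction f generalizing t with
  | nil => trivial
  | node M c r ihc ihr =>
    obtain ⟨h1, h2, h3⟩ := h
    rw [Grove.del]
    split_ifs with e
    · exact h3
    · exact ⟨h1, ihc h2, ihr h3⟩

theorem Anchored.congr {up' : ℕ → ℕ} {f : Grove} (h : Anchored up t f)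
    (H : ∀ M ∈ f.verts, up' M = up M) : Anchored up' t f := by
  induction f generalizing t with
  | nil => trivial
  | node M c r ihc ihr =>
    obtain ⟨h1, h2, h3⟩ := h
    simp only [verts, List.mem_cons, List.mem_append] at H
    exact ⟨by rw [H M (.inl rfl), h1], ihc h2 fun M h => H M (.inr (.inl h)),
      ihr h3 fun M h => H M (.inr (.inr h))⟩

/-- A property passes from `t` down to all nodes of a forest that is anchored at `t`. -/
theorem Anchored.forall_verts {P : ℕ → Prop} {f : Grove} (h : Anchored up t f) (ht : P t)
    (H : ∀ M ∈ f.verts, P (up M) → P M) : ∀ M ∈ f.verts, P M := by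
  induction f generalizing t with
  | nil => simp [verts]
  | node M c r ihc ihr =>
    obtain ⟨h1, h2, h3⟩ := h
    simp only [verts, List.mem_cons, List.mem_append] at H ⊢
    have hM : P M := H M (.inl rfl) (h1 ▸ ht)
    rintro N (rfl | h | h)
    · exact hM
    · exact ihc h2 hM (fun N h => H N (.inr (.inl h))) N h
    · exact ihr h3 ht (fun N h => H N (.inr (.inr h))) N h

end Grove

/-! ### Doubly linked lists -/

/-- In a doubly linked list `b` comes immediately after `a`. -/
def Link (nx pv : ℕ → ℕ) (a b : ℕ) : Prop := nx a = b ∧ pv b = a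

/-- The successor of the last entry and the predecessor of the first are irrelevant, hence the ends
of a list may be relinked freely. -/
theorem Link.isChain_congr {nx pv nx' pv' : ℕ → ℕ} {L : List ℕ} (h : L.IsChain (Link nx pv))
    (h1 : ∀ a ∈ L.dropLast, nx' a = nx a) (h2 : ∀ b ∈ L.tail, pv' b = pv b) :
    L.IsChain (Link nx' pv') := by
  induction L with
  | nil => exact .nil
  | cons a L ih =>
    cases L with
    | nil => exact .singleton _
    | cons b L =>
      rw [List.isChain_cons_cons] at h ⊢
      simp only [List.dropLast_cons_cons, List.mem_cons, List.tail_cons] at h1 h2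
      refine ⟨⟨by rw [h1 a (.inl rfl), h.1.1], by rw [h2 b (.inl rfl), h.1.2]⟩, ih h.2 ?_ ?_⟩
      · intro c hc; exact h1 c (.inr hc)
      · intro c hc; exact h2 c (.inr hc)

theorem Link.isChain_congr' {nx pv nx' pv' : ℕ → ℕ} {L : List ℕ} (h : L.IsChain (Link nx pv))
    (h1 : ∀ a ∈ L, nx' a = nx a) (h2 : ∀ b ∈ L, pv' b = pv b) :
    L.IsChain (Link nx' pv') :=
  Link.isChain_congr h (fun a ha => h1 a (List.mem_of_mem_dropLast ha))
    (fun b hb => h2 b (List.mem_of_mem_tail hb))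

theorem List.isChain_append_cons {α : Type*} {R : α → α → Prop} {A B : List α} {a b : α} :
    (A ++ a :: b :: B).IsChain R ↔ (A ++ [a]).IsChain R ∧ R a b ∧ (b :: B).IsChain R := by
  rw [List.isChain_append, List.isChain_append, List.isChain_cons_cons]
  simp
  tauto

/-- Linking `a` directly to `b` detaches the segment `m`. Both lists remain valid, because the two
changed pointers do not belong to entries of `m`. -/
theorem Link.isChain_splice {nx pv : ℕ → ℕ} {A B : List ℕ} {m : List ℕ} {a b : ℕ}
    (h : (A ++ a :: (m ++ b :: B)).IsChain (Link nx pv)) (hn : (A ++ a :: (m ++ b :: B)).Nodup) :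
    m.IsChain (Link (Function.update nx a b) (Function.update pv b a)) ∧
    (A ++ a :: b :: B).IsChain (Link (Function.update nx a b) (Function.update pv b a)) := by
  have h' : ((A ++ [a]) ++ (m ++ b :: B)).IsChain (Link nx pv) := by simpa using h
  simp only [List.isChain_append (l₁ := A ++ [a])] at h'
  obtain ⟨h1, h2, -⟩ := h'
  rw [List.isChain_append] at h2
  obtain ⟨h2, h3, -⟩ := h2
  simp only [List.nodup_append, List.nodup_cons, List.mem_append, List.mem_cons, not_or] at hn
  obtain ⟨hA, ⟨⟨ham, hab, haB⟩, hm, ⟨hbB, hB⟩, hmb⟩, hAa⟩ := hn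
  refine ⟨?_, List.isChain_append_cons.2 ⟨?_, ⟨by simp, by simp⟩, ?_⟩⟩
  · refine Link.isChain_congr' h2 ?_ ?_
    · intro u hu
      refine Function.update_of_ne ?_ _ _
      rintro rfl
      exact ham hu
    · intro u hu; exact Function.update_of_ne (fun e => hmb _ hu _ (.inl rfl) e) _ _
  · refine Link.isChain_congr h1 ?_ ?_
    · intro u hu
      rw [List.dropLast_concat] at hu
      exact Function.update_of_ne (hAa _ hu _ (.inl rfl)) _ _
    · intro u hu
      have := List.mem_of_mem_tail hu
      simp only [List.mem_append, List.mem_singleton] at this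
      refine Function.update_of_ne ?_ _ _
      rcases this with h | rfl
      · exact hAa _ h _ (.inr (.inr (.inl rfl)))
      · exact hab
  · refine Link.isChain_congr h3 ?_ ?_
    · intro u hu
      have := List.mem_of_mem_dropLast hu
      refine Function.update_of_ne ?_ _ _
      rintro rfl
      simp only [List.mem_cons] at this
      tauto
    · intro u hu
      refine Function.update_of_ne ?_ _ _
      rintro rfl
      exact hbB hu

/-! ### Components of a forest with cut edges -/

/-- The decomposition of the nodes in `full` into the components that remain when the edges from
the nodes in `cut` to their parents are removed. Every component has a label, and its Euler tour is
a doubly linked list. -/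
structure Components (full cut : ℕ → Prop) (up lab top nx pv : ℕ → ℕ) (tr : ℕ → Grove) : Prop where
  mem : ∀ l M, M ∈ (tr l).verts ↔ full M ∧ lab M = l
  nodup : ∀ l, (tr l).verts.Nodup
  chain : ∀ l, (tr l).tour.IsChain (Link nx pv)
  root : ∀ l, tr l ≠ .nil → ∃ c, tr l = .node (top l) c .nil ∧ cut (top l) ∧
    c.Anchored up (top l) ∧ ∀ M ∈ c.verts, ¬ cut M
  label : ∀ l, tr l ≠ .nil → full l ∧ cut l

namespace Components

variable {full cut : ℕ → Prop} {up lab top nx pv : ℕ → ℕ} {tr : ℕ → Grove}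

theorem congr (H : Components full cut up lab top nx pv tr) {full' cut' : ℕ → Prop} {up' : ℕ → ℕ}
    (h1 : ∀ M, full' M ↔ full M) (h2 : ∀ M, full M → (cut' M ↔ cut M))
    (h3 : ∀ M, full M → up' M = up M) : Components full' cut' up' lab top nx pv tr where
  mem l M := by rw [H.mem, h1]
  nodup := H.nodup
  chain := H.chain
  root l hl := by
    obtain ⟨c, e, h4, h5, h6⟩ := H.root l hl
    have hf : ∀ M ∈ (tr l).verts, full M := fun M hM => ((H.mem l M).1 hM).1
    rw [e] at hf
    simp only [Grove.verts, List.append_nil, List.mem_cons, forall_eq_or_imp] at hf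
    exact ⟨c, e, (h2 _ hf.1).2 h4, h5.congr fun M hM => h3 M (hf.2 M hM),
      fun M hM => by rw [h2 M (hf.2 M hM)]; exact h6 M hM⟩
  label l hl := by
    obtain ⟨h4, h5⟩ := H.label l hl
    exact ⟨(h1 l).2 h4, (h2 l h4).2 h5⟩

theorem tr_ne_nil (H : Components full cut up lab top nx pv tr) {M : ℕ} (h : full M) :
    tr (lab M) ≠ .nil := by
  intro e
  have := (H.mem (lab M) M).2 ⟨h, rfl⟩
  simp [e, Grove.verts] at this

theorem eq_nil (H : Components full cut up lab top nx pv tr) {l : ℕ} (h : ¬ (full l ∧ cut l)) :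
    tr l = .nil :=
  by_contra fun e => h (H.label l e)

/-- The root of the component of `M`. -/
theorem top_spec (H : Components full cut up lab top nx pv tr) {M : ℕ} (h : full M) :
    full (top (lab M)) ∧ cut (top (lab M)) := by
  obtain ⟨c, e, h4, -⟩ := H.root _ (H.tr_ne_nil h)
  refine ⟨((H.mem (lab M) _).1 ?_).1, h4⟩
  rw [e]; simp [Grove.verts]

/-- A property passes from the top of a component down to `M`, since no edge on this way is cut. It
justifies the jump to the top in a query. -/
theorem top_induct (H : Components full cut up lab top nx pv tr) {P : ℕ → Prop} {M : ℕ} (h : full M)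
    (h0 : P (top (lab M))) (h1 : ∀ M, full M → ¬ cut M → P (up M) → P M) : P M := by
  obtain ⟨c, e, -, h5, h6⟩ := H.root _ (H.tr_ne_nil h)
  have hM := (H.mem (lab M) M).2 ⟨h, rfl⟩
  have hf : ∀ N ∈ (tr (lab M)).verts, full N := fun N hN => ((H.mem _ N).1 hN).1
  rw [e] at hM hf
  simp only [Grove.verts, List.append_nil, List.mem_cons, forall_eq_or_imp] at hM hf
  rcases hM with hM | hM
  · rwa [hM]
  · exact h5.forall_verts h0 (fun N hN => h1 N (hf.2 N hN) (h6 N hN)) M hM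

theorem full_of_mem_tour (H : Components full cut up lab top nx pv tr) {l t : ℕ}
    (h : t ∈ (tr l).tour) : full (t / 2) ∧ lab (t / 2) = l :=
  (H.mem _ _).1 (Grove.mem_tour.1 h)

/-- The name `m` is a free label because labels are full nodes and `m` was not full. -/
theorem insertRoot (H : Components full cut up lab top nx pv tr) {m : ℕ} (hm : ¬ full m) (hc : cut m) :
    Components (fun M => full M ∨ M = m) cut up (Function.update lab m m) (Function.update top m m)
      (Function.update nx (2 * m) (2 * m + 1)) (Function.update pv (2 * m + 1) (2 * m))
      (Function.update tr m (.node m .nil .nil)) := by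
  have e0 : tr m = .nil := H.eq_nil fun h => hm h.1
  have hl : ∀ M, full M → lab M ≠ m := by
    intro M h1 h2
    have := (H.mem m M).2 ⟨h1, h2⟩
    simp [e0, Grove.verts] at this
  refine ⟨?_, ?_, ?_, ?_, ?_⟩
  · intro l M
    by_cases e : l = m
    · subst e
      simp only [Function.update_self, Grove.verts, List.append_nil, List.mem_singleton]
      constructor
      · rintro rfl; simp
      · rintro ⟨h1 | h1, h2⟩
        · rw [Function.update_of_ne (by rintro rfl; exact hm h1)] at h2
          exact absurd h2 (hl M h1)
        · exact h1
    · rw [Function.update_of_ne e, H.mem]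
      by_cases e' : M = m
      · subst e'
        simp [hm, Ne.symm e]
      · rw [Function.update_of_ne e']; simp [e']
  · intro l
    by_cases e : l = m
    · subst e; simp [Grove.verts]
    · rw [Function.update_of_ne e]; exact H.nodup l
  · intro l
    by_cases e : l = m
    · subst e
      simp [Grove.tour, Link]
    · rw [Function.update_of_ne e]
      refine Link.isChain_congr' (H.chain l) ?_ ?_
      · intro a ha
        refine Function.update_of_ne ?_ _ _
        rintro rfl
        have := (H.full_of_mem_tour ha).1
        rw [Nat.mul_div_cancel_left _ (by omega)] at this; exact hm this
      · intro a ha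
        refine Function.update_of_ne ?_ _ _
        rintro rfl
        have := (H.full_of_mem_tour ha).1
        rw [show (2 * m + 1) / 2 = m by omega] at this; exact hm this
  · intro l
    by_cases e : l = m
    · subst e
      rw [Function.update_self, Function.update_self]
      exact fun _ => ⟨.nil, rfl, hc, trivial, by simp [Grove.verts]⟩
    · rw [Function.update_of_ne e, Function.update_of_ne e]; exact H.root l
  · intro l
    by_cases e : l = m
    · subst e; exact fun _ => ⟨.inr rfl, hc⟩
    · rw [Function.update_of_ne e]
      exact fun h => ⟨.inl (H.label l h).1, (H.label l h).2⟩

/-- The entries `2 * m` and `2 * m + 1` are inserted right after the opening of `q`, which makes `m`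
its first child. -/
theorem insertLeaf (H : Components full cut up lab top nx pv tr) {m q : ℕ} (hm : ¬ full m)
    (hc : ¬ cut m) (hq : full q) (hu : up m = q) :
    Components (fun M => full M ∨ M = m) cut up (Function.update lab m (lab q)) top
      (Function.update (Function.update (Function.update nx (2 * q) (2 * m)) (2 * m) (2 * m + 1))
        (2 * m + 1) (nx (2 * q)))
      (Function.update (Function.update (Function.update pv (2 * m) (2 * q)) (2 * m + 1) (2 * m))
        (nx (2 * q)) (2 * m + 1))
      (Function.update tr (lab q) ((tr (lab q)).ins q m)) := by
  have hmq : m ≠ q := fun e => hm (e ▸ hq)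
  have hq' : q ∈ (tr (lab q)).verts := (H.mem _ _).2 ⟨hq, rfl⟩
  obtain ⟨A, B, e1, e2⟩ := Grove.tour_ins (y := m) (H.nodup _) hq'
  have hv := Grove.verts_ins (y := m) (H.nodup _) hq'
  have hmt : ∀ l t, t ∈ (tr l).tour → t / 2 ≠ m :=
    fun l t ht e => hm (e ▸ (H.full_of_mem_tour ht).1)
  have hch := H.chain (lab q)
  have hnd := Grove.nodup_tour (H.nodup (lab q))
  obtain ⟨c, er, hcr, han, hcc⟩ := H.root _ (H.tr_ne_nil hq)
  -- The tour ends with an odd entry, the closing of the top, so the opening of `q` has a successor.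
  have hBne : ∃ b B', B = b :: B' := by
    cases B with
    | cons b B' => exact ⟨b, B', rfl⟩
    | nil =>
      exfalso
      have h1 : (tr (lab q)).tour.getLast? = some (2 * q) := by rw [e1]; simp
      have h2 : (tr (lab q)).tour.getLast? = some (2 * top (lab q) + 1) := by
        rw [er]; simp [Grove.tour, List.getLast?_cons]
      rw [h1] at h2; simp at h2; omega
  obtain ⟨b, B, rfl⟩ := hBne
  have hch' := hch
  rw [e1, List.isChain_append_cons] at hch'
  obtain ⟨h1, ⟨hb, -⟩, h3⟩ := hch'
  rw [hb]
  have hbm : b / 2 ≠ m := hmt (lab q) b (by rw [e1]; simp)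
  rw [e1] at hnd
  simp only [List.nodup_append, List.nodup_cons, List.mem_cons, not_or] at hnd
  obtain ⟨hA, ⟨⟨hqb, hqB⟩, hbB, hB⟩, hAq⟩ := hnd
  have hmA : ∀ t ∈ A, t / 2 ≠ m := fun t ht => hmt (lab q) t (by rw [e1]; simp [ht])
  have hmB : ∀ t ∈ B, t / 2 ≠ m := fun t ht => hmt (lab q) t (by rw [e1]; simp [ht])
  refine ⟨?_, ?_, ?_, ?_, ?_⟩
  · intro l M
    by_cases e : l = lab q
    · subst e
      rw [Function.update_self, hv.mem_iff, List.mem_cons, H.mem]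
      by_cases e' : M = m
      · subst e'; simp
      · rw [Function.update_of_ne e']; simp [e']
    · rw [Function.update_of_ne e, H.mem]
      by_cases e' : M = m
      · subst e'; simp [hm, Ne.symm e]
      · rw [Function.update_of_ne e']; simp [e']
  · intro l
    by_cases e : l = lab q
    · subst e
      rw [Function.update_self, hv.nodup_iff, List.nodup_cons]
      exact ⟨fun h => hm ((H.mem _ _).1 h).1, H.nodup _⟩
    · rw [Function.update_of_ne e]; exact H.nodup l
  · intro l
    by_cases e : l = lab q
    · subst e
      rw [Function.update_self, e2, List.isChain_append_cons, List.isChain_cons_cons,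
        List.isChain_cons_cons]
      refine ⟨Link.isChain_congr h1 ?_ ?_, ⟨?_, ?_⟩, ⟨?_, ?_⟩, ⟨?_, ?_⟩,
        Link.isChain_congr h3 ?_ ?_⟩
      · intro u hu
        rw [List.dropLast_concat] at hu
        have h4 := hmA u hu
        have h5 := hAq _ hu _ (.inl rfl)
        rw [Function.update_of_ne (by omega), Function.update_of_ne (by omega),
          Function.update_of_ne h5]
      · intro u hu
        have h6 := List.mem_of_mem_tail hu
        simp only [List.mem_append, List.mem_singleton] at h6
        have h4 : u / 2 ≠ m := by
          rcases h6 with h | rfl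
          exacts [hmA u h, by omega]
        have h5 : u ≠ b := by
          rcases h6 with h | rfl
          exacts [hAq _ h _ (.inr (.inl rfl)), hqb]
        rw [Function.update_of_ne h5, Function.update_of_ne (by omega),
          Function.update_of_ne (by omega)]
      · rw [Function.update_of_ne (by omega), Function.update_of_ne (by omega),
          Function.update_self]
      · rw [Function.update_of_ne (by omega), Function.update_of_ne (by omega),
          Function.update_self]
      · rw [Function.update_of_ne (by omega), Function.update_self]
      · rw [Function.update_of_ne (by omega), Function.update_self]
      · rw [Function.update_self]
      · rw [Function.update_self]
      · intro u hu
        have h6 := List.mem_of_mem_dropLast hu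
        simp only [List.mem_cons] at h6
        have h4 : u / 2 ≠ m := by
          rcases h6 with rfl | h
          exacts [hbm, hmB u h]
        have h5 : u ≠ 2 * q := by
          rcases h6 with rfl | h
          exacts [Ne.symm hqb, fun e => hqB (e ▸ h)]
        rw [Function.update_of_ne (by omega), Function.update_of_ne (by omega),
          Function.update_of_ne h5]
      · intro u hu
        rw [List.tail_cons] at hu
        have h4 := hmB u hu
        have h5 : u ≠ b := fun e => hbB (e ▸ hu)
        rw [Function.update_of_ne h5, Function.update_of_ne (by omega),
          Function.update_of_ne (by omega)]
    · rw [Function.update_of_ne e]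
      refine Link.isChain_congr' (H.chain l) ?_ ?_
      · intro u hu
        have h4 := hmt l u hu
        have h5 : u ≠ 2 * q := by
          rintro rfl
          have := (H.full_of_mem_tour hu).2
          rw [Nat.mul_div_cancel_left _ (by omega)] at this; exact e this.symm
        rw [Function.update_of_ne (by omega), Function.update_of_ne (by omega),
          Function.update_of_ne h5]
      · intro u hu
        have h4 := hmt l u hu
        have h5 : u ≠ b := by
          rintro rfl
          have h6 := (H.full_of_mem_tour hu).2
          have h7 := (H.full_of_mem_tour (l := lab q) (t := u) (by rw [e1]; simp)).2
          exact e (h6.symm.trans h7)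
        rw [Function.update_of_ne h5, Function.update_of_ne (by omega),
          Function.update_of_ne (by omega)]
  · intro l
    by_cases e : l = lab q
    · subst e
      intro _
      rw [Function.update_self]
      rw [er] at hq' ⊢
      rw [Grove.ins]
      split_ifs with e
      · refine ⟨_, rfl, hcr, ⟨by rw [e]; exact hu, trivial, han⟩, ?_⟩
        simp only [Grove.verts, List.nil_append, List.mem_cons, forall_eq_or_imp]
        exact ⟨hc, hcc⟩
      · refine ⟨_, rfl, hcr, han.ins hu, ?_⟩
        simp only [Grove.verts, List.append_nil, List.mem_cons] at hq'
        have hnc := H.nodup (lab q)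
        rw [er] at hnc
        simp only [Grove.verts, List.append_nil, List.nodup_cons] at hnc
        have := Grove.verts_ins (y := m) hnc.2 (hq'.resolve_left (Ne.symm e))
        intro M hM
        rw [this.mem_iff, List.mem_cons] at hM
        rcases hM with rfl | hM
        exacts [hc, hcc M hM]
    · rw [Function.update_of_ne e]; exact H.root l
  · intro l
    by_cases e : l = lab q
    · subst e
      intro _
      obtain ⟨h4, h5⟩ := H.label _ (H.tr_ne_nil hq)
      exact ⟨.inl h4, h5⟩
    · rw [Function.update_of_ne e]
      exact fun h => ⟨.inl (H.label l h).1, (H.label l h).2⟩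

/-- The Euler tours of the two parts into which the component of `x` falls when the edge above `x`
is removed. -/
theorem split (H : Components full cut up lab top nx pv tr) {x : ℕ} (hx : full x) (hc : ¬ cut x) :
    ∃ c cs cd : Grove,
      tr (lab x) = .node (top (lab x)) c .nil ∧
      (tr (lab x)).verts.Perm ((Grove.node x cs .nil).verts ++
        (Grove.node (top (lab x)) cd .nil).verts) ∧
      cs.Anchored up x ∧ cd.Anchored up (top (lab x)) ∧
      (∀ M ∈ cs.verts, ¬ cut M ∧ M ≠ x) ∧ (∀ M ∈ cd.verts, ¬ cut M ∧ M ≠ x) ∧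
      (Grove.node x cs .nil).tour.IsChain
        (Link (Function.update nx (pv (2 * x)) (nx (2 * x + 1)))
          (Function.update pv (nx (2 * x + 1)) (pv (2 * x)))) ∧
      (Grove.node (top (lab x)) cd .nil).tour.IsChain
        (Link (Function.update nx (pv (2 * x)) (nx (2 * x + 1)))
          (Function.update pv (nx (2 * x + 1)) (pv (2 * x)))) ∧
      pv (2 * x) ∈ (tr (lab x)).tour ∧ nx (2 * x + 1) ∈ (tr (lab x)).tour := by
  obtain ⟨c, er, hcr, han, hcc⟩ := H.root _ (H.tr_ne_nil hx)
  have hxr : x ≠ top (lab x) := fun e => hc (e ▸ hcr)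
  have hx' : x ∈ c.verts := by
    have := (H.mem (lab x) x).2 ⟨hx, rfl⟩
    rw [er] at this
    simp only [Grove.verts, List.append_nil, List.mem_cons] at this
    exact this.resolve_left hxr
  have hnd := H.nodup (lab x)
  rw [er] at hnd
  simp only [Grove.verts, List.append_nil, List.nodup_cons] at hnd
  have hperm := Grove.verts_del hnd.2 hx'
  have hnd2 := hperm.nodup_iff.1 hnd.2
  simp only [Grove.verts, List.append_nil, List.cons_append, List.nodup_cons,
    List.mem_append, not_or] at hnd2
  obtain ⟨A, B, t1, t2⟩ := Grove.tour_del hnd.2 hx'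
  have hmem : ∀ M, M ∈ c.verts ↔ M = x ∨ M ∈ (c.sub x).verts ∨ M ∈ (c.del x).verts := by
    intro M; rw [hperm.mem_iff]; simp [Grove.verts]
  refine ⟨c, c.sub x, c.del x, er, ?_, han.sub, han.del, ?_, ?_, ?_⟩
  · rw [er]
    simp only [Grove.verts, List.append_nil] at hperm ⊢
    exact (hperm.cons _).trans (List.perm_middle (l₁ := x :: (c.sub x).verts)).symm
  · exact fun M hM => ⟨hcc M ((hmem M).2 (.inr (.inl hM))), fun e => hnd2.1.1 (e ▸ hM)⟩
  · exact fun M hM => ⟨hcc M ((hmem M).2 (.inr (.inr hM))), fun e => hnd2.1.2 (e ▸ hM)⟩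
  · set r := top (lab x)
    set m := (Grove.node x (c.sub x) .nil).tour with hm
    -- The entries of the root `r` enclose the segment of `x`, so there is an entry `a` before it
    -- and an entry `b` after it.
    obtain ⟨A', a, eA⟩ : ∃ A' a, 2 * r :: A = A' ++ [a] := by
      obtain h | ⟨A', a, h⟩ := List.eq_nil_or_concat (2 * r :: A)
      · simp at h
      · exact ⟨A', a, by rw [h, List.concat_eq_append]⟩
    obtain ⟨b, B', eB⟩ : ∃ b B', B ++ [2 * r + 1] = b :: B' := by
      cases B with
      | nil => exact ⟨_, _, rfl⟩
      | cons b B => exact ⟨_, _, rfl⟩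
    have et : (tr (lab x)).tour = A' ++ a :: (m ++ b :: B') := by
      rw [er, Grove.tour, t1]
      simp only [Grove.tour] at hm ⊢
      calc 2 * r :: (A ++ m ++ B ++ [2 * r + 1])
          = (2 * r :: A) ++ (m ++ (B ++ [2 * r + 1])) := by simp
        _ = _ := by rw [eA, eB]; simp
    have ed : (Grove.node r (c.del x) .nil).tour = A' ++ a :: b :: B' := by
      rw [Grove.tour, t2]
      simp only [Grove.tour]
      calc 2 * r :: (A ++ B ++ [2 * r + 1])
          = (2 * r :: A) ++ (B ++ [2 * r + 1]) := by simp
        _ = _ := by rw [eA, eB]; simp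
    have hch := H.chain (lab x)
    have hnt := Grove.nodup_tour (H.nodup (lab x))
    have hpv : pv (2 * x) = a := by
      have := hch
      rw [et, hm, Grove.tour, List.cons_append, List.isChain_append_cons] at this
      exact this.2.1.2
    have hnx : nx (2 * x + 1) = b := by
      have := hch
      rw [et, hm, Grove.tour] at this
      have e : A' ++ a :: (2 * x :: ((c.sub x).tour ++ (2 * x + 1) :: Grove.nil.tour) ++ b :: B')
          = (A' ++ a :: 2 * x :: (c.sub x).tour) ++ (2 * x + 1) :: b :: B' := by
        simp [Grove.tour]
      rw [e, List.isChain_append_cons] at this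
      exact this.2.1.1
    rw [hpv, hnx, ed]
    have := Link.isChain_splice (et ▸ hch) (et ▸ hnt)
    exact ⟨this.1, this.2, by rw [et]; simp, by rw [et]; simp⟩

/-- Removes the edge above `x` when one of the two new components (`G₁`) keeps the old label and
the other one (`G₂`) gets the label `x`. -/
theorem relabel (H : Components full cut up lab top nx pv tr) {x : ℕ} (hx : full x) (hc : ¬ cut x)
    {G₁ G₂ c₁ c₂ : Grove} {top' nx' pv' : ℕ → ℕ}
    (e₁ : G₁ = .node (top' (lab x)) c₁ .nil) (e₂ : G₂ = .node (top' x) c₂ .nil)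
    (hp : (tr (lab x)).verts.Perm (G₁.verts ++ G₂.verts))
    (a₁ : c₁.Anchored up (top' (lab x))) (a₂ : c₂.Anchored up (top' x))
    (k₁ : ∀ M ∈ c₁.verts, ¬ cut M ∧ M ≠ x) (k₂ : ∀ M ∈ c₂.verts, ¬ cut M ∧ M ≠ x)
    (r₁ : cut (top' (lab x)) ∨ top' (lab x) = x) (r₂ : cut (top' x) ∨ top' x = x)
    (l₁ : G₁.tour.IsChain (Link nx' pv')) (l₂ : G₂.tour.IsChain (Link nx' pv'))
    (ht : ∀ l, l ≠ lab x → l ≠ x → top' l = top l)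
    (hn : ∀ t, t ∉ (tr (lab x)).tour → nx' t = nx t ∧ pv' t = pv t) :
    Components full (fun M => cut M ∨ M = x) up (fun M => if M ∈ G₂.verts then x else lab M)
      top' nx' pv' (Function.update (Function.update tr (lab x) G₁) x G₂) := by
  have hxl : x ≠ lab x := fun e => hc (e ▸ (H.label _ (H.tr_ne_nil hx)).2)
  -- Labels are cut nodes and `x` was not cut, hence the label `x` is free. It may go to either
  -- part, whether or not that part contains `x`.
  have hnil : tr x = .nil := H.eq_nil fun h => hc h.2
  have hlab : ∀ M, full M → lab M ≠ x := by
    intro M h1 h2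
    have := (H.mem x M).2 ⟨h1, h2⟩
    simp [hnil, Grove.verts] at this
  have hnd := hp.nodup_iff.1 (H.nodup _)
  rw [List.nodup_append] at hnd
  obtain ⟨n1, n2, n3⟩ := hnd
  have hm : ∀ M, full M ∧ lab M = lab x ↔ M ∈ G₁.verts ∨ M ∈ G₂.verts := by
    intro M; rw [← H.mem, hp.mem_iff, List.mem_append]
  have hch : ∀ l, l ≠ lab x → (tr l).tour.IsChain (Link nx' pv') := by
    intro l hl
    have : ∀ t ∈ (tr l).tour, t ∉ (tr (lab x)).tour := fun t h1 h2 =>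
      hl ((H.full_of_mem_tour h1).2.symm.trans (H.full_of_mem_tour h2).2)
    exact Link.isChain_congr' (H.chain l) (fun t h => (hn t (this t h)).1)
      fun t h => (hn t (this t h)).2
  refine ⟨?_, ?_, ?_, ?_, ?_⟩
  · intro l M
    by_cases e : l = x
    · subst e
      rw [Function.update_self]
      split_ifs with h
      · simp [h, ((hm M).2 (.inr h)).1]
      · simp only [h, false_iff]
        rintro ⟨h1, h2⟩
        exact hlab M h1 h2
    · rw [Function.update_of_ne e]
      by_cases e' : l = lab x
      · subst e'
        rw [Function.update_self]
        split_ifs with h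
        · simp only [hxl, and_false, iff_false]
          exact fun h' => n3 _ h' _ h rfl
        · rw [hm]; simp [h]
      · rw [Function.update_of_ne e', H.mem]
        split_ifs with h
        · have := (hm M).2 (.inr h)
          simp [Ne.symm e, this.2, Ne.symm e']
        · rfl
  · intro l
    by_cases e : l = x
    · subst e; rwa [Function.update_self]
    · rw [Function.update_of_ne e]
      by_cases e' : l = lab x
      · subst e'; rwa [Function.update_self]
      · rw [Function.update_of_ne e']; exact H.nodup l
  · intro l
    by_cases e : l = x
    · subst e; rwa [Function.update_self]
    · rw [Function.update_of_ne e]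
      by_cases e' : l = lab x
      · subst e'; rwa [Function.update_self]
      · rw [Function.update_of_ne e']; exact hch l e'
  · intro l
    by_cases e : l = x
    · subst e; rw [Function.update_self]
      exact fun _ => ⟨c₂, e₂, r₂, a₂, fun M hM => by simpa using k₂ M hM⟩
    · rw [Function.update_of_ne e]
      by_cases e' : l = lab x
      · subst e'; rw [Function.update_self]
        exact fun _ => ⟨c₁, e₁, r₁, a₁, fun M hM => by simpa using k₁ M hM⟩
      · rw [Function.update_of_ne e', ht l e' e]
        intro h
        obtain ⟨c, er, hcr, han, hcc⟩ := H.root l h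
        refine ⟨c, er, .inl hcr, han, fun M hM => ?_⟩
        rintro (h' | rfl)
        · exact hcc M hM h'
        · have : M ∈ (tr l).verts := by rw [er]; simp [Grove.verts, hM]
          exact e' ((H.mem _ _).1 this).2.symm
  · intro l
    by_cases e : l = x
    · subst e; exact fun _ => ⟨hx, .inr rfl⟩
    · rw [Function.update_of_ne e]
      by_cases e' : l = lab x
      · subst e'
        obtain ⟨h1, h2⟩ := H.label _ (H.tr_ne_nil hx)
        exact fun _ => ⟨h1, .inl h2⟩
      · rw [Function.update_of_ne e']
        exact fun h => ⟨(H.label l h).1, .inl (H.label l h).2⟩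

end Components

/-! ### Evaluation rules for exact arithmetic -/

namespace WordRAM

namespace BinOp

variable (w a b : ℕ)

@[simp] theorem val_add : BinOp.add.val a b = a + b := rfl
@[simp] theorem val_sub : BinOp.sub.val a b = a - b := rfl
@[simp] theorem val_and : BinOp.and.val a b = a &&& b := rfl
@[simp] theorem val_or : BinOp.or.val a b = a ||| b := rfl
@[simp] theorem val_shl : BinOp.shl.val a b = a <<< b := rfl
@[simp] theorem val_shr : BinOp.shr.val a b = a >>> b := rfl
@[simp] theorem val_lt : BinOp.lt.val a b = if a < b then 1 else 0 := rfl
@[simp] theorem val_eq : BinOp.eq.val a b = if a = b then 1 else 0 := rfl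
@[simp] theorem fits_add : BinOp.add.Fits w a b ↔ a + b < 2 ^ w := Iff.rfl
@[simp] theorem fits_sub : BinOp.sub.Fits w a b ↔ b ≤ a := Iff.rfl
@[simp] theorem fits_and : BinOp.and.Fits w a b := trivial
@[simp] theorem fits_or : BinOp.or.Fits w a b := trivial
@[simp] theorem fits_shl : BinOp.shl.Fits w a b ↔ a <<< b < 2 ^ w := Iff.rfl
@[simp] theorem fits_shr : BinOp.shr.Fits w a b := trivial
@[simp] theorem fits_lt : BinOp.lt.Fits w a b := trivial
@[simp] theorem fits_eq : BinOp.eq.Fits w a b := trivial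

end BinOp

attribute [simp] AExp.ev AExp.Ok AProg.runs_set AProg.runs_st AProg.runs_seq

theorem lim_lt (w : ℕ) : lim w ≤ 2 ^ w := Nat.pow_le_pow_right (by norm_num) (by omega)

end WordRAM

/-! ### The potential of components -/

/-- The potential of a component with `s` nodes. -/
def phi (s : ℕ) : ℕ := ∑ i ∈ Finset.range (s + 1), Nat.log 2 i

@[simp] theorem phi_zero : phi 0 = 0 := by simp [phi]

theorem phi_succ (s : ℕ) : phi (s + 1) = phi s + Nat.log 2 (s + 1) := by
  rw [phi, Finset.sum_range_succ]; rfl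

/-- For `k < a ≤ b` the summand at `k + b + 1` exceeds the one at `k + 1` by at least one, because
`k + b + 1` is at least twice `k + 1`. -/
theorem phi_add (a b : ℕ) (h : a ≤ b) : phi a + phi b + a ≤ phi (a + b) := by
  suffices H : ∀ k ≤ a, phi k + phi b + k ≤ phi (k + b) from H a le_rfl
  intro k hk
  induction k with
  | zero => simp
  | succ k ih =>
    have h1 := ih (by omega)
    rw [phi_succ, show k + 1 + b = (k + b) + 1 by omega, phi_succ]
    have h2 : Nat.log 2 (k + 1) + 1 ≤ Nat.log 2 (k + b + 1) := by
      rw [← Nat.log_mul_base (by norm_num) (by omega)]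
      exact Nat.log_mono_right (by omega)
    omega

theorem phi_add' (a b : ℕ) : phi a + phi b + min a b ≤ phi (a + b) := by
  rcases le_total a b with h | h
  · rw [min_eq_left h]; exact phi_add a b h
  · rw [min_eq_right h, add_comm (phi a), add_comm a]; exact phi_add b a h

/-- The potential of a family of components. -/
def groveSum (N : ℕ) (tr : ℕ → Grove) : ℕ :=
  ∑ l ∈ Finset.range N, phi (tr l).verts.length

theorem groveSum_update {N : ℕ} {tr : ℕ → Grove} {l : ℕ} (hl : l < N) (G : Grove) :
    groveSum N (Function.update tr l G) + phi (tr l).verts.length =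
      groveSum N tr + phi G.verts.length := by
  have hl' := Finset.mem_range.2 hl
  unfold groveSum
  rw [← Finset.add_sum_erase _ _ hl', ← Finset.add_sum_erase (Finset.range N)
    (fun l => phi (tr l).verts.length) hl', Function.update_self]
  have : ∑ x ∈ (Finset.range N).erase l, phi (Function.update tr l G x).verts.length =
      ∑ x ∈ (Finset.range N).erase l, phi (tr x).verts.length :=
    Finset.sum_congr rfl fun x hx => by rw [Function.update_of_ne (Finset.ne_of_mem_erase hx)]
  omega

/-- A split releases at least the size of the smaller part, which is what finding and relabelling
that part costs up to a factor. -/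
theorem groveSum_split {N : ℕ} {tr : ℕ → Grove} {l x : ℕ} (hl : l < N) (hx : x < N) (hlx : x ≠ l)
    (h0 : tr x = .nil) {G₁ G₂ : Grove} (hp : (tr l).verts.Perm (G₁.verts ++ G₂.verts)) :
    groveSum N (Function.update (Function.update tr l G₁) x G₂) +
      min G₁.verts.length G₂.verts.length ≤ groveSum N tr := by
  have h1 := groveSum_update (tr := tr) hl G₁
  have h2 := groveSum_update (tr := Function.update tr l G₁) hx G₂
  rw [Function.update_of_ne hlx, h0] at h2
  have h3 := hp.length_eq
  rw [List.length_append] at h3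
  have h4 := phi_add' G₁.verts.length G₂.verts.length
  rw [h3] at h1
  simp [Grove.verts] at h2
  omega

/-- The relabelling loop omits the last tour entry. Nothing is lost, since every node is met at its
opening. -/
theorem Grove.exists_mem_dropLast_tour {M M' : ℕ} {f : Grove} :
    (M' = M ∨ ∃ t ∈ (node M f nil).tour.dropLast, t / 2 = M') ↔ M' ∈ (node M f nil).verts := by
  have e : (node M f nil).tour = (2 * M :: f.tour) ++ [2 * M + 1] := by simp [tour]
  rw [e, List.dropLast_concat]
  simp only [verts, List.append_nil, List.mem_cons]
  constructor
  · rintro (h | ⟨t, rfl | h, rfl⟩)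
    · exact .inl h
    · left; omega
    · exact .inr (mem_tour.1 h)
  · rintro (h | h)
    · exact .inl h
    · exact .inr ⟨2 * M', .inr (mem_tour.2 (by rwa [Nat.mul_div_cancel_left _ (by omega)])),
        by omega⟩

-- Arrays and the cutting of an edge

-- Indexed by forest nodes: `aPar` parent, `aMic` root of the microtree, `aBit` own bit, `aAnc` bits
-- of the ancestors in the microtree, `aHead` and `aSib` lists of children, `aStk` stack links,
-- `aOwn` handle. Indexed by microtree roots: `aMk` marks, `aNb` next free bit (`0` if full), `aSz`
-- size, and `aBase`, `aCap` the segment of `aSlot` that lists the nodes; for full microtrees also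
-- `aLab`, the label of the component. `aTop` is indexed by labels, `aNx` and `aPv` by tour entries,
-- `aIdx` by bits, `aCur` (current node) and `aHp` (parent) by handles. Variable `0` carries
-- argument and answer; `1`, `2`, `3`, `4` permanently hold the number of nodes, the used length of
-- `aSlot`, the next handle and the highest bit. Each group of programs has its own range of
-- temporaries, which is what the frame conditions express.
notation "aPar" => 0
notation "aMic" => 1
notation "aAnc" => 2
notation "aBit" => 3
notation "aHead" => 4
notation "aSib" => 5
notation "aOwn" => 6
notation "aStk" => 7
notation "aMk" => 8
notation "aNb" => 9
notation "aSz" => 10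
notation "aBase" => 11
notation "aLab" => 12
notation "aTop" => 13
notation "aSlot" => 14
notation "aIdx" => 15
notation "aNx" => 16
notation "aPv" => 17
notation "aCur" => 18
notation "aHp" => 19
notation "aCap" => 20

open WordRAM AProg

/-- Walks along the tours that start at `35` and `36` until one of them ends, at `37` or `38`. -/
def raceProg : AProg :=
  .while (.op .and (.op .eq (.op .eq (.v 35) (.v 37)) (.c 0))
      (.op .eq (.op .eq (.v 36) (.v 38)) (.c 0)))
    (.set 35 (.ld aNx (.v 35));; .set 36 (.ld aNx (.v 36)))

/-- Gives the label `30` to all nodes on the tour from `35` to `39`. -/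
def relabelProg : AProg :=
  .st aLab (.op .shr (.v 35) (.c 1)) (.v 30);;
  .while (.op .eq (.op .eq (.v 35) (.v 39)) (.c 0))
    (.st aLab (.op .shr (.v 35) (.c 1)) (.v 30);; .set 35 (.ld aNx (.v 35)))

/-- Removes the edge above the node `30` of the contracted forest. -/
def cutProg : AProg :=
  .set 31 (.ld aLab (.v 30));;
  .set 32 (.ld aTop (.v 31));;
  .set 35 (.op .add (.v 30) (.v 30));;
  .set 37 (.op .add (.v 35) (.c 1));;
  .set 36 (.op .add (.v 32) (.v 32));;
  .set 38 (.op .add (.v 36) (.c 1));;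
  .set 33 (.ld aPv (.v 35));;
  .set 34 (.ld aNx (.v 37));;
  .st aNx (.v 33) (.v 34);;
  .st aPv (.v 34) (.v 33);;
  raceProg;;
  .ite (.op .eq (.v 35) (.v 37))
    (.st aTop (.v 30) (.v 30);;
      .set 35 (.op .add (.v 30) (.v 30));;
      .set 39 (.v 37))
    (.st aTop (.v 30) (.v 32);;
      .st aTop (.v 31) (.v 30);;
      .set 35 (.op .add (.v 32) (.v 32));;
      .set 39 (.v 38));;
  relabelProg

/-- Each pass takes three steps and advances in both lists. As entries are distinct, a final entry
is met only at the end of its list, so the outcome tells which list is shorter; a tie goes to the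
first. -/
theorem runs_raceProg {w : ℕ} {X Y : ℕ} (L₁ L₂ : List ℕ) :
    ∀ (h : AState) (p q : ℕ), (p :: L₁).IsChain (Link (h.arr aNx) (h.arr aPv)) →
    (q :: L₂).IsChain (Link (h.arr aNx) (h.arr aPv)) → (p :: L₁).getLast? = some X →
    (q :: L₂).getLast? = some Y → (p :: L₁).Nodup → (q :: L₂).Nodup →
    (∀ t ∈ p :: L₁, t < lim w) → (∀ t ∈ q :: L₂, t < lim w) →
    h.var 35 = p → h.var 36 = q → h.var 37 = X → h.var 38 = Y →
    Runs w raceProg h fun h' t => h'.arr = h.arr ∧ h'.inp = h.inp ∧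
      (∀ i, i ≠ 35 → i ≠ 36 → h'.var i = h.var i) ∧
      t ≤ 3 * min L₁.length L₂.length + 1 ∧
      (h'.var 35 = X ↔ L₁.length ≤ L₂.length) := by
  induction L₁ generalizing L₂ with
  | nil =>
    intro h p q c1 c2 l1 l2 n1 n2 b1 b2 e1 e2 e3 e4
    simp only [List.getLast?_singleton, Option.some.injEq] at l1
    refine runs_while_of_eq (by simp) ?_ ?_
    · simp [e1, e3, l1]
    · simp [e1, l1]
  | cons p' L₁ ih =>
    intro h p q c1 c2 l1 l2 n1 n2 b1 b2 e1 e2 e3 e4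
    have hpX : p ≠ X := by
      rintro rfl
      have := List.mem_of_getLast? (l := p' :: L₁) (a := p) (by simpa using l1)
      exact (List.nodup_cons.1 n1).1 this
    cases L₂ with
    | nil =>
      simp only [List.getLast?_singleton, Option.some.injEq] at l2
      refine runs_while_of_eq (by simp) ?_ ?_
      · simp [e2, e4, l2]
      · simp [e1, hpX]
    | cons q' L₂ =>
      have hqY : q ≠ Y := by
        rintro rfl
        have := List.mem_of_getLast? (l := q' :: L₂) (a := q) (by simpa using l2)
        exact (List.nodup_cons.1 n2).1 this
      refine runs_while_of_ne (by simp) (by simp [e1, e2, e3, e4, hpX, hqY]) ?_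
      rw [List.isChain_cons_cons] at c1 c2
      simp only [runs_seq, runs_set, AExp.Ok, AExp.ev, AState.setVar_var, AState.setVar_arr]
      refine ⟨⟨trivial, by rw [e1]; exact b1 _ (by simp)⟩, ⟨trivial, ?_⟩, ?_⟩
      · simp [e2]; exact b2 _ (by simp)
      refine (ih L₂ _ p' q' (by simpa using c1.2) (by simpa using c2.2) (by simpa using l1) (by simpa using l2)
        (List.nodup_cons.1 n1).2 (List.nodup_cons.1 n2).2
        (fun t ht => b1 t (List.mem_cons_of_mem _ ht))
        (fun t ht => b2 t (List.mem_cons_of_mem _ ht)) ?_ ?_ ?_ ?_).mono ?_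
      · simp [e1, c1.1.1]
      · simp [e2, c2.1.1]
      · simp [e3]
      · simp [e4]
      · rintro h' t ⟨a1, a2, a3, a4, a5⟩
        refine ⟨by simpa using a1, by simpa using a2, ?_, ?_, by simpa using a5⟩
        · intro i h1 h2; rw [a3 i h1 h2]; simp [h1, h2]
        · simp only [List.length_cons]; omega

theorem runs_relabelLoop {w : ℕ} {x e : ℕ} (L : List ℕ) :
    ∀ (h : AState) (p : ℕ), (p :: L).IsChain (Link (h.arr aNx) (h.arr aPv)) →
    (p :: L).getLast? = some e → (p :: L).Nodup →
    (∀ t ∈ p :: L, t < lim w) → h.var 35 = p → h.var 39 = e → h.var 30 = x →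
    Runs w (.while (.op .eq (.op .eq (.v 35) (.v 39)) (.c 0))
      (.st aLab (.op .shr (.v 35) (.c 1)) (.v 30);; .set 35 (.ld aNx (.v 35)))) h fun h' t =>
      (∀ k, k ≠ aLab → h'.arr k = h.arr k) ∧ h'.inp = h.inp ∧
      (∀ i, i ≠ 35 → h'.var i = h.var i) ∧
      (∀ M, h'.arr aLab M = if ∃ t ∈ (p :: L).dropLast, t / 2 = M then x else h.arr aLab M) ∧
      t ≤ 3 * L.length + 1 := by
  induction L with
  | nil =>
    intro h p c1 l1 n1 b1 e1 e2 e3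
    simp only [List.getLast?_singleton, Option.some.injEq] at l1
    refine runs_while_of_eq (by simp) ?_ ?_
    · simp [e1, e2, l1]
    · simp
  | cons p' L ih =>
    intro h p c1 l1 n1 b1 e1 e2 e3
    have hpX : p ≠ e := by
      rintro rfl
      have := List.mem_of_getLast? (l := p' :: L) (a := p) (by simpa using l1)
      exact (List.nodup_cons.1 n1).1 this
    refine runs_while_of_ne (by simp) (by simp [e1, e2, hpX]) ?_
    rw [List.isChain_cons_cons] at c1
    simp only [runs_seq, runs_set, runs_st, AExp.Ok, AExp.ev, AState.setVar_var,
      AState.setVar_arr, BinOp.val_shr, BinOp.fits_shr, AState.setArr_arr, AState.setArr_var]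
    have hp := b1 p (by simp)
    refine ⟨by simp, by simp, ?_, ⟨trivial, ?_⟩, ?_⟩
    · rw [e1]; exact (Nat.shiftRight_le _ _).trans_lt hp
    · rwa [e1]
    refine (ih _ p' ?_ (by simpa using l1) (List.nodup_cons.1 n1).2
      (fun t ht => b1 t (List.mem_cons_of_mem _ ht)) ?_ ?_ ?_).mono ?_
    · simpa using c1.2
    · simp [e1, c1.1.1]
    · simp [e2]
    · simp [e3]
    · rintro h' t ⟨a1, a2, a3, a4, a5⟩
      refine ⟨?_, by simpa using a2, ?_, ?_, ?_⟩
      · intro k hk; rw [a1 k hk]; simp [hk]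
      · intro i hi; rw [a3 i hi]; simp [hi]
      · intro M
        rw [a4 M]
        simp only [AState.setVar_arr, AState.setArr_arr, if_true, e1, e3,
          List.dropLast_cons_cons, List.mem_cons, Function.update_apply, Nat.shiftRight_one]
        have hd : ∀ t, t ∈ (p :: p' :: L).dropLast ↔ t = p ∨ t ∈ (p' :: L).dropLast := by
          simp [List.dropLast_cons_cons]
        by_cases h1 : ∃ t ∈ (p' :: L).dropLast, t / 2 = M
        · obtain ⟨t, h2, h3⟩ := h1
          rw [if_pos ⟨t, h2, h3⟩, if_pos ⟨t, (hd t).2 (.inr h2), h3⟩]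
        · rw [if_neg h1]
          by_cases h2 : M = p / 2
          · rw [if_pos h2, if_pos ⟨p, (hd p).2 (.inl rfl), h2.symm⟩]
          · rw [if_neg h2, if_neg]
            rintro ⟨t, h3, h4⟩
            rcases (hd t).1 h3 with rfl | h3
            · exact h2 h4.symm
            · exact h1 ⟨t, h3, h4⟩
      · simp only [List.length_cons]; omega

/-- The factor `6` stems from two tour entries per node and three steps per entry. -/
theorem runs_relabelProg {w : ℕ} {x M : ℕ} {f : Grove} {h : AState}
    (hc : (Grove.node M f .nil).tour.IsChain (Link (h.arr aNx) (h.arr aPv)))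
    (hn : (Grove.node M f .nil).verts.Nodup)
    (hb : ∀ t ∈ (Grove.node M f .nil).tour, t < lim w)
    (e1 : h.var 35 = 2 * M) (e2 : h.var 39 = 2 * M + 1) (e3 : h.var 30 = x) :
    Runs w relabelProg h fun h' t =>
      (∀ k, k ≠ aLab → h'.arr k = h.arr k) ∧ h'.inp = h.inp ∧
      (∀ i, i ≠ 35 → h'.var i = h.var i) ∧
      (h'.arr aLab = fun M' => if M' ∈ (Grove.node M f .nil).verts then x else h.arr aLab M') ∧
      t ≤ 6 * (Grove.node M f .nil).verts.length := by
  have hb0 := hb (2 * M) (by simp [Grove.tour])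
  simp only [relabelProg, runs_seq, runs_st, AExp.Ok, AExp.ev, BinOp.val_shr, BinOp.fits_shr]
  refine ⟨by simp, trivial, by rw [e1]; exact (Nat.shiftRight_le _ _).trans_lt hb0, ?_⟩
  refine (runs_relabelLoop (x := x) (e := 2 * M + 1) (f.tour ++ [2 * M + 1]) _ (2 * M) ?_ ?_ ?_ ?_
    ?_ ?_ ?_).mono ?_
  · simpa [Grove.tour] using hc
  · simp [List.getLast?_cons]
  · simpa [Grove.tour] using Grove.nodup_tour hn
  · simpa [Grove.tour] using hb
  · simpa using e1
  · simpa using e2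
  · simpa using e3
  · rintro h' t ⟨a1, a2, a3, a4, a5⟩
    refine ⟨fun k hk => by rw [a1 k hk]; simp [hk], a2, a3, ?_, ?_⟩
    · funext M'
      rw [a4 M']
      have := Grove.exists_mem_dropLast_tour (M := M) (M' := M') (f := f)
      simp only [Grove.tour] at this
      simp only [AState.setArr_arr, if_true, e1, e3, Function.update_apply,
        Nat.shiftRight_one, Nat.mul_div_cancel_left _ (show 0 < 2 by omega), ← this]
      by_cases h1 : ∃ t ∈ (2 * M :: (f.tour ++ [2 * M + 1])).dropLast, t / 2 = M'
      · rw [if_pos h1, if_pos (.inr h1)]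
      · rw [if_neg h1]
        by_cases h2 : M' = M
        · rw [if_pos h2, if_pos (.inl h2)]
        · rw [if_neg h2, if_neg (not_or.2 ⟨h2, h1⟩)]
    · simp only [List.length_append, Grove.length_tour, List.length_singleton] at a5
      simp only [Grove.verts, List.length_cons, List.append_nil]
      omega

/-- The race and the relabelling each cost about six steps per node of the smaller part. Hence the
weight `12` of `groveSum`, which falls by the size of that part. -/
theorem Components.runs_cutProg {w N x : ℕ} {h : AState} {full cut : ℕ → Prop} {up : ℕ → ℕ}
    {tr : ℕ → Grove}
    (H : Components full cut up (h.arr aLab) (h.arr aTop) (h.arr aNx) (h.arr aPv) tr)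
    (hN : ∀ M, full M → M < N) (hl : 2 * N ≤ lim w) (hx : full x) (hc : ¬ cut x)
    (e0 : h.var 30 = x) :
    Runs w cutProg h fun h' t =>
      (∃ tr', Components full (fun M => cut M ∨ M = x) up (h'.arr aLab) (h'.arr aTop) (h'.arr aNx)
        (h'.arr aPv) tr' ∧ t + 12 * groveSum N tr' ≤ 12 * groveSum N tr + 20) ∧
      (∀ k, k ≠ aLab → k ≠ aTop → k ≠ aNx → k ≠ aPv → h'.arr k = h.arr k) ∧
      (∀ i, i < 30 ∨ 40 ≤ i → h'.var i = h.var i) ∧ h'.inp = h.inp := by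
  obtain ⟨c, cs, cd, er, hp, as, ad, ks, kd, ls, ld, ma, mb⟩ := H.split hx hc
  have hlw := lim_lt w
  have hxN := hN x hx
  have hlN := hN _ (H.label _ (H.tr_ne_nil hx)).1
  have hxl : x ≠ h.arr aLab x := fun e => hc (e ▸ (H.label _ (H.tr_ne_nil hx)).2)
  obtain ⟨htf, htc⟩ := H.top_spec hx
  have htN := hN _ htf
  have hnil : tr x = .nil := H.eq_nil fun h => hc h.2
  have hab : ∀ t ∈ (tr (h.arr aLab x)).tour, t < lim w := by
    intro t ht
    have := hN _ (H.full_of_mem_tour ht).1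
    omega
  have hnd := hp.nodup_iff.1 (H.nodup _)
  rw [List.nodup_append] at hnd
  obtain ⟨n1, n2, -⟩ := hnd
  have hts : ∀ t ∈ (Grove.node x cs .nil).tour, t < lim w := by
    intro t ht
    refine hab t (Grove.mem_tour.2 (hp.mem_iff.2 (List.mem_append_left _ (Grove.mem_tour.1 ht))))
  have htd : ∀ t ∈ (Grove.node (h.arr aTop (h.arr aLab x)) cd .nil).tour, t < lim w := by
    intro t ht
    refine hab t (Grove.mem_tour.2 (hp.mem_iff.2 (List.mem_append_right _ (Grove.mem_tour.1 ht))))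
  have hla := hab _ ma
  have hlb := hab _ mb
  have hnn : ∀ t, t ∉ (tr (h.arr aLab x)).tour →
      Function.update (h.arr aNx) (h.arr aPv (2 * x)) (h.arr aNx (2 * x + 1)) t = h.arr aNx t ∧
      Function.update (h.arr aPv) (h.arr aNx (2 * x + 1)) (h.arr aPv (2 * x)) t = h.arr aPv t := by
    intro t ht
    exact ⟨Function.update_of_ne (by rintro rfl; exact ht ma) _ _,
      Function.update_of_ne (by rintro rfl; exact ht mb) _ _⟩
  rw [cutProg]
  simp only [runs_seq, runs_set, runs_st, AExp.Ok, AExp.ev, AState.setVar_var, e0,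
    AState.setVar_arr, AState.setArr_arr, AState.setArr_var, BinOp.val_add, BinOp.fits_add,
    true_and, and_true, if_true, OfNat.ofNat_eq_ofNat, Nat.reduceEqDiff, if_false]
  simp only [← two_mul]
  refine ⟨by omega, by omega, by omega, by omega, by omega, by omega, by omega, by omega, hla, hlb,
    ?_⟩
  have len1 := Grove.length_tour (.node x cs .nil)
  have len2 := Grove.length_tour (.node (h.arr aTop (h.arr aLab x)) cd .nil)
  refine (runs_raceProg (X := 2 * x + 1) (Y := 2 * h.arr aTop (h.arr aLab x) + 1)
    (cs.tour ++ [2 * x + 1]) (cd.tour ++ [2 * h.arr aTop (h.arr aLab x) + 1]) _ (2 * x)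
    (2 * h.arr aTop (h.arr aLab x)) ?_ ?_ ?_ ?_ ?_ ?_ ?_ ?_ ?_ ?_ ?_ ?_).mono ?_
  · simpa [Grove.tour] using ls
  · simpa [Grove.tour] using ld
  · simp [List.getLast?_cons]
  · simp [List.getLast?_cons]
  · simpa [Grove.tour] using Grove.nodup_tour n1
  · simpa [Grove.tour] using Grove.nodup_tour n2
  · simpa [Grove.tour] using hts
  · simpa [Grove.tour] using htd
  · simp
  · simp
  · simp
  · simp
  rintro h1 t1 ⟨a1, a2, a3, a4, a5⟩
  have v30 : h1.var 30 = x := by rw [a3 30 (by simp) (by simp)]; simpa using e0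
  have v31 : h1.var 31 = h.arr aLab x := by rw [a3 31 (by simp) (by simp)]; simp
  have v32 : h1.var 32 = h.arr aTop (h.arr aLab x) := by rw [a3 32 (by simp) (by simp)]; simp
  have v37 : h1.var 37 = 2 * x + 1 := by rw [a3 37 (by simp) (by simp)]; simp
  have v38 : h1.var 38 = 2 * h.arr aTop (h.arr aLab x) + 1 := by
    rw [a3 38 (by simp) (by simp)]; simp
  have vfr : ∀ i, i < 30 ∨ 40 ≤ i → h1.var i = h.var i := by
    intro i hi
    rw [a3 i (by omega) (by omega)]
    simp only [AState.setVar_var, AState.setArr_var]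
    iterate 8 rw [if_neg (by omega)]
  simp only [Grove.tour, List.length_cons, Grove.verts, List.append_nil] at len1 len2
  simp only [List.length_append, List.length_singleton] at a4 a5 len1 len2
  have hnx : h1.arr aNx = Function.update (h.arr aNx) (h.arr aPv (2 * x))
      (h.arr aNx (2 * x + 1)) := by rw [a1]; simp
  have hpv : h1.arr aPv = Function.update (h.arr aPv) (h.arr aNx (2 * x + 1))
      (h.arr aPv (2 * x)) := by rw [a1]; simp
  have hlab : h1.arr aLab = h.arr aLab := by rw [a1]; simp
  have htop : h1.arr aTop = h.arr aTop := by rw [a1]; simp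
  have afr : ∀ k, k ≠ aLab → k ≠ aTop → k ≠ aNx → k ≠ aPv → h1.arr k = h.arr k := by
    intro k k1 k2 k3 k4
    rw [a1]; simp [k3, k4]
  have ainp : h1.inp = h.inp := by rw [a2]; simp
  -- The smaller part takes the new label `x`: the part below `x` here, the part with the old top in
  -- the other case, where the part below `x` keeps the old label and gets `x` as its top.
  by_cases hsmall : (cs.tour.length + 1) ≤ cd.tour.length + 1
  · have v35 := a5.2 hsmall
    refine runs_ite_of_ne (by simp) (by simp [v35, v37]) ?_
    simp only [runs_seq, runs_set, runs_st, AExp.Ok, AExp.ev, AState.setVar_var, v30, v37,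
      AState.setVar_arr, AState.setArr_arr, AState.setArr_var, BinOp.val_add, BinOp.fits_add,
      true_and, if_true, Nat.reduceEqDiff, if_false, ← two_mul]
    refine ⟨by omega, by omega, (runs_relabelProg (x := x) (M := x) (f := cs) ?_ n1 hts ?_ ?_ ?_).mono
      ?_⟩
    · simpa [hnx, hpv] using ls
    · simp
    · simp
    · simpa using v30
    rintro h2 t2 ⟨b1, b2, b3, b4, b5⟩
    have hv := hp.trans List.perm_append_comm
    refine ⟨⟨Function.update (Function.update tr (h.arr aLab x)
      (.node (h.arr aTop (h.arr aLab x)) cd .nil)) x (.node x cs .nil), ?_, ?_⟩, ?_, ?_, ?_⟩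
    · have := H.relabel hx hc
        (G₁ := .node (h.arr aTop (h.arr aLab x)) cd .nil) (G₂ := .node x cs .nil)
        (top' := Function.update (h.arr aTop) x x)
        (by rw [Function.update_of_ne hxl.symm]) (by rw [Function.update_self]) hv
        (by rwa [Function.update_of_ne hxl.symm]) (by rwa [Function.update_self]) kd ks
        (by left; rwa [Function.update_of_ne hxl.symm]) (by right; rw [Function.update_self]) ld ls
        (fun l _ h => Function.update_of_ne h _ _) hnn
      convert this using 1
      · rw [b4]; simp [hlab]
      · rw [b1 _ (by simp)]; simp [htop]
      · rw [b1 _ (by simp)]; simp [hnx]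
      · rw [b1 _ (by simp)]; simp [hpv]
    · have := groveSum_split hlN hxN hxl hnil hv
      simp only [Grove.verts, List.length_cons, List.append_nil, List.length_append] at this b5
      omega
    · intro k k1 k2 k3 k4
      rw [b1 k k1, ← afr k k1 k2 k3 k4]
      simp [k2]
    · intro i hi
      rw [b3 i (by omega), ← vfr i hi]
      simp only [AState.setVar_var, AState.setArr_var]
      iterate 2 rw [if_neg (by omega)]
    · rw [b2, ← ainp]; simp
  · have v35 : h1.var 35 ≠ 2 * x + 1 := fun e => hsmall (a5.1 e)
    refine runs_ite_of_eq (by simp) (by simp [v35, v37]) ?_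
    simp only [runs_seq, runs_set, runs_st, AExp.Ok, AExp.ev, AState.setVar_var, v30, v31, v32, v38,
      AState.setVar_arr, AState.setArr_arr, AState.setArr_var, BinOp.val_add, BinOp.fits_add,
      true_and, if_true, Nat.reduceEqDiff, if_false, ← two_mul]
    refine ⟨by omega, by omega, by omega, (runs_relabelProg (x := x)
      (M := h.arr aTop (h.arr aLab x)) (f := cd) ?_ n2 htd ?_ ?_ ?_).mono ?_⟩
    · simpa [hnx, hpv] using ld
    · simp
    · simp
    · simpa using v30
    rintro h2 t2 ⟨b1, b2, b3, b4, b5⟩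
    refine ⟨⟨Function.update (Function.update tr (h.arr aLab x) (.node x cs .nil)) x
      (.node (h.arr aTop (h.arr aLab x)) cd .nil), ?_, ?_⟩, ?_, ?_, ?_⟩
    · have := H.relabel hx hc
        (G₂ := .node (h.arr aTop (h.arr aLab x)) cd .nil) (G₁ := .node x cs .nil)
        (top' := Function.update (Function.update (h.arr aTop) x (h.arr aTop (h.arr aLab x)))
          (h.arr aLab x) x)
        (by rw [Function.update_self]) (by rw [Function.update_of_ne hxl, Function.update_self]) hp
        (by rwa [Function.update_self])
        (by rwa [Function.update_of_ne hxl, Function.update_self]) ks kd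
        (by right; rw [Function.update_self])
        (by left; rwa [Function.update_of_ne hxl, Function.update_self]) ls ld
        (fun l h h' => by rw [Function.update_of_ne h, Function.update_of_ne h']) hnn
      convert this using 1
      · rw [b4]; simp [hlab]
      · rw [b1 _ (by simp)]; simp [htop]
      · rw [b1 _ (by simp)]; simp [hnx]
      · rw [b1 _ (by simp)]; simp [hpv]
    · have := groveSum_split hlN hxN hxl hnil hp
      simp only [Grove.verts, List.length_cons, List.append_nil, List.length_append] at this b5
      omega
    · intro k k1 k2 k3 k4
      rw [b1 k k1, ← afr k k1 k2 k3 k4]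
      simp [k2]
    · intro i hi
      rw [b3 i (by omega), ← vfr i hi]
      simp only [AState.setVar_var, AState.setArr_var]
      iterate 2 rw [if_neg (by omega)]
    · rw [b2, ← ainp]; simp

/-! ### Microtrees as bit masks -/

/-- Isolates the lowest set bit: passing from `x` to `x - 1` changes only the bits up to `e`, and
bit `e` is cleared. -/
theorem Nat.sub_and_pred_eq {x e : ℕ} (h1 : x.testBit e = true) (h2 : ∀ i < e, x.testBit i = false) :
    x - (x &&& (x - 1)) = 2 ^ e := by
  obtain ⟨m, rfl⟩ : ∃ m, x = 2 ^ (e + 1) * m + 2 ^ e := by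
    refine ⟨x / 2 ^ (e + 1), ?_⟩
    have : x % 2 ^ (e + 1) = 2 ^ e := by
      apply Nat.eq_of_testBit_eq
      intro i
      rw [Nat.testBit_mod_two_pow, Nat.testBit_two_pow]
      rcases lt_trichotomy i e with h | h | h
      · simp [h2 i h, h.ne']
      · subst h; simp [h1]
      · simp [h.ne, show ¬ i < e + 1 by omega]
    conv_lhs => rw [← Nat.div_add_mod x (2 ^ (e + 1)), this]
  have hlt : 2 ^ e < 2 ^ (e + 1) := Nat.pow_lt_pow_right (by norm_num) (by omega)
  have hpos : 0 < 2 ^ e := by positivity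
  have : (2 ^ (e + 1) * m + 2 ^ e) &&& (2 ^ (e + 1) * m + 2 ^ e - 1) = 2 ^ (e + 1) * m := by
    rw [Nat.add_sub_assoc hpos]
    apply Nat.eq_of_testBit_eq
    intro i
    rw [Nat.testBit_and, Nat.testBit_two_pow_mul_add _ hlt, Nat.testBit_two_pow_mul_add _ (by omega),
      Nat.testBit_two_pow_mul, Nat.testBit_two_pow, Nat.testBit_two_pow_sub_one]
    rcases lt_trichotomy i e with h | h | h
    · simp [show i < e + 1 by omega, h.ne', show ¬ e + 1 ≤ i by omega]
    · simp [h]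
    · simp [show ¬ i < e + 1 by omega, show e + 1 ≤ i by omega]
  rw [this]; omega
theorem Nat.and_two_pow_ne_zero {x e : ℕ} : x &&& 2 ^ e ≠ 0 ↔ x.testBit e = true := by
  rw [Nat.and_two_pow]
  cases x.testBit e <;> simp

theorem Finset.sum_range_update {N i : ℕ} (hi : i < N) (f : ℕ → ℕ) (x : ℕ) :
    ∑ j ∈ Finset.range N, Function.update f i x j + f i = ∑ j ∈ Finset.range N, f j + x := by
  have hi' := Finset.mem_range.2 hi
  rw [Finset.sum_update_of_mem hi', ← Finset.add_sum_erase _ f hi', Finset.sdiff_singleton_eq_erase]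
  omega

/-- `r` is the first marked node on the way from `j` to the root. -/
inductive Nearest (par : ℕ → ℕ) (mkd : ℕ → Prop) : ℕ → ℕ → Prop
  | here {j : ℕ} : mkd j → Nearest par mkd j j
  | step {j r : ℕ} : ¬ mkd j → Nearest par mkd (par j) r → Nearest par mkd j r

/-- The node `j` is marked. -/
def Mkd (h : AState) (j : ℕ) : Prop := h.arr aBit j &&& h.arr aMk (h.arr aMic j) ≠ 0

/-- The node `j` has a marked ancestor in its microtree. -/
def Cov (h : AState) (j : ℕ) : Prop := h.arr aAnc j &&& h.arr aMk (h.arr aMic j) ≠ 0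

/-- The decomposition of the forest into microtrees with at most `B` nodes. A microtree has the
number of its root; its nodes are numbered consecutively, and the numbers are represented by bits. -/
structure Micro (B N top : ℕ) (h : AState) : Prop where
  pos : 0 < N
  par_zero : h.arr aPar 0 = 0
  par_lt : ∀ j < N, 0 < j → h.arr aPar j < j
  mic_or : ∀ j < N, h.arr aMic j = j ∨ (0 < j ∧ h.arr aMic j = h.arr aMic (h.arr aPar j))
  mic_le : ∀ j < N, h.arr aMic j ≤ j
  mic_mic : ∀ j < N, h.arr aMic (h.arr aMic j) = h.arr aMic j
  full : ∀ j < N, 0 < j → h.arr aMic j = j → h.arr aNb (h.arr aMic (h.arr aPar j)) = 0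
  anc_root : ∀ j < N, h.arr aMic j = j → h.arr aAnc j = h.arr aBit j
  anc_step : ∀ j < N, h.arr aMic j ≠ j → h.arr aAnc j = h.arr aAnc (h.arr aPar j) ||| h.arr aBit j
  idx_lt : ∀ j < N, h.arr aIdx (h.arr aBit j) < h.arr aSz (h.arr aMic j)
  bit_eq : ∀ j < N, h.arr aBit j = 2 ^ (B - 1 - h.arr aIdx (h.arr aBit j))
  slot_eq : ∀ j < N,
    h.arr aSlot (h.arr aBase (h.arr aMic j) + h.arr aIdx (h.arr aBit j)) = j
  idx_par_lt : ∀ j < N, h.arr aMic j ≠ j →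
    h.arr aIdx (h.arr aBit (h.arr aPar j)) < h.arr aIdx (h.arr aBit j)
  sz_pos : ∀ j < N, h.arr aMic j = j → 1 ≤ h.arr aSz j
  sz_le_cap : ∀ j < N, h.arr aMic j = j → h.arr aSz j ≤ h.arr aCap j
  cap_le : ∀ j < N, h.arr aCap j ≤ 2 * h.arr aSz j
  sz_le : ∀ j < N, h.arr aMic j = j → h.arr aSz j ≤ B
  nb_eq : ∀ j < N, h.arr aMic j = j →
    h.arr aNb j = if h.arr aSz j < B then 2 ^ (B - 1 - h.arr aSz j) else 0
  sz_zero : ∀ j < N, h.arr aMic j ≠ j → h.arr aSz j = 0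
  mk_bits : ∀ j < N, h.arr aMic j = j → ∀ e, (h.arr aMk j).testBit e = true →
    e < B ∧ B ≤ e + h.arr aSz j
  seg : ∀ j < N, h.arr aMic j = j → h.arr aBase j + h.arr aCap j ≤ top
  disj : ∀ j < N, ∀ j' < N, h.arr aMic j = j → h.arr aMic j' = j' → j ≠ j' →
    ∀ i < h.arr aCap j, ∀ i' < h.arr aCap j', h.arr aBase j + i ≠ h.arr aBase j' + i'
  space : top + 2 * ∑ j ∈ Finset.range N, (2 * h.arr aSz j - h.arr aCap j) ≤ 4 * N
  mkd_zero : Mkd h 0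

namespace Micro

variable {B N top : ℕ} {h : AState}

theorem par_lt' (H : Micro B N top h) {j : ℕ} (hj : j < N) : h.arr aPar j < N := by
  rcases Nat.eq_zero_or_pos j with rfl | h0
  · rw [H.par_zero]; exact hj
  · exact (H.par_lt j hj h0).trans hj

theorem mic_lt (H : Micro B N top h) {j : ℕ} (hj : j < N) : h.arr aMic j < N :=
  (H.mic_le j hj).trans_lt hj

theorem mic_eq_par (H : Micro B N top h) {j : ℕ} (hj : j < N) (hm : h.arr aMic j ≠ j) :
    h.arr aMic (h.arr aPar j) = h.arr aMic j :=
  (((H.mic_or j hj).resolve_left hm).2).symm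

theorem idx_lt_B (H : Micro B N top h) {j : ℕ} (hj : j < N) :
    h.arr aIdx (h.arr aBit j) < B :=
  (H.idx_lt j hj).trans_le (H.sz_le _ (H.mic_lt hj) (H.mic_mic j hj))

theorem mkd_iff (H : Micro B N top h) {j : ℕ} (hj : j < N) : Mkd h j ↔
    (h.arr aMk (h.arr aMic j)).testBit (B - 1 - h.arr aIdx (h.arr aBit j)) = true := by
  unfold Mkd
  have := H.bit_eq j hj
  rw [Nat.land_comm]
  nth_rewrite 1 [this]
  exact Nat.and_two_pow_ne_zero

theorem testBit_bit (H : Micro B N top h) {j : ℕ} (hj : j < N) (e : ℕ) :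
    (h.arr aBit j).testBit e = decide (B - 1 - h.arr aIdx (h.arr aBit j) = e) := by
  have := H.bit_eq j hj
  nth_rewrite 1 [this]
  exact Nat.testBit_two_pow

theorem anc_induct {P : ℕ → Prop}
    (h0 : ∀ j < N, h.arr aMic j = j → P j)
    (h1 : ∀ j < N, h.arr aMic j ≠ j → P (h.arr aPar j) → P j) (H : Micro B N top h) :
    ∀ j < N, P j := by
  intro j
  induction j using Nat.strong_induction_on with
  | _ j ih =>
    intro hj
    by_cases hm : h.arr aMic j = j
    · exact h0 j hj hm
    · have := (H.mic_or j hj).resolve_left hm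
      exact h1 j hj hm (ih _ (H.par_lt j hj this.1) (H.par_lt' hj))

/-- Indices increase and hence bits decrease on the way down, so the own bit of a node is the lowest
in its ancestor mask. -/
theorem le_of_testBit_anc (H : Micro B N top h) : ∀ j < N, ∀ e, (h.arr aAnc j).testBit e = true →
    B - 1 - h.arr aIdx (h.arr aBit j) ≤ e := by
  refine anc_induct ?_ ?_ H
  · intro j hj hm e he
    rw [H.anc_root j hj hm, H.testBit_bit hj] at he
    exact (of_decide_eq_true he).le
  · intro j hj hm ih e he
    rw [H.anc_step j hj hm, Nat.testBit_or, Bool.or_eq_true, H.testBit_bit hj,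
      decide_eq_true_eq] at he
    rcases he with he | he
    · have := ih e he
      have := H.idx_par_lt j hj hm
      omega
    · exact he.le

theorem bit_mem_anc (H : Micro B N top h) {j : ℕ} (hj : j < N) :
    (h.arr aAnc j).testBit (B - 1 - h.arr aIdx (h.arr aBit j)) = true := by
  by_cases hm : h.arr aMic j = j
  · rw [H.anc_root j hj hm, H.testBit_bit hj]; simp
  · rw [H.anc_step j hj hm, Nat.testBit_or, H.testBit_bit hj]; simp

theorem cov_of_mkd (H : Micro B N top h) {j : ℕ} (hj : j < N) (hk : Mkd h j) : Cov h j := by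
  intro e
  have h1 := (H.mkd_iff hj).1 hk
  have h2 := H.bit_mem_anc hj
  have := Nat.testBit_and (h.arr aAnc j) (h.arr aMk (h.arr aMic j))
    (B - 1 - h.arr aIdx (h.arr aBit j))
  rw [e, h1, h2] at this
  simp at this

/-- The masks of a node and its parent differ only in the bit of the node, which the marks do not
contain. Thus an unmarked node may be replaced by its parent. -/
theorem and_eq_of_not_mkd (H : Micro B N top h) {j : ℕ} (hj : j < N) (hm : h.arr aMic j ≠ j)
    (hk : ¬ Mkd h j) : h.arr aAnc j &&& h.arr aMk (h.arr aMic j) =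
      h.arr aAnc (h.arr aPar j) &&& h.arr aMk (h.arr aMic (h.arr aPar j)) := by
  rw [H.mic_eq_par hj hm, H.anc_step j hj hm, Nat.and_or_distrib_right]
  unfold Mkd at hk
  rw [not_not] at hk
  rw [hk, Nat.or_zero]

theorem cov_step (H : Micro B N top h) {j : ℕ} (hj : j < N) (hm : h.arr aMic j ≠ j) :
    Cov h j ↔ Mkd h j ∨ Cov h (h.arr aPar j) := by
  constructor
  · intro hc
    by_cases hk : Mkd h j
    · exact .inl hk
    · right; unfold Cov at hc ⊢; rwa [H.and_eq_of_not_mkd hj hm hk] at hc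
  · rintro (hk | hc)
    · exact H.cov_of_mkd hj hk
    · by_cases hk : Mkd h j
      · exact H.cov_of_mkd hj hk
      · unfold Cov at hc ⊢; rwa [H.and_eq_of_not_mkd hj hm hk]

theorem cov_root (H : Micro B N top h) {j : ℕ} (hj : j < N) (hm : h.arr aMic j = j) :
    Cov h j ↔ Mkd h j := by
  unfold Cov Mkd; rw [H.anc_root j hj hm]

/-- The marked root `0` covers its whole microtree. An uncovered node therefore lies in a microtree
that has one above it. -/
theorem cov_of_mic_eq_zero (H : Micro B N top h) : ∀ j < N, h.arr aMic j = 0 → Cov h j := by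
  refine anc_induct ?_ ?_ H
  · intro j hj hm h0
    rw [hm] at h0; subst h0
    exact (H.cov_root hj hm).2 H.mkd_zero
  · intro j hj hm ih h0
    exact (H.cov_step hj hm).2 (.inr (ih (by rw [H.mic_eq_par hj hm, h0])))

/-- The lowest common bit of the ancestors and the marks stands for the nearest marked ancestor. -/
theorem nearest_of_cov (H : Micro B N top h) : ∀ j < N, Cov h j →
    ∃ r < N, h.arr aMic r = h.arr aMic j ∧ Nearest (h.arr aPar) (Mkd h) j r ∧
      ∃ x, x = h.arr aAnc j &&& h.arr aMk (h.arr aMic j) ∧ x - (x &&& (x - 1)) = h.arr aBit r := by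
  have key : ∀ j < N, Mkd h j → ∃ r < N, h.arr aMic r = h.arr aMic j ∧
      Nearest (h.arr aPar) (Mkd h) j r ∧
      ∃ x, x = h.arr aAnc j &&& h.arr aMk (h.arr aMic j) ∧
        x - (x &&& (x - 1)) = h.arr aBit r := by
    intro j hj hk
    refine ⟨j, hj, rfl, .here hk, _, rfl, ?_⟩
    have := H.bit_eq j hj
    rw [this]
    apply Nat.sub_and_pred_eq
    · rw [Nat.testBit_and, H.bit_mem_anc hj, (H.mkd_iff hj).1 hk]; rfl
    · intro i hi
      rw [Nat.testBit_and, Bool.and_eq_false_iff]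
      left
      by_contra hc
      have := H.le_of_testBit_anc j hj i (by simpa using hc)
      omega
  refine anc_induct ?_ ?_ H
  · intro j hj hm hc
    exact key j hj ((H.cov_root hj hm).1 hc)
  · intro j hj hm ih hc
    by_cases hk : Mkd h j
    · exact key j hj hk
    · obtain ⟨r, hr, h1, h2, x, h3, h4⟩ := ih (((H.cov_step hj hm).1 hc).resolve_left hk)
      exact ⟨r, hr, by rw [h1, H.mic_eq_par hj hm], .step hk h2, x,
        by rw [h3, H.and_eq_of_not_mkd hj hm hk], h4⟩

/-- From an uncovered node the search may leave the microtree at once. -/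
theorem nearest_of_not_cov (H : Micro B N top h) : ∀ j < N, ¬ Cov h j →
    ∀ r, Nearest (h.arr aPar) (Mkd h) (h.arr aPar (h.arr aMic j)) r →
      Nearest (h.arr aPar) (Mkd h) j r := by
  refine anc_induct ?_ ?_ H
  · intro j hj hm hc r hr
    rw [hm] at hr
    exact .step (fun hk => hc (H.cov_of_mkd hj hk)) hr
  · intro j hj hm ih hc r hr
    rw [H.cov_step hj hm, not_or] at hc
    rw [← H.mic_eq_par hj hm] at hr
    exact .step hc.1 (ih hc.2 r hr)

/-- The micro tree data are determined by some of the arrays. -/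
theorem congr (H : Micro B N top h) {h' : AState}
    (e : ∀ k ∈ [aPar, aMic, aAnc, aBit, aMk, aNb, aSz, aBase, aSlot, aIdx, aCap],
      h'.arr k = h.arr k) : Micro B N top h' := by
  simp only [List.mem_cons, List.not_mem_nil, or_false, forall_eq_or_imp, forall_eq] at e
  obtain ⟨e0, e1, e2, e3, e4, e5, e6, e7, e8, e9, e10⟩ := e
  obtain ⟨a1, a2, a3, a4, a5, a6, a7, a8, a9, a10, a11, a12, a13, a14, a15, a16, a17, a18, a19,
    a20, a21, a22, a23, a24⟩ := H
  unfold Mkd at a24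
  rw [← e0, ← e1, ← e2, ← e3, ← e4, ← e5, ← e6, ← e7, ← e8, ← e9, ← e10] at *
  exact ⟨a1, a2, a3, a4, a5, a6, a7, a8, a9, a10, a11, a12, a13, a14, a15, a16, a17, a18, a19,
    a20, a21, a22, a23, a24⟩

end Micro

/-! ### Setting a mark and doubling the array of a microtree -/

namespace Micro

variable {B N top : ℕ} {h h' : AState}

theorem mark (H : Micro B N top h) {x : ℕ} (hx : x < N)
    (e : ∀ k ∈ [aPar, aMic, aAnc, aBit, aNb, aSz, aBase, aSlot, aIdx, aCap], h'.arr k = h.arr k)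
    (e' : h'.arr aMk = Function.update (h.arr aMk) (h.arr aMic x)
      (h.arr aMk (h.arr aMic x) ||| h.arr aBit x)) : Micro B N top h' := by
  simp only [List.mem_cons, List.not_mem_nil, or_false, forall_eq_or_imp, forall_eq] at e
  obtain ⟨e0, e1, e2, e3, e4, e5, e6, e7, e8, e9⟩ := e
  have e' := e'
  have hb := H.mk_bits
  have hz := H.mkd_zero
  have hidx := H.idx_lt x hx
  have hB := H.idx_lt_B hx
  have htb := H.testBit_bit hx
  obtain ⟨a1, a2, a3, a4, a5, a6, a7, a8, a9, a10, a11, a12, a13, a14, a15, a16, a17, a18, a19,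
    -, a21, a22, a23, -⟩ := H
  unfold Mkd at hz
  rw [← e0, ← e1, ← e2, ← e3, ← e4, ← e5, ← e6, ← e7, ← e8, ← e9] at *
  refine ⟨a1, a2, a3, a4, a5, a6, a7, a8, a9, a10, a11, a12, a13, a14, a15, a16, a17, a18, a19,
    ?_, a21, a22, a23, ?_⟩
  · intro j hj hm t ht
    rw [e', Function.update_apply] at ht
    split_ifs at ht with hjm
    · rw [Nat.testBit_or, Bool.or_eq_true] at ht
      rcases ht with ht | ht
      · exact hb j hj hm t (hjm ▸ ht)
      · rw [htb, decide_eq_true_eq] at ht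
        rw [hjm]
        omega
    · exact hb j hj hm t ht
  · unfold Mkd
    rw [e', Function.update_apply]
    split_ifs with hm
    · intro h0
      rw [Nat.and_or_distrib_left, Nat.or_eq_zero_iff, ← hm] at h0
      exact hz h0.1
    · exact hz

theorem mark_mkd (H : Micro B N top h) {x : ℕ} (hx : x < N)
    (e : ∀ k ∈ [aPar, aMic, aAnc, aBit, aNb, aSz, aBase, aSlot, aIdx, aCap], h'.arr k = h.arr k)
    (e' : h'.arr aMk = Function.update (h.arr aMk) (h.arr aMic x)
      (h.arr aMk (h.arr aMic x) ||| h.arr aBit x)) {j : ℕ} (hj : j < N) :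
    Mkd h' j ↔ Mkd h j ∨ j = x := by
  have H' := H.mark hx e e'
  rw [H'.mkd_iff hj, H.mkd_iff hj, e' , e aMic (by simp), e aIdx (by simp), e aBit (by simp),
    Function.update_apply]
  split_ifs with hm
  · rw [Nat.testBit_or, Bool.or_eq_true, H.testBit_bit hx, decide_eq_true_eq, hm]
    refine or_congr Iff.rfl ⟨fun hh => ?_, fun hh => by rw [hh]⟩
    have h1 := H.idx_lt_B hx
    have h2 := H.idx_lt_B hj
    -- A node is determined by its microtree and its index, because both give its entry in `aSlot`.
    rw [← H.slot_eq j hj, ← H.slot_eq x hx, hm]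
    congr 2
    omega
  · refine ⟨.inl, ?_⟩
    rintro (h1 | rfl)
    · exact h1
    · exact absurd rfl hm

/-- `x` is an ancestor of `j` within a microtree. -/
def _root_.Below (h : AState) (x j : ℕ) : Prop :=
  h.arr aMic j = h.arr aMic x ∧ h.arr aAnc j &&& h.arr aBit x ≠ 0

/-- Exactly the descendants of `x` within the microtree can become covered, so these are the nodes
that marking has to explore. -/
theorem mark_cov (e2 : h'.arr aAnc = h.arr aAnc) (e1 : h'.arr aMic = h.arr aMic) {x : ℕ}
    (e' : h'.arr aMk = Function.update (h.arr aMk) (h.arr aMic x)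
      (h.arr aMk (h.arr aMic x) ||| h.arr aBit x)) {j : ℕ} :
    Cov h' j ↔ Cov h j ∨ Below h x j := by
  unfold Cov Below
  rw [e2, e1, e', Function.update_apply]
  split_ifs with hm
  · rw [Nat.and_or_distrib_left, Ne, Nat.or_eq_zero_iff, hm]
    simp only [true_and]
    tauto
  · tauto

theorem below_self (H : Micro B N top h) {x : ℕ} (hx : x < N) : Below h x x := by
  refine ⟨rfl, ?_⟩
  rw [H.bit_eq x hx, Nat.and_two_pow_ne_zero]
  exact H.bit_mem_anc hx

theorem below_step (H : Micro B N top h) {x j : ℕ} (hj : j < N) (hm : h.arr aMic j ≠ j)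
    (hb : Below h x (h.arr aPar j)) : Below h x j := by
  refine ⟨by rw [← hb.1, H.mic_eq_par hj hm], ?_⟩
  rw [H.anc_step j hj hm, Nat.and_or_distrib_right, Ne, Nat.or_eq_zero_iff]
  exact fun h0 => hb.2 h0.1

/-- The bit of `x` enters an ancestor mask either as the own bit, which identifies `x`, or through
the mask of the parent. -/
theorem eq_or_of_below (H : Micro B N top h) {x j : ℕ} (hx : x < N) (hj : j < N)
    (hb : Below h x j) : j = x ∨ (h.arr aMic j ≠ j ∧ Below h x (h.arr aPar j)) := by
  have key : (h.arr aBit j).testBit (B - 1 - h.arr aIdx (h.arr aBit x)) = true → j = x := by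
    intro ht
    rw [H.testBit_bit hj, decide_eq_true_eq] at ht
    have h1 := H.idx_lt_B hx
    have h2 := H.idx_lt_B hj
    rw [← H.slot_eq j hj, ← H.slot_eq x hx, hb.1]
    congr 2
    omega
  have hb2 := hb.2
  rw [H.bit_eq x hx, Nat.and_two_pow_ne_zero] at hb2
  by_cases hm : h.arr aMic j = j
  · left
    rw [H.anc_root j hj hm] at hb2
    exact key hb2
  · rw [H.anc_step j hj hm, Nat.testBit_or, Bool.or_eq_true] at hb2
    rcases hb2 with h1 | h1
    · refine .inr ⟨hm, by rw [H.mic_eq_par hj hm, hb.1], ?_⟩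
      rw [H.bit_eq x hx, Nat.and_two_pow_ne_zero]
      exact h1
    · exact .inl (key h1)

/-- The array of a microtree is moved to a place that is twice as large. -/
theorem double (H : Micro B N top h) {m : ℕ} (hm : m < N) (hmm : h.arr aMic m = m)
    (hc : h.arr aSz m = h.arr aCap m)
    (e : ∀ k ∈ [aPar, aMic, aAnc, aBit, aMk, aNb, aSz, aIdx], h'.arr k = h.arr k)
    (e1 : ∀ i < top, h'.arr aSlot i = h.arr aSlot i)
    (e2 : ∀ i < h.arr aSz m, h'.arr aSlot (top + i) = h.arr aSlot (h.arr aBase m + i))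
    (e3 : h'.arr aBase = Function.update (h.arr aBase) m top)
    (e4 : h'.arr aCap = Function.update (h.arr aCap) m (2 * h.arr aSz m)) :
    Micro B N (top + 2 * h.arr aSz m) h' ∧
      ∑ j ∈ Finset.range N, (2 * h'.arr aSz j - h'.arr aCap j) + h.arr aSz m =
        ∑ j ∈ Finset.range N, (2 * h.arr aSz j - h.arr aCap j) := by
  simp only [List.mem_cons, List.not_mem_nil, or_false, forall_eq_or_imp, forall_eq] at e
  obtain ⟨b0, b1, b2, b3, b4, b5, b6, b7⟩ := e
  have hsum : ∑ j ∈ Finset.range N, (2 * h'.arr aSz j - h'.arr aCap j) + h.arr aSz m =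
        ∑ j ∈ Finset.range N, (2 * h.arr aSz j - h.arr aCap j) := by
    have := Finset.sum_range_update hm (fun j => 2 * h.arr aSz j - h.arr aCap j) 0
    have hv : 2 * h.arr aSz m - h.arr aCap m = h.arr aSz m := by omega
    rw [hv] at this
    have e5 : (fun j => 2 * h'.arr aSz j - h'.arr aCap j) =
        Function.update (fun j => 2 * h.arr aSz j - h.arr aCap j) m 0 := by
      funext j
      rw [e4, b6, Function.update_apply, Function.update_apply]
      split_ifs with hj
      · subst hj; simp
      · rfl
    rw [e5]
    omega
  refine ⟨?_, hsum⟩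
  have hz := H.mkd_zero
  have hc := hc
  have e2 := e2
  have e4 := e4
  have hslot := H.slot_eq
  have hseg := H.seg
  have hdisj := H.disj
  have hcap := H.cap_le
  have hszc := H.sz_le_cap
  have hsp := H.space
  have hml := @mic_lt _ _ _ _ H
  obtain ⟨a1, a2, a3, a4, a5, a6, a7, a8, a9, a10, a11, a12, a13, a14, a15, a16, a17, a18, a19,
    a20, a21, a22, a23, -⟩ := H
  unfold Mkd at hz
  rw [← b0, ← b1, ← b2, ← b3, ← b4, ← b5, ← b6, ← b7] at *
  refine ⟨a1, a2, a3, a4, a5, a6, a7, a8, a9, a10, a11, ?_, a13, a14, ?_, ?_, a17, a18, a19,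
    a20, ?_, ?_, ?_, hz⟩
  · intro j hj
    have i1 := a10 j hj
    rw [e3, Function.update_apply]
    split_ifs with hjm
    · rw [e2 _ (by rw [← hjm]; exact i1), ← hjm, hslot j hj]
    · have := hseg _ (hml hj) (a6 j hj)
      have := hszc _ (hml hj) (a6 j hj)
      rw [e1 _ (by omega), hslot j hj]
  · intro j hj hjj
    rw [e4, Function.update_apply]
    split_ifs with hjm
    · subst hjm; omega
    · exact hszc j hj hjj
  · intro j hj
    rw [e4, Function.update_apply]
    split_ifs with hjm
    · subst hjm; rfl
    · exact hcap j hj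
  · intro j hj hjj
    rw [e3, e4, Function.update_apply, Function.update_apply]
    split_ifs with hjm
    · exact le_rfl
    · have := hseg j hj hjj; omega
  · intro j hj j' hj' hjj hjj' hne i hi i' hi'
    rw [e4, Function.update_apply] at hi hi'
    rw [e3, Function.update_apply, Function.update_apply]
    split_ifs at hi hi' ⊢ with c1 c2 c2
    · exact absurd (c1.trans c2.symm) hne
    · have := hseg j' hj' hjj'; omega
    · have := hseg j hj hjj; omega
    · exact hdisj j hj j' hj' hjj hjj' hne i hi i' hi'
  -- The used length grows by `2 * aSz m`, and the sum falls by `aSz m`, so the weighted total in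
  -- `space` is unchanged.
  · omega

end Micro

/-! ### New nodes in the microtree decomposition -/

/-- The state `h'` has the new node `N` below `p`; the old nodes keep their data. -/
structure NewNode (N p : ℕ) (h h' : AState) : Prop where
  old : ∀ k ∈ [aPar, aMic, aAnc, aBit, aMk, aBase, aCap], ∀ j < N, h'.arr k j = h.arr k j
  par_new : h'.arr aPar N = p

namespace NewNode

variable {N p : ℕ} {h h' : AState} (E : NewNode N p h h')
include E

theorem par {j : ℕ} (hj : j < N) : h'.arr aPar j = h.arr aPar j := E.old _ (by simp) j hj
theorem mic {j : ℕ} (hj : j < N) : h'.arr aMic j = h.arr aMic j := E.old _ (by simp) j hj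
theorem anc {j : ℕ} (hj : j < N) : h'.arr aAnc j = h.arr aAnc j := E.old _ (by simp) j hj
theorem bit {j : ℕ} (hj : j < N) : h'.arr aBit j = h.arr aBit j := E.old _ (by simp) j hj
theorem mk' {j : ℕ} (hj : j < N) : h'.arr aMk j = h.arr aMk j := E.old _ (by simp) j hj
theorem base {j : ℕ} (hj : j < N) : h'.arr aBase j = h.arr aBase j := E.old _ (by simp) j hj
theorem cap {j : ℕ} (hj : j < N) : h'.arr aCap j = h.arr aCap j := E.old _ (by simp) j hj

end NewNode

namespace Micro

variable {B N top p : ℕ} {h h' : AState}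

theorem cov_new (H : Micro B N top h) (E : NewNode N p h h') {j : ℕ} (hj : j < N) :
    Cov h' j ↔ Cov h j := by
  unfold Cov; rw [E.anc hj, E.mic hj, E.mk' (H.mic_lt hj)]

theorem mkd_new (H : Micro B N top h) (E : NewNode N p h h') {j : ℕ} (hj : j < N) :
    Mkd h' j ↔ Mkd h j := by
  unfold Mkd; rw [E.bit hj, E.mic hj, E.mk' (H.mic_lt hj)]

theorem two_pow_inj {B s t : ℕ} (hs : s < B) (ht : t < B)
    (h : 2 ^ (B - 1 - s) = 2 ^ (B - 1 - t)) : s = t := by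
  have := Nat.pow_right_injective le_rfl h
  omega

/-- The table `aIdx` is shared by all microtrees. Writing an entry again does no harm, since a bit
stands for the same index everywhere. -/
theorem idx_new (H : Micro B N top h) (E : NewNode N p h h') {s : ℕ} (hs : s < B)
    (i1 : h'.arr aIdx (2 ^ (B - 1 - s)) = s)
    (i2 : ∀ i, i ≠ 2 ^ (B - 1 - s) → h'.arr aIdx i = h.arr aIdx i) {j : ℕ} (hj : j < N) :
    h'.arr aIdx (h'.arr aBit j) = h.arr aIdx (h.arr aBit j) := by
  rw [E.bit hj]
  by_cases e : h.arr aBit j = 2 ^ (B - 1 - s)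
  · rw [e, i1]
    have h1 := H.bit_eq j hj
    rw [e] at h1
    exact two_pow_inj hs (e ▸ H.idx_lt_B hj) h1
  · exact i2 _ e

/-- A new node joins the microtree of its parent. -/
theorem join (H : Micro B N top h) (E : NewNode N p h h') (hp : p < N) {m s : ℕ}
    (hm : m = h.arr aMic p) (hs : s = h.arr aSz m) (hsB : s < B) (hsc : s < h.arr aCap m)
    (m1 : h'.arr aMic N = m) (a1 : h'.arr aAnc N = h.arr aAnc p ||| 2 ^ (B - 1 - s))
    (b1 : h'.arr aBit N = 2 ^ (B - 1 - s))
    (n1 : h'.arr aNb m = if s + 1 < B then 2 ^ (B - 1 - (s + 1)) else 0)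
    (n2 : ∀ j < N, j ≠ m → h'.arr aNb j = h.arr aNb j)
    (s1 : h'.arr aSz m = s + 1) (s2 : ∀ j < N, j ≠ m → h'.arr aSz j = h.arr aSz j)
    (s3 : h'.arr aSz N = 0) (c1 : h'.arr aCap N = 0)
    (l1 : h'.arr aSlot (h.arr aBase m + s) = N)
    (l2 : ∀ i, i ≠ h.arr aBase m + s → h'.arr aSlot i = h.arr aSlot i)
    (i1 : h'.arr aIdx (2 ^ (B - 1 - s)) = s)
    (i2 : ∀ i, i ≠ 2 ^ (B - 1 - s) → h'.arr aIdx i = h.arr aIdx i) :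
    Micro B (N + 1) top h' ∧
      ∑ j ∈ Finset.range (N + 1), (2 * h'.arr aSz j - h'.arr aCap j) =
        ∑ j ∈ Finset.range N, (2 * h.arr aSz j - h.arr aCap j) + 2 := by
  have hmN : m < N := hm ▸ H.mic_lt hp
  have hmm : h.arr aMic m = m := by rw [hm]; exact H.mic_mic p hp
  have hcap := H.cap_le m hmN
  have hidx := @idx_new _ _ _ _ _ _ H E s hsB i1 i2
  have hidxN : h'.arr aIdx (h'.arr aBit N) = s := by rw [b1, i1]
  have hsum : ∑ j ∈ Finset.range (N + 1), (2 * h'.arr aSz j - h'.arr aCap j) =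
        ∑ j ∈ Finset.range N, (2 * h.arr aSz j - h.arr aCap j) + 2 := by
    rw [Finset.sum_range_succ, s3, c1]
    have := Finset.sum_range_update hmN (fun j => 2 * h.arr aSz j - h.arr aCap j)
      (2 * h'.arr aSz m - h'.arr aCap m)
    have e : ∑ j ∈ Finset.range N, (2 * h'.arr aSz j - h'.arr aCap j) =
        ∑ j ∈ Finset.range N, Function.update (fun j => 2 * h.arr aSz j - h.arr aCap j) m
          (2 * h'.arr aSz m - h'.arr aCap m) j := by
      refine Finset.sum_congr rfl fun j hj => ?_
      rw [Finset.mem_range] at hj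
      rw [Function.update_apply]
      split_ifs with hjm
      · rw [hjm]
      · rw [s2 j hj hjm, E.cap hj]
    have hv : 2 * h'.arr aSz m - h'.arr aCap m = 2 * h.arr aSz m - h.arr aCap m + 2 := by
      rw [s1, E.cap hmN]; omega
    rw [hv] at this e
    omega
  have hmic : ∀ j < N + 1, h'.arr aMic j = j → j < N ∧ h.arr aMic j = j := by
    intro j hj hjj
    rcases Nat.lt_succ_iff_lt_or_eq.1 hj with hj | rfl
    · exact ⟨hj, by rwa [E.mic hj] at hjj⟩
    · omega
  refine ⟨⟨by omega, ?_, ?_, ?_, ?_, ?_, ?_, ?_, ?_, ?_, ?_, ?_, ?_, ?_, ?_, ?_, ?_, ?_, ?_, ?_, ?_,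
    ?_, ?_, ?_⟩, hsum⟩
  · rw [E.par H.pos, H.par_zero]
  · intro j hj h0
    rcases Nat.lt_succ_iff_lt_or_eq.1 hj with hj | rfl
    · rw [E.par hj]; exact H.par_lt j hj h0
    · rw [E.par_new]; exact hp
  · intro j hj
    rcases Nat.lt_succ_iff_lt_or_eq.1 hj with hj | rfl
    · rw [E.par hj, E.mic hj, E.mic (H.par_lt' hj)]; exact H.mic_or j hj
    · right; rw [E.par_new, m1, E.mic hp, hm]; exact ⟨H.pos, rfl⟩
  · intro j hj
    rcases Nat.lt_succ_iff_lt_or_eq.1 hj with hj | rfl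
    · rw [E.mic hj]; exact H.mic_le j hj
    · omega
  · intro j hj
    rcases Nat.lt_succ_iff_lt_or_eq.1 hj with hj | rfl
    · rw [E.mic hj, E.mic (H.mic_lt hj)]; exact H.mic_mic j hj
    · rw [m1, E.mic hmN, hmm]
  · intro j hj h0 hjj
    obtain ⟨hj, hjj⟩ := hmic j hj hjj
    have h1 := H.full j hj h0 hjj
    rw [E.par hj, E.mic (H.par_lt' hj)]
    have h2 := H.par_lt' hj
    rw [n2 _ (H.mic_lt h2)]
    · exact h1
    -- Below `m` there is no microtree yet: one would require `m` to be full.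
    · intro e
      rw [e, H.nb_eq m hmN hmm, if_pos (by omega)] at h1
      exact absurd h1 (by positivity)
  · intro j hj hjj
    obtain ⟨hj, hjj⟩ := hmic j hj hjj
    rw [E.anc hj, E.bit hj]; exact H.anc_root j hj hjj
  · intro j hj hjj
    rcases Nat.lt_succ_iff_lt_or_eq.1 hj with hj | rfl
    · rw [E.mic hj] at hjj
      rw [E.anc hj, E.bit hj, E.par hj, E.anc (H.par_lt' hj)]; exact H.anc_step j hj hjj
    · rw [E.par_new, a1, E.anc hp, b1]
  · intro j hj
    rcases Nat.lt_succ_iff_lt_or_eq.1 hj with hj | rfl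
    · rw [hidx hj, E.mic hj]
      have := H.idx_lt j hj
      by_cases e : h.arr aMic j = m
      · rw [e] at this ⊢; omega
      · rwa [s2 _ (H.mic_lt hj) e]
    · rw [hidxN, m1]; omega
  · intro j hj
    rcases Nat.lt_succ_iff_lt_or_eq.1 hj with hj | rfl
    · rw [hidx hj, E.bit hj]; exact H.bit_eq j hj
    · rw [hidxN, b1]
  · intro j hj
    rcases Nat.lt_succ_iff_lt_or_eq.1 hj with hj | rfl
    · rw [hidx hj, E.mic hj, E.base (H.mic_lt hj), l2]
      · exact H.slot_eq j hj
      · have h1 := H.idx_lt j hj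
        have h2 := H.sz_le_cap _ (H.mic_lt hj) (H.mic_mic j hj)
        by_cases e : h.arr aMic j = m
        · rw [e] at h1 ⊢; omega
        · exact H.disj _ (H.mic_lt hj) m hmN (H.mic_mic j hj) hmm e _ (by omega) _ hsc
    · rw [hidxN, m1, E.base hmN, l1]
  · intro j hj hjj
    rcases Nat.lt_succ_iff_lt_or_eq.1 hj with hj | rfl
    · rw [E.mic hj] at hjj
      rw [hidx hj, E.par hj, hidx (H.par_lt' hj)]; exact H.idx_par_lt j hj hjj
    · rw [hidxN, E.par_new, hidx hp, hs, hm]; exact H.idx_lt p hp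
  · intro j hj hjj
    obtain ⟨hj, hjj⟩ := hmic j hj hjj
    by_cases e : j = m
    · rw [e]; omega
    · rw [s2 j hj e]; exact H.sz_pos j hj hjj
  · intro j hj hjj
    obtain ⟨hj, hjj⟩ := hmic j hj hjj
    rw [E.cap hj]
    by_cases e : j = m
    · rw [e]; omega
    · rw [s2 j hj e]; exact H.sz_le_cap j hj hjj
  · intro j hj
    rcases Nat.lt_succ_iff_lt_or_eq.1 hj with hj | rfl
    · rw [E.cap hj]
      by_cases e : j = m
      · rw [e]; omega
      · rw [s2 j hj e]; exact H.cap_le j hj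
    · omega
  · intro j hj hjj
    obtain ⟨hj, hjj⟩ := hmic j hj hjj
    by_cases e : j = m
    · rw [e]; omega
    · rw [s2 j hj e]; exact H.sz_le j hj hjj
  · intro j hj hjj
    obtain ⟨hj, hjj⟩ := hmic j hj hjj
    by_cases e : j = m
    · rw [e, n1, s1]
    · rw [s2 j hj e, n2 j hj e]; exact H.nb_eq j hj hjj
  · intro j hj hjj
    rcases Nat.lt_succ_iff_lt_or_eq.1 hj with hj | rfl
    · rw [E.mic hj] at hjj
      rw [s2 j hj (by rintro rfl; exact hjj hmm)]; exact H.sz_zero j hj hjj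
    · exact s3
  · intro j hj hjj e he
    obtain ⟨hj, hjj⟩ := hmic j hj hjj
    rw [E.mk' hj] at he
    have := H.mk_bits j hj hjj e he
    by_cases e : j = m
    · rw [e] at this ⊢; omega
    · rwa [s2 j hj e]
  · intro j hj hjj
    obtain ⟨hj, hjj⟩ := hmic j hj hjj
    rw [E.base hj, E.cap hj]; exact H.seg j hj hjj
  · intro j hj j' hj' hjj hjj'
    obtain ⟨hj, hjj⟩ := hmic j hj hjj
    obtain ⟨hj', hjj'⟩ := hmic j' hj' hjj'
    rw [E.base hj, E.cap hj, E.base hj', E.cap hj']; exact H.disj j hj j' hj' hjj hjj'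
  -- The new node adds `2` to the sum, hence `4` to the left side of `space`, as much as to the
  -- right side.
  · have := H.space
    omega
  · rw [H.mkd_new E H.pos]; exact H.mkd_zero

/-- By `mk_bits`, marks occupy only bits already handed out, so the bit of the new node is clear. -/
theorem join_mkd (H : Micro B N top h) (E : NewNode N p h h') (hp : p < N) {m s : ℕ}
    (hm : m = h.arr aMic p) (hs : s = h.arr aSz m) (hsB : s < B) (m1 : h'.arr aMic N = m)
    (b1 : h'.arr aBit N = 2 ^ (B - 1 - s)) : ¬ Mkd h' N := by
  have hmN : m < N := hm ▸ H.mic_lt hp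
  have hmm : h.arr aMic m = m := by rw [hm]; exact H.mic_mic p hp
  unfold Mkd
  rw [m1, b1, Nat.land_comm, E.mk' hmN, Nat.and_two_pow_ne_zero]
  intro hb
  have := H.mk_bits m hmN hmm _ hb
  omega

/-- A new node starts a new microtree. -/
theorem fresh (H : Micro B N top h) (E : NewNode N p h h') (hp : p < N) (hB : 1 < B)
    (hf : h.arr aNb (h.arr aMic p) = 0)
    (m1 : h'.arr aMic N = N) (a1 : h'.arr aAnc N = 2 ^ (B - 1))
    (b1 : h'.arr aBit N = 2 ^ (B - 1)) (k1 : h'.arr aMk N = 0)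
    (n1 : h'.arr aNb N = 2 ^ (B - 1 - 1)) (n2 : ∀ j < N, h'.arr aNb j = h.arr aNb j)
    (s1 : h'.arr aSz N = 1) (s2 : ∀ j < N, h'.arr aSz j = h.arr aSz j)
    (c1 : h'.arr aCap N = 1) (t1 : h'.arr aBase N = top)
    (l1 : h'.arr aSlot top = N) (l2 : ∀ i, i ≠ top → h'.arr aSlot i = h.arr aSlot i)
    (i1 : h'.arr aIdx (2 ^ (B - 1)) = 0)
    (i2 : ∀ i, i ≠ 2 ^ (B - 1) → h'.arr aIdx i = h.arr aIdx i) :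
    Micro B (N + 1) (top + 1) h' ∧
      ∑ j ∈ Finset.range (N + 1), (2 * h'.arr aSz j - h'.arr aCap j) =
        ∑ j ∈ Finset.range N, (2 * h.arr aSz j - h.arr aCap j) + 1 := by
  have hidx := @idx_new _ _ _ _ _ _ H E 0 (by omega) i1 i2
  have hidxN : h'.arr aIdx (h'.arr aBit N) = 0 := by rw [b1, i1]
  have hsum : ∑ j ∈ Finset.range (N + 1), (2 * h'.arr aSz j - h'.arr aCap j) =
        ∑ j ∈ Finset.range N, (2 * h.arr aSz j - h.arr aCap j) + 1 := by
    rw [Finset.sum_range_succ, s1, c1]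
    congr 1
    refine Finset.sum_congr rfl fun j hj => ?_
    rw [Finset.mem_range] at hj
    rw [s2 j hj, E.cap hj]
  refine ⟨⟨by omega, ?_, ?_, ?_, ?_, ?_, ?_, ?_, ?_, ?_, ?_, ?_, ?_, ?_, ?_, ?_, ?_, ?_, ?_, ?_, ?_,
    ?_, ?_, ?_⟩, hsum⟩
  · rw [E.par H.pos, H.par_zero]
  · intro j hj h0
    rcases Nat.lt_succ_iff_lt_or_eq.1 hj with hj | rfl
    · rw [E.par hj]; exact H.par_lt j hj h0
    · rw [E.par_new]; exact hp
  · intro j hj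
    rcases Nat.lt_succ_iff_lt_or_eq.1 hj with hj | rfl
    · rw [E.par hj, E.mic hj, E.mic (H.par_lt' hj)]; exact H.mic_or j hj
    · exact .inl m1
  · intro j hj
    rcases Nat.lt_succ_iff_lt_or_eq.1 hj with hj | rfl
    · rw [E.mic hj]; exact H.mic_le j hj
    · omega
  · intro j hj
    rcases Nat.lt_succ_iff_lt_or_eq.1 hj with hj | rfl
    · rw [E.mic hj, E.mic (H.mic_lt hj)]; exact H.mic_mic j hj
    · rw [m1, m1]
  · intro j hj h0 hjj
    rcases Nat.lt_succ_iff_lt_or_eq.1 hj with hj | rfl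
    · rw [E.mic hj] at hjj
      have h2 := H.par_lt' hj
      rw [E.par hj, E.mic h2, n2 _ (H.mic_lt h2)]
      exact H.full j hj h0 hjj
    · rw [E.par_new, E.mic hp, n2 _ (H.mic_lt hp), hf]
  · intro j hj hjj
    rcases Nat.lt_succ_iff_lt_or_eq.1 hj with hj | rfl
    · rw [E.mic hj] at hjj
      rw [E.anc hj, E.bit hj]; exact H.anc_root j hj hjj
    · rw [a1, b1]
  · intro j hj hjj
    rcases Nat.lt_succ_iff_lt_or_eq.1 hj with hj | rfl
    · rw [E.mic hj] at hjj
      rw [E.anc hj, E.bit hj, E.par hj, E.anc (H.par_lt' hj)]; exact H.anc_step j hj hjj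
    · exact absurd m1 hjj
  · intro j hj
    rcases Nat.lt_succ_iff_lt_or_eq.1 hj with hj | rfl
    · rw [hidx hj, E.mic hj, s2 _ (H.mic_lt hj)]; exact H.idx_lt j hj
    · rw [hidxN, m1, s1]; omega
  · intro j hj
    rcases Nat.lt_succ_iff_lt_or_eq.1 hj with hj | rfl
    · rw [hidx hj, E.bit hj]; exact H.bit_eq j hj
    · rw [hidxN, b1]; rfl
  · intro j hj
    rcases Nat.lt_succ_iff_lt_or_eq.1 hj with hj | rfl
    · rw [hidx hj, E.mic hj, E.base (H.mic_lt hj), l2]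
      · exact H.slot_eq j hj
      · have h1 := H.idx_lt j hj
        have h2 := H.sz_le_cap _ (H.mic_lt hj) (H.mic_mic j hj)
        have h3 := H.seg _ (H.mic_lt hj) (H.mic_mic j hj)
        omega
    · rw [hidxN, m1, t1]; exact l1
  · intro j hj hjj
    rcases Nat.lt_succ_iff_lt_or_eq.1 hj with hj | rfl
    · rw [E.mic hj] at hjj
      rw [hidx hj, E.par hj, hidx (H.par_lt' hj)]; exact H.idx_par_lt j hj hjj
    · exact absurd m1 hjj
  · intro j hj hjj
    rcases Nat.lt_succ_iff_lt_or_eq.1 hj with hj | rfl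
    · rw [E.mic hj] at hjj
      rw [s2 j hj]; exact H.sz_pos j hj hjj
    · omega
  · intro j hj hjj
    rcases Nat.lt_succ_iff_lt_or_eq.1 hj with hj | rfl
    · rw [E.mic hj] at hjj
      rw [s2 j hj, E.cap hj]; exact H.sz_le_cap j hj hjj
    · omega
  · intro j hj
    rcases Nat.lt_succ_iff_lt_or_eq.1 hj with hj | rfl
    · rw [s2 j hj, E.cap hj]; exact H.cap_le j hj
    · omega
  · intro j hj hjj
    rcases Nat.lt_succ_iff_lt_or_eq.1 hj with hj | rfl
    · rw [E.mic hj] at hjj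
      rw [s2 j hj]; exact H.sz_le j hj hjj
    · omega
  · intro j hj hjj
    rcases Nat.lt_succ_iff_lt_or_eq.1 hj with hj | rfl
    · rw [E.mic hj] at hjj
      rw [s2 j hj, n2 j hj]; exact H.nb_eq j hj hjj
    · rw [n1, s1, if_pos hB]
  · intro j hj hjj
    rcases Nat.lt_succ_iff_lt_or_eq.1 hj with hj | rfl
    · rw [E.mic hj] at hjj
      rw [s2 j hj]; exact H.sz_zero j hj hjj
    · exact absurd m1 hjj
  · intro j hj hjj e he
    rcases Nat.lt_succ_iff_lt_or_eq.1 hj with hj | rfl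
    · rw [E.mic hj] at hjj
      rw [E.mk' hj] at he
      rw [s2 j hj]; exact H.mk_bits j hj hjj e he
    · simp [k1] at he
  · intro j hj hjj
    rcases Nat.lt_succ_iff_lt_or_eq.1 hj with hj | rfl
    · rw [E.mic hj] at hjj
      have := H.seg j hj hjj
      rw [E.base hj, E.cap hj]; omega
    · omega
  · intro j hj j' hj' hjj hjj' hne i hi i' hi'
    rcases Nat.lt_succ_iff_lt_or_eq.1 hj with hj | rfl
    · rw [E.mic hj] at hjj
      have h1 := H.seg j hj hjj
      rw [E.cap hj] at hi
      rw [E.base hj]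
      rcases Nat.lt_succ_iff_lt_or_eq.1 hj' with hj' | rfl
      · rw [E.mic hj'] at hjj'
        rw [E.cap hj'] at hi'
        rw [E.base hj']; exact H.disj j hj j' hj' hjj hjj' hne i hi i' hi'
      · omega
    · rcases Nat.lt_succ_iff_lt_or_eq.1 hj' with hj' | rfl
      · rw [E.mic hj'] at hjj'
        have h1 := H.seg j' hj' hjj'
        rw [E.cap hj'] at hi'
        rw [E.base hj']; omega
      · exact absurd rfl hne
  · have := H.space
    omega
  · rw [H.mkd_new E H.pos]; exact H.mkd_zero

end Micro

/-! ### Lists of children -/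

/-- The children of `i`, the youngest first. -/
def kids (N : ℕ) (par : ℕ → ℕ) (i : ℕ) : List ℕ :=
  ((List.range N).filter fun j => decide (0 < j ∧ par j = i)).reverse

theorem mem_kids {N : ℕ} {par : ℕ → ℕ} {i j : ℕ} :
    j ∈ kids N par i ↔ j < N ∧ 0 < j ∧ par j = i := by
  simp [kids]

theorem nodup_kids {N : ℕ} {par : ℕ → ℕ} {i : ℕ} : (kids N par i).Nodup :=
  List.nodup_reverse.2 (List.nodup_range.filter _)

theorem kids_congr {N : ℕ} {par par' : ℕ → ℕ} (h : ∀ j < N, par' j = par j) (i : ℕ) :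
    kids N par' i = kids N par i := by
  unfold kids
  congr 1
  refine List.filter_congr fun j hj => ?_
  rw [h j (List.mem_range.1 hj)]

/-- The order from the youngest on is the one that insertion at the head of a linked list produces.
-/
theorem kids_succ {N p : ℕ} (hN : 0 < N) {par par' : ℕ → ℕ} (h : ∀ j < N, par' j = par j)
    (hp : par' N = p) (i : ℕ) :
    kids (N + 1) par' i = if i = p then N :: kids N par i else kids N par i := by
  rw [← kids_congr h]
  unfold kids
  rw [List.range_succ, List.filter_append, List.reverse_append]
  by_cases e : i = p
  · simp [hp, e, hN]
  · simp [hp, Ne.symm e, e]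

/-- The linked list that starts at `a`, with `0` as the null pointer. -/
def LinkedFrom (nxt : ℕ → ℕ) : ℕ → List ℕ → Prop
  | a, [] => a = 0
  | a, x :: L => a = x ∧ x ≠ 0 ∧ LinkedFrom nxt (nxt x) L

theorem LinkedFrom.congr {nxt nxt' : ℕ → ℕ} {L : List ℕ} {a : ℕ} (h : LinkedFrom nxt a L)
    (H : ∀ x ∈ L, nxt' x = nxt x) : LinkedFrom nxt' a L := by
  induction L generalizing a with
  | nil => exact h
  | cons x L ih =>
    obtain ⟨h1, h2, h3⟩ := h
    refine ⟨h1, h2, ?_⟩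
    rw [H x (by simp)]
    exact ih h3 fun y hy => H y (by simp [hy])

/-- The lists of children. -/
def KidLists (N : ℕ) (par head sib : ℕ → ℕ) : Prop :=
  ∀ i < N, LinkedFrom sib (head i) (kids N par i)

theorem KidLists.newNode {N p : ℕ} {par head sib par' head' sib' : ℕ → ℕ}
    (H : KidLists N par head sib) (hN : 0 < N) (hp : p < N)
    (hpar : ∀ j < N, 0 < j → par j < j) (h1 : ∀ j < N, par' j = par j) (h2 : par' N = p)
    (h3 : ∀ j < N, j ≠ p → head' j = head j) (h4 : head' p = N) (h5 : head' N = 0)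
    (h6 : ∀ j < N, sib' j = sib j) (h7 : sib' N = head p) :
    KidLists (N + 1) par' head' sib' := by
  intro i hi
  rw [kids_succ hN h1 h2]
  have hsib : ∀ i < N, LinkedFrom sib' (head i) (kids N par i) := fun i hi =>
    (H i hi).congr fun x hx => h6 x (mem_kids.1 hx).1
  rcases Nat.lt_succ_iff_lt_or_eq.1 hi with hi | rfl
  · split_ifs with e
    · subst e
      exact ⟨h4, hN.ne', by rw [h7]; exact hsib i hp⟩
    · rw [h3 i hi e]; exact hsib i hi
  · rw [if_neg hp.ne', h5]
    have : kids i par i = [] := by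
      rw [List.eq_nil_iff_forall_not_mem]
      intro j hj
      obtain ⟨a, b, c⟩ := mem_kids.1 hj
      have := hpar j a b
      omega
    rw [this]; rfl

/-! ### The invariant of the forest and its potential -/

/-- `M` is the root of a microtree to which no further nodes can be added. -/
def FullM (h : AState) (N M : ℕ) : Prop := M < N ∧ h.arr aMic M = M ∧ h.arr aNb M = 0

/-- The state `h` holds the data structure for a forest with `N` nodes. -/
structure Forest (w N : ℕ) (tr : ℕ → Grove) (h : AState) : Prop where
  micro : Micro (w - 6) N (h.var 2) h
  size : h.var 1 = N
  topBit : h.var 4 = 2 ^ (w - 6 - 1)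
  kidLists : KidLists N (h.arr aPar) (h.arr aHead) (h.arr aSib)
  comps : Components (FullM h N) (fun M => Cov h (h.arr aPar M)) (fun M => h.arr aMic (h.arr aPar M))
    (h.arr aLab) (h.arr aTop) (h.arr aNx) (h.arr aPv) tr

open Classical in
/-- The potential of the uncovered nodes. -/
noncomputable def covSum (N : ℕ) (h : AState) : ℕ :=
  ∑ z ∈ Finset.range N, if Cov h z then 0 else 1 + (kids N (h.arr aPar) z).length

/-- The potential of the data structure. -/
noncomputable def potential (N : ℕ) (tr : ℕ → Grove) (h : AState) : ℕ :=
  -- The terms pay for splitting components, for visiting nodes that become covered and their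
  -- children, for inserting microtrees that become full, and for copying arrays that are doubled.
  12 * groveSum N tr + 30 * covSum N h +
    12 * ∑ j ∈ Finset.range N, (if h.arr aNb j = 0 then 0 else h.arr aSz j) +
    3 * ∑ j ∈ Finset.range N, (2 * h.arr aSz j - h.arr aCap j)

theorem Micro.bit_lt_lim {w N top : ℕ} {h : AState} (H : Micro (w - 6) N top h) {j : ℕ}
    (hj : j < N) : h.arr aBit j < lim w := by
  rw [H.bit_eq j hj]
  have := H.idx_lt_B hj
  exact Nat.pow_lt_pow_right (by norm_num) (by omega)

theorem Micro.top_le {B N top : ℕ} {h : AState} (H : Micro B N top h) : top ≤ 4 * N := by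
  have := H.space; omega

theorem Micro.slot_lt {B N top : ℕ} {h : AState} (H : Micro B N top h) {j : ℕ}
    (hj : j < N) : h.arr aBase (h.arr aMic j) + h.arr aIdx (h.arr aBit j) < top := by
  have h1 := H.idx_lt j hj
  have h2 := H.seg _ (H.mic_lt hj) (H.mic_mic j hj)
  have h3 := H.sz_le_cap _ (H.mic_lt hj) (H.mic_mic j hj)
  omega

/-! ### Queries in the forest -/

/-- Puts the marked ancestors of the node `40` in its microtree into the variable `42`. -/
def localProg : AProg :=
  .set 41 (.ld aMic (.v 40));;
  .set 42 (.op .and (.ld aAnc (.v 40)) (.ld aMk (.v 41)))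

/-- Puts the node with the lowest bit of `42` into the variable `43`. -/
def lookupProg : AProg :=
  .set 43 (.ld aSlot (.op .add (.ld aBase (.v 41))
    (.ld aIdx (.op .sub (.v 42) (.op .and (.v 42) (.op .sub (.v 42) (.c 1)))))))

/-- Finds the nearest marked ancestor of the node `40`. -/
def findProg : AProg :=
  localProg;;
  .ite (.v 42) (.set 40 (.v 40))
    (.set 40 (.ld aPar (.v 41));;
      localProg;;
      .ite (.v 42) (.set 40 (.v 40))
        (.set 40 (.ld aPar (.ld aTop (.ld aLab (.v 41))));; localProg));;
  lookupProg

theorem runs_localProg {w N top : ℕ} {h : AState} {j : ℕ} (H : Micro (w - 6) N top h)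
    (hN : N ≤ lim w) (hj : j < N) (e : h.var 40 = j) {Q : AState → ℕ → Prop}
    (hQ : Q ((h.setVar 41 (h.arr aMic j)).setVar 42
      (h.arr aAnc j &&& h.arr aMk (h.arr aMic j))) 2) : Runs w localProg h Q := by
  have := H.mic_lt hj
  simp only [localProg, runs_seq, runs_set, AExp.Ok, AExp.ev, AState.setVar_var,
    AState.setVar_arr, BinOp.val_and, BinOp.fits_and, e, true_and, and_true, if_true,
    Nat.reduceEqDiff, if_false]
  exact ⟨by omega, ⟨by omega, by omega⟩, hQ⟩

/-- The search starts at `j`, then at the parent of its microtree root, then at the parent of the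
top of the component. The last node is covered because the top is cut. -/
theorem Forest.runs_findProg {w N : ℕ} {tr : ℕ → Grove} {h : AState} (H : Forest w N tr h)
    (hN : 8 * (N + 1) ≤ lim w) {j : ℕ} (hj : j < N) (e : h.var 40 = j) :
    Runs w findProg h fun h' t => t ≤ 20 ∧ h'.arr = h.arr ∧ h'.inp = h.inp ∧
      (∀ i, i < 40 ∨ 50 ≤ i → h'.var i = h.var i) ∧
      Nearest (h.arr aPar) (Mkd h) j (h'.var 43) ∧ h'.var 43 < N := by
  have hlw := lim_lt w
  have htop := H.micro.top_le
  -- The common end of all three cases: `j'` is a covered node whose nearest marked ancestor is also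
  -- that of `j`.
  have fin : ∀ (h1 : AState) (j' t1 : ℕ), h1.arr = h.arr → h1.inp = h.inp →
      (∀ i, i < 40 ∨ 50 ≤ i → h1.var i = h.var i) → j' < N → Cov h j' → t1 ≤ 10 →
      (∀ r, Nearest (h.arr aPar) (Mkd h) j' r → Nearest (h.arr aPar) (Mkd h) j r) →
      h1.var 41 = h.arr aMic j' → h1.var 42 = h.arr aAnc j' &&& h.arr aMk (h.arr aMic j') →
      Runs w lookupProg h1 fun h' t => t1 + t ≤ 20 ∧ h'.arr = h.arr ∧ h'.inp = h.inp ∧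
          (∀ i, i < 40 ∨ 50 ≤ i → h'.var i = h.var i) ∧
          Nearest (h.arr aPar) (Mkd h) j (h'.var 43) ∧ h'.var 43 < N := by
    intro h1 j' t1 e1 e2 e3 hj' hc ht hr e41 e42
    obtain ⟨r, hrN, hm, hn, x, hx, hb⟩ := H.micro.nearest_of_cov j' hj' hc
    have h1' := H.micro.slot_lt hrN
    have h2' := H.micro.bit_lt_lim hrN
    have h3' := H.micro.mic_lt hj'
    have hx0 : 1 ≤ x := by
      unfold Cov at hc; rw [← hx] at hc; omega
    have hsub : x &&& (x - 1) ≤ x := Nat.and_le_left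
    rw [← hx] at e42
    rw [hm] at h1'
    have hs := H.micro.slot_eq r hrN
    rw [hm] at hs
    simp only [lookupProg, runs_set, AExp.Ok, AExp.ev, BinOp.val_and, BinOp.fits_and, BinOp.val_sub,
      BinOp.fits_sub, BinOp.val_add, BinOp.fits_add, e41, e42, e1, hb, true_and, and_true,
      AState.setVar_var, AState.setVar_arr, AState.setVar_inp, if_true, hs, hr r hn, hrN, e2]
    refine ⟨⟨⟨by omega, ⟨⟨hx0, hsub⟩, h2'⟩, by omega⟩, by omega⟩, by omega, ?_⟩
    intro i hi
    rw [if_neg (by omega)]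
    exact e3 i hi
  rw [findProg, runs_seq]
  refine runs_localProg H.micro (by omega) hj e ?_
  rw [runs_seq]
  by_cases hc : Cov h j
  · refine runs_ite_of_ne trivial (by simpa [AExp.ev, Cov] using hc) ?_
    rw [runs_set]
    refine ⟨trivial, (fin _ j 4 (by simp) (by simp) ?_ hj hc (by omega) (fun r hr => hr)
      (by simp) (by simp)).mono ?_⟩
    · intro i hi
      simp only [AState.setVar_var]
      iterate 3 rw [if_neg (by omega)]
    · rintro h' t ⟨b1, b2⟩; exact ⟨by omega, b2⟩
  have hn1 := H.micro.nearest_of_not_cov j hj hc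
  have hm0 : h.arr aMic j ≠ 0 := fun h0 => hc (H.micro.cov_of_mic_eq_zero j hj h0)
  have hmN := H.micro.mic_lt hj
  have hmm := H.micro.mic_mic j hj
  have hpN := H.micro.par_lt' hmN
  have hful := H.micro.full _ hmN (by omega) hmm
  refine runs_ite_of_eq trivial (by simpa [AExp.ev, Cov] using hc) ?_
  rw [runs_seq]
  simp only [runs_set, AExp.Ok, AExp.ev, AState.setVar_var, AState.setVar_arr, true_and, if_true,
    Nat.reduceEqDiff, if_false]
  refine ⟨by omega, ?_⟩
  rw [runs_seq]
  refine runs_localProg (N := N) (top := h.var 2) (j := h.arr aPar (h.arr aMic j))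
    (by exact H.micro.congr fun _ _ => rfl) (by omega) hpN (by simp) ?_
  by_cases hc2 : Cov h (h.arr aPar (h.arr aMic j))
  · refine runs_ite_of_ne trivial (by simpa [AExp.ev, Cov] using hc2) ?_
    rw [runs_set]
    refine ⟨trivial, (fin _ _ 8 (by simp) (by simp) ?_ hpN hc2 (by omega) hn1
      (by simp) (by simp)).mono ?_⟩
    · intro i hi
      simp only [AState.setVar_var]
      iterate 6 rw [if_neg (by omega)]
    · rintro h' t ⟨b1, b2⟩; exact ⟨by omega, b2⟩
  have hn2 := H.micro.nearest_of_not_cov _ hpN hc2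
  set q := h.arr aMic (h.arr aPar (h.arr aMic j)) with hq
  have hqf : FullM h N q := ⟨H.micro.mic_lt hpN, H.micro.mic_mic _ hpN, hful⟩
  obtain ⟨ht1, ht2⟩ := H.comps.top_spec hqf
  have hlab := (H.comps.label _ (H.comps.tr_ne_nil hqf)).1
  -- Between `q` and the top no edge is cut, so every microtree on the way is entered at an
  -- uncovered node and can be skipped.
  have hn3 : ∀ r, Nearest (h.arr aPar) (Mkd h) (h.arr aPar (h.arr aTop (h.arr aLab q))) r →
      Nearest (h.arr aPar) (Mkd h) (h.arr aPar q) r := by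
    intro r hr
    refine H.comps.top_induct (P := fun M => Nearest (h.arr aPar) (Mkd h) (h.arr aPar M) r)
      hqf hr ?_
    intro M hM hMc hMr
    exact H.micro.nearest_of_not_cov _ (H.micro.par_lt' hM.1) hMc r hMr
  have htN := H.micro.par_lt' ht1.1
  have b1 := ht1.1
  have b2 := hlab.1
  have b3 := hqf.1
  refine runs_ite_of_eq trivial (by simpa [AExp.ev, Cov] using hc2) ?_
  rw [runs_seq]
  simp only [runs_set, AExp.Ok, AExp.ev, AState.setVar_var, AState.setVar_arr, true_and, if_true,
    Nat.reduceEqDiff, if_false, ← hq]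
  refine ⟨⟨⟨by omega, by omega⟩, by omega⟩, ?_⟩
  refine runs_localProg (N := N) (top := h.var 2)
    (j := h.arr aPar (h.arr aTop (h.arr aLab q)))
    (by exact H.micro.congr fun _ _ => rfl) (by omega) htN (by simp) ?_
  refine (fin _ _ 10 (by simp) (by simp) ?_ htN ht2 (by omega)
    (fun r hr => hn1 r (hn2 r (hn3 r hr))) (by simp) (by simp)).mono ?_
  · intro i hi
    simp only [AState.setVar_var]
    iterate 8 rw [if_neg (by omega)]
  · rintro h' t ⟨b1, b2⟩; exact ⟨by omega, b2⟩

/-! ### Marking in the forest -/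

def nextSib : AProg := .set 25 (.ld aSib (.v 25))

/-- Goes through the siblings from `25` on: uncovered nodes of the microtree `21` are pushed on the
stack `23`, and roots of complete microtrees are cut off. -/
def kidLoop : AProg :=
  .while (.v 25)
    (.ite (.op .eq (.ld aMic (.v 25)) (.v 21))
      (.ite (.op .and (.ld aAnc (.v 25)) (.ld aMk (.v 21)))
        (.set 23 (.v 23))
        (.st aStk (.v 25) (.v 23);; .set 23 (.v 25)))
      (.ite (.ld aNb (.v 25))
        (.set 23 (.v 23))
        (.set 30 (.v 25);; cutProg));;
    nextSib)

/-- Explores the nodes of one microtree that the coming mark will cover. -/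
def coverLoop : AProg :=
  .while (.v 23)
    (.set 24 (.v 23);;
      .set 23 (.ld aStk (.v 24));;
      .set 25 (.ld aHead (.v 24));;
      kidLoop)

/-- Executed after the exploration, so that all tests for covered nodes refer to the old marks. -/
def setMark : AProg := .st aMk (.v 21) (.op .or (.ld aMk (.v 21)) (.ld aBit (.v 20)))

/-- Marks the node `20`. -/
def markProg : AProg :=
  .set 21 (.ld aMic (.v 20));;
  .ite (.op .and (.ld aAnc (.v 20)) (.ld aMk (.v 21)))
    (.set 23 (.v 23))
    (.st aStk (.v 20) (.c 0);; .set 23 (.v 20);; coverLoop);;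
  setMark

/-- The invariant of the traversal of the nodes below `x`: the nodes in `V` are finished, those in
`S` wait on the stack, and `D` holds for the treated children of finished nodes. -/
structure Cover (h₀ : AState) (N x : ℕ) (V S : List ℕ) (D : ℕ → Prop) (tr : ℕ → Grove)
    (h : AState) : Prop where
  arr : ∀ k, k ≠ aStk → k ≠ aLab → k ≠ aTop → k ≠ aNx → k ≠ aPv → h.arr k = h₀.arr k
  var : ∀ i, i < 20 ∨ 40 ≤ i → h.var i = h₀.var i
  inp : h.inp = h₀.inp
  var_x : h.var 20 = x
  var_m : h.var 21 = h₀.arr aMic x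
  stack : LinkedFrom (h.arr aStk) (h.var 23) S
  nodup : (V ++ S).Nodup
  below : ∀ z ∈ V ++ S, z < N ∧ Below h₀ x z ∧ ¬ Cov h₀ z ∧ x ≤ z
  closed : ∀ c < N, D c → h₀.arr aMic c = h₀.arr aMic x → ¬ Cov h₀ c → c ∈ V ++ S
  origin : ∀ z ∈ V ++ S, z = x ∨ D z
  mem : x ∈ V ++ S
  comps : Components (FullM h₀ N) (fun M => Cov h₀ (h₀.arr aPar M) ∨ D M)
    (fun M => h₀.arr aMic (h₀.arr aPar M)) (h.arr aLab) (h.arr aTop) (h.arr aNx) (h.arr aPv) tr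

theorem WordRAM.AState.setVar_self (h : AState) (i : ℕ) : h.setVar i (h.var i) = h := by
  simp [AState.setVar]

theorem WordRAM.AProg.runs_skip {w i : ℕ} {h : AState} {Q : AState → ℕ → Prop} :
    Runs w (.set i (.v i)) h Q ↔ Q h 1 := by
  rw [runs_set, AExp.ev, AState.setVar_self]
  exact ⟨fun h => h.2, fun h => ⟨trivial, h⟩⟩

theorem Cover.setVar {h₀ h : AState} {N x : ℕ} {V S : List ℕ} {D : ℕ → Prop} {tr : ℕ → Grove}
    (I : Cover h₀ N x V S D tr h) {i a : ℕ} (hi : 24 ≤ i ∧ i < 40) :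
    Cover h₀ N x V S D tr (h.setVar i a) where
  arr := I.arr
  var j hj := by rw [AState.setVar_var, if_neg (by omega)]; exact I.var j hj
  inp := I.inp
  var_x := by rw [AState.setVar_var, if_neg (by omega)]; exact I.var_x
  var_m := by rw [AState.setVar_var, if_neg (by omega)]; exact I.var_m
  stack := by
    rw [AState.setVar_var, if_neg (by omega)]; exact I.stack
  nodup := I.nodup
  below := I.below
  closed := I.closed
  origin := I.origin
  mem := I.mem
  comps := I.comps

/-- Nothing has to be done for a child that is neither an uncovered node of the same microtree nor a
node of the contracted forest. -/
theorem Cover.treat {h₀ h : AState} {N x c : ℕ} {V S : List ℕ} {D : ℕ → Prop} {tr : ℕ → Grove}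
    (I : Cover h₀ N x V S D tr h) (hc : h₀.arr aMic c = h₀.arr aMic x → Cov h₀ c)
    (hn : ∀ M, FullM h₀ N M → M ≠ c) : Cover h₀ N x V S (fun d => D d ∨ d = c) tr h :=
  { I with
    closed := by
      rintro d hd (h1 | rfl) h2 h3
      · exact I.closed d hd h1 h2 h3
      · exact absurd (hc h2) h3
    origin := fun z hz => (I.origin z hz).imp_right .inl
    comps := I.comps.congr (fun _ => Iff.rfl) (fun M hM => by simp [hn M hM]) (fun _ _ => rfl) }

/-- A child costs at most `30` steps besides those that `groveSum` pays for when an edge is cut. -/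
theorem Cover.runs_kidLoop {w N x y : ℕ} {h₀ : AState} {V : List ℕ}
    (H : Micro (w - 6) N (h₀.var 2) h₀) (hN : 8 * (N + 1) ≤ lim w) (hx : x < N) (hy : y ∈ V)
    (R : List ℕ) : ∀ (S : List ℕ) (D : ℕ → Prop) (tr : ℕ → Grove) (h : AState),
    Cover h₀ N x V S D tr h → LinkedFrom (h₀.arr aSib) (h.var 25) R → R.Nodup →
    (∀ c ∈ R, c < N ∧ 0 < c ∧ h₀.arr aPar c = y ∧ ¬ D c) →
    Runs w kidLoop h fun h' t => ∃ S' tr',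
      Cover h₀ N x V S' (fun c => D c ∨ c ∈ R) tr' h' ∧
      t + 12 * groveSum N tr' ≤ 12 * groveSum N tr + 30 * R.length + 1 := by
  induction R with
  | nil =>
    intro S D tr h I hl _ _
    refine runs_while_of_eq trivial hl ⟨S, tr, ?_, by simp; omega⟩
    simpa using I
  | cons c R ih =>
    intro S D tr h I hl hn hR
    obtain ⟨e25, hc0, hl⟩ := hl
    obtain ⟨hcN, -, hpar, hDc⟩ := hR c (by simp)
    rw [List.nodup_cons] at hn
    obtain ⟨hyN, hyb, hyc, hxy⟩ := I.below y (by simp [hy])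
    have hcy : y < c := hpar ▸ H.par_lt c hcN (by omega)
    have hmN := H.mic_lt hx
    have hmN' := H.mic_lt hcN
    have a1 : h.arr aMic = h₀.arr aMic := I.arr _ (by simp) (by simp) (by simp) (by simp) (by simp)
    have a2 : h.arr aAnc = h₀.arr aAnc := I.arr _ (by simp) (by simp) (by simp) (by simp) (by simp)
    have a8 : h.arr aMk = h₀.arr aMk := I.arr _ (by simp) (by simp) (by simp) (by simp) (by simp)
    have a9 : h.arr aNb = h₀.arr aNb := I.arr _ (by simp) (by simp) (by simp) (by simp) (by simp)
    -- A child in the microtree of `x` is not its root: that root is at most `y`, and `y < c`.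
    have hnotfull : (h₀.arr aMic c = h₀.arr aMic x ∨ h₀.arr aNb c ≠ 0) → ∀ M, FullM h₀ N M →
        M ≠ c := by
      rintro (h1 | h1) M hM rfl
      · have := H.mic_le y hyN
        rw [hyb.1] at this
        have := hM.2.1
        omega
      · exact h1 hM.2.2
    -- the rest of the loop
    have cont : ∀ (S' : List ℕ) (tr' : ℕ → Grove) (h1 : AState) (t1 : ℕ),
        Cover h₀ N x V S' (fun d => D d ∨ d = c) tr' h1 → h1.var 25 = c →
        t1 + 12 * groveSum N tr' ≤ 12 * groveSum N tr + 25 →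
        Runs w nextSib h1 fun h2 t2 =>
          Runs w kidLoop h2 fun h3 t3 => ∃ S' tr',
            Cover h₀ N x V S' (fun d => D d ∨ d ∈ c :: R) tr' h3 ∧
            t1 + t2 + t3 + 1 + 12 * groveSum N tr' ≤
              12 * groveSum N tr + 30 * (c :: R).length + 1 := by
      intro S' tr' h1 t1 I1 e1 ht
      have a5 : h1.arr aSib = h₀.arr aSib :=
        I1.arr _ (by simp) (by simp) (by simp) (by simp) (by simp)
      simp only [nextSib, runs_set, AExp.Ok, AExp.ev, e1, true_and, a5]
      refine ⟨by omega, (ih S' _ tr' _ (I1.setVar (by omega)) ?_ hn.2 ?_).mono ?_⟩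
      · simpa using hl
      · intro d hd
        obtain ⟨q1, q2, q3, q4⟩ := hR d (by simp [hd])
        exact ⟨q1, q2, q3, by rintro (h | rfl); exacts [q4 h, hn.1 hd]⟩
      · rintro h3 t3 ⟨S'', tr'', I3, ht3⟩
        refine ⟨S'', tr'', ?_, ?_⟩
        · have : (fun d => D d ∨ d ∈ c :: R) = fun d => (D d ∨ d = c) ∨ d ∈ R := by
            funext d; rw [List.mem_cons, or_assoc]
          rwa [this]
        · simp only [List.length_cons]; omega
    refine runs_while_of_ne trivial (by simp only [AExp.ev]; omega) ?_
    rw [runs_seq]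
    by_cases hm : h₀.arr aMic c = h₀.arr aMic x
    · refine runs_ite_of_ne ?_ ?_ ?_
      · simp only [AExp.Ok, AExp.ev, e25, I.var_m, BinOp.fits_eq, and_true, true_and]; omega
      · simp [e25, I.var_m, a1, hm]
      by_cases hcov : Cov h₀ c
      · refine runs_ite_of_ne ?_ ?_ ?_
        · simp only [AExp.Ok, AExp.ev, e25, I.var_m, BinOp.fits_and, and_true, true_and]; omega
        · simpa [e25, I.var_m, a2, a8, ← hm, Cov] using hcov
        rw [runs_skip]
        exact (cont S tr h 3 (I.treat (fun _ => hcov) (hnotfull (.inl hm))) e25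
          (by omega)).mono fun _ _ r => r
      · refine runs_ite_of_eq ?_ ?_ ?_
        · simp only [AExp.Ok, AExp.ev, e25, I.var_m, BinOp.fits_and, and_true, true_and]; omega
        · simpa [e25, I.var_m, a2, a8, ← hm, Cov] using hcov
        -- Nodes get on the stack only as treated children, and `c` is not treated yet; the starting
        -- node `x` is excluded by `x ≤ y < c`.
        have hcx : c ∉ V ++ S := by
          intro hz
          rcases I.origin c hz with rfl | h1
          · omega
          · exact hDc h1
        have hmc : h₀.arr aMic c ≠ c := by
          have := H.mic_le y hyN
          rw [hyb.1] at this
          omega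
        simp only [runs_seq, runs_st, runs_set, AExp.Ok, AExp.ev, e25, true_and, and_true,
          AState.setArr_var]
        refine ⟨by omega, (cont (c :: S) tr ((h.setArr aStk c (h.var 23)).setVar 23 c) 4
          ⟨?_, ?_, I.inp, ?_, ?_, ?_, ?_, ?_,
          ?_, ?_, ?_, ?_⟩ ?_ (by omega)).mono ?_⟩
        · intro k k1 k2 k3 k4 k5
          rw [AState.setVar_arr, AState.setArr_arr, if_neg k1]; exact I.arr k k1 k2 k3 k4 k5
        · intro i hi
          rw [AState.setVar_var, if_neg (by omega)]; exact I.var i hi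
        · simpa using I.var_x
        · simpa using I.var_m
        · simp only [AState.setVar_arr, AState.setArr_arr, AState.setVar_var, if_true]
          refine ⟨rfl, hc0, ?_⟩
          rw [Function.update_self]
          refine I.stack.congr fun z hz => Function.update_of_ne ?_ _ _
          rintro rfl
          exact hcx (by simp [hz])
        · rw [(List.perm_middle).nodup_iff, List.nodup_cons]
          exact ⟨hcx, I.nodup⟩
        · intro z hz
          rw [(List.perm_middle).mem_iff, List.mem_cons] at hz
          rcases hz with rfl | hz
          · exact ⟨hcN, H.below_step hcN hmc (hpar ▸ hyb), hcov, by omega⟩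
          · exact I.below z hz
        · intro d hd h1 h2 h3
          rw [(List.perm_middle).mem_iff, List.mem_cons]
          rcases h1 with h1 | h1
          · exact .inr (I.closed d hd h1 h2 h3)
          · exact .inl h1
        · intro z hz
          rw [(List.perm_middle).mem_iff, List.mem_cons] at hz
          rcases hz with rfl | hz
          · exact .inr (.inr rfl)
          · exact (I.origin z hz).imp_right .inl
        · rw [(List.perm_middle).mem_iff, List.mem_cons]
          exact .inr I.mem
        · have : Components (FullM h₀ N) (fun M => Cov h₀ (h₀.arr aPar M) ∨ (D M ∨ M = c))
              (fun M => h₀.arr aMic (h₀.arr aPar M)) (h.arr aLab) (h.arr aTop) (h.arr aNx)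
              (h.arr aPv) tr := by
            refine I.comps.congr (fun _ => Iff.rfl) (fun M hM => ?_) (fun _ _ => rfl)
            simp [hnotfull (.inl hm) M hM]
          simpa using this
        · simpa using e25
        · intro h2 t2 r; exact r
    -- A child outside the microtree of its parent is the root of its own microtree.
    · have hmc : h₀.arr aMic c = c := by
        by_contra hne
        exact hm (by rw [← H.mic_eq_par hcN hne, hpar, hyb.1])
      refine runs_ite_of_eq ?_ ?_ ?_
      · simp only [AExp.Ok, AExp.ev, e25, I.var_m, BinOp.fits_eq, and_true, true_and]; omega
      · simp [e25, I.var_m, a1, hm]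
      by_cases hnb : h₀.arr aNb c = 0
      · refine runs_ite_of_eq ?_ ?_ ?_
        · simp only [AExp.Ok, AExp.ev, e25, true_and]; omega
        · simpa [e25, a9] using hnb
        simp only [runs_seq, runs_set, AExp.Ok, AExp.ev, e25, true_and]
        refine (Components.runs_cutProg (w := w) (N := N) (x := c) (h := h.setVar 30 c)
          I.comps (fun M hM => hM.1) (by omega) ⟨hcN, hmc, hnb⟩ ?_ (by simp)).mono ?_
        · rintro (h1 | h1)
          · exact hyc (hpar ▸ h1)
          · exact hDc h1
        rintro h1 t1 ⟨⟨tr1, C1, ht1⟩, b1, b2, b3⟩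
        refine (cont S tr1 h1 (1 + t1 + 1 + 1) ⟨?_, ?_, ?_, ?_, ?_, ?_, I.nodup, I.below,
          ?_, ?_, I.mem, ?_⟩ ?_ (by omega)).mono ?_
        · intro k k1 k2 k3 k4 k5
          rw [b1 k k2 k3 k4 k5]; exact I.arr k k1 k2 k3 k4 k5
        · intro i hi
          rw [b2 i (by omega), AState.setVar_var, if_neg (by omega)]; exact I.var i hi
        · rw [b3]; exact I.inp
        · rw [b2 _ (by simp)]; simpa using I.var_x
        · rw [b2 _ (by simp)]; simpa using I.var_m
        · rw [b2 _ (by simp), b1 _ (by simp) (by simp) (by simp) (by simp)]; simpa using I.stack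
        · rintro d hd (h1 | rfl) h2 h3
          · exact I.closed d hd h1 h2 h3
          · exact absurd h2 hm
        · intro z hz
          exact (I.origin z hz).imp_right .inl
        · have : (fun M => Cov h₀ (h₀.arr aPar M) ∨ (D M ∨ M = c)) =
              fun M => (Cov h₀ (h₀.arr aPar M) ∨ D M) ∨ M = c := by
            funext M; rw [or_assoc]
          rw [this]; exact C1
        · rw [b2 _ (by simp)]; simpa using e25
        · intro h2 t2 r; exact r
      · refine runs_ite_of_ne ?_ ?_ ?_
        · simp only [AExp.Ok, AExp.ev, e25, true_and]; omega
        · simpa [e25, a9] using hnb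
        rw [runs_skip]
        exact (cont S tr h 3 (I.treat (fun h => absurd h hm) (hnotfull (.inr hnb))) e25
          (by omega)).mono fun _ _ r => r

/-- The number of nodes in the list and of their children. -/
def coverCost (N : ℕ) (par : ℕ → ℕ) (V : List ℕ) : ℕ :=
  (V.map fun z => 1 + (kids N par z).length).sum

/-- The recursion is on the number `f` of nodes that may still be finished, as `V` has no
repetitions. The cost of a finished node and its children is recorded in `coverCost`. -/
theorem Cover.runs_coverLoop {w N x : ℕ} {h₀ : AState}
    (H : Micro (w - 6) N (h₀.var 2) h₀) (hk : KidLists N (h₀.arr aPar) (h₀.arr aHead) (h₀.arr aSib))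
    (hN : 8 * (N + 1) ≤ lim w) (hx : x < N) :
    ∀ (f : ℕ) (V S : List ℕ) (tr : ℕ → Grove) (h : AState), N ≤ V.length + f →
    Cover h₀ N x V S (fun c => 0 < c ∧ c < N ∧ h₀.arr aPar c ∈ V) tr h →
    Runs w coverLoop h fun h' t => ∃ V' tr',
      Cover h₀ N x V' [] (fun c => 0 < c ∧ c < N ∧ h₀.arr aPar c ∈ V') tr' h' ∧
      t + 12 * groveSum N tr' + 30 * coverCost N (h₀.arr aPar) V ≤
        12 * groveSum N tr + 30 * coverCost N (h₀.arr aPar) V' + 1 := by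
  intro f
  induction f with
  | zero =>
    intro V S tr h hf I
    cases S with
    | nil => exact runs_while_of_eq trivial I.stack ⟨V, tr, I, by omega⟩
    | cons z S =>
      exfalso
      have := (I.nodup.subperm (l₂ := List.range N)
        fun a ha => List.mem_range.2 (I.below a ha).1).length_le
      simp only [List.length_append, List.length_cons, List.length_range] at this
      omega
  | succ f ih =>
    intro V S tr h hf I
    cases S with
    | nil => exact runs_while_of_eq trivial I.stack ⟨V, tr, I, by omega⟩
    | cons z S =>
      obtain ⟨e23, hz0, hl⟩ := I.stack
      have hzN := (I.below z (by simp)).1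
      have hp : (V ++ z :: S).Perm (z :: V ++ S) := List.perm_middle
      have hn : (z :: V ++ S).Nodup := hp.nodup_iff.1 I.nodup
      have hzV : z ∉ V := fun h => (List.nodup_cons.1 hn).1 (by simp [h])
      have a4 : h.arr aHead = h₀.arr aHead :=
        I.arr _ (by simp) (by simp) (by simp) (by simp) (by simp)
      refine runs_while_of_ne trivial (by simp only [AExp.ev]; omega) ?_
      simp only [runs_seq, runs_set, AExp.Ok, AExp.ev, e23, true_and, AState.setVar_var,
        AState.setVar_arr, if_true, Nat.reduceEqDiff, if_false]
      refine ⟨by omega, by omega, ?_⟩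
      have I1 : Cover h₀ N x (z :: V) S (fun c => 0 < c ∧ c < N ∧ h₀.arr aPar c ∈ V) tr
          (((h.setVar 24 z).setVar 23 (h.arr aStk z)).setVar 25 (h.arr aHead z)) := by
        refine Cover.setVar (h := (h.setVar 24 z).setVar 23 (h.arr aStk z)) ⟨I.arr, ?_, I.inp, ?_, ?_, ?_, hn, ?_, ?_, ?_, ?_, I.comps⟩
          (by omega)
        · intro i hi
          simp only [AState.setVar_var]
          iterate 2 rw [if_neg (by omega)]
          exact I.var i hi
        · simpa using I.var_x
        · simpa using I.var_m
        · simpa using hl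
        · exact fun a ha => I.below a (hp.mem_iff.2 ha)
        · exact fun c h1 h2 h3 h4 => hp.mem_iff.1 (I.closed c h1 h2 h3 h4)
        · exact fun a ha => I.origin a (hp.mem_iff.2 ha)
        · exact hp.mem_iff.1 I.mem
      refine (Cover.runs_kidLoop (y := z) H hN hx (by simp) (kids N (h₀.arr aPar) z) _ _ _ _ I1 ?_ nodup_kids ?_).mono ?_
      · simpa [a4] using hk z hzN
      · intro c hc
        obtain ⟨b1, b2, b3⟩ := mem_kids.1 hc
        exact ⟨b1, b2, b3, fun h => hzV (b3 ▸ h.2.2)⟩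
      rintro h2 t2 ⟨S', tr2, I2, ht2⟩
      have e : (fun c => (0 < c ∧ c < N ∧ h₀.arr aPar c ∈ V) ∨ c ∈ kids N (h₀.arr aPar) z) =
          fun c => 0 < c ∧ c < N ∧ h₀.arr aPar c ∈ z :: V := by
        funext c
        rw [mem_kids, List.mem_cons, eq_iff_iff]
        tauto
      rw [e] at I2
      refine (ih (z :: V) S' tr2 h2 (by simp only [List.length_cons]; omega) I2).mono ?_
      rintro h3 t3 ⟨V', tr3, I3, ht3⟩
      refine ⟨V', tr3, I3, ?_⟩
      have : coverCost N (h₀.arr aPar) (z :: V) =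
        1 + (kids N (h₀.arr aPar) z).length + coverCost N (h₀.arr aPar) V := by
        simp [coverCost]
      omega

theorem Micro.below_induct {B N top x : ℕ} {h : AState} {P : ℕ → Prop} (H : Micro B N top h)
    (hx : x < N) (h0 : P x)
    (h1 : ∀ j < N, h.arr aMic j ≠ j → Below h x (h.arr aPar j) → P (h.arr aPar j) → P j) :
    ∀ j < N, Below h x j → P j := by
  intro j
  induction j using Nat.strong_induction_on with
  | _ j ih =>
    intro hj hb
    rcases H.eq_or_of_below hx hj hb with rfl | ⟨hm, hb'⟩
    · exact h0
    · have := (H.mic_or j hj).resolve_left hm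
      exact h1 j hj hm hb' (ih _ (H.par_lt j hj this.1) (H.par_lt' hj) hb')

/-- The potential released by the newly covered nodes `V` is exactly the amount charged for
exploring them. -/
theorem covSum_add_coverCost {N : ℕ} {h h' : AState} {V : List ℕ} (hV : V.Nodup)
    (hp : h'.arr aPar = h.arr aPar) (hVN : ∀ z ∈ V, z < N ∧ ¬ Cov h z)
    (hc : ∀ z < N, Cov h' z ↔ Cov h z ∨ z ∈ V) :
    covSum N h' + coverCost N (h.arr aPar) V = covSum N h := by
  classical
  have h1 : coverCost N (h.arr aPar) V = ∑ z ∈ Finset.range N,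
      if z ∈ V then 1 + (kids N (h.arr aPar) z).length else 0 := by
    rw [coverCost, ← List.sum_toFinset _ hV, ← Finset.sum_filter]
    refine Finset.sum_congr ?_ fun _ _ => rfl
    ext z
    simp only [List.mem_toFinset, Finset.mem_filter, Finset.mem_range]
    exact ⟨fun h => ⟨(hVN z h).1, h⟩, fun h => h.2⟩
  rw [h1, covSum, covSum, ← Finset.sum_add_distrib]
  refine Finset.sum_congr rfl fun z hz => ?_
  have := hc z (Finset.mem_range.1 hz)
  rw [hp]
  by_cases h2 : z ∈ V
  · rw [if_pos (this.2 (.inr h2)), if_pos h2, if_neg (hVN z h2).2, zero_add]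
  · by_cases h3 : Cov h z
    · rw [if_pos (this.2 (.inl h3)), if_neg h2, if_pos h3]
    · rw [if_neg (by tauto), if_neg h2, if_neg h3]; rfl

/-- Marking a node costs no more than it lowers the potential, up to a constant. -/
theorem Forest.runs_markProg {w N x : ℕ} {tr : ℕ → Grove} {h : AState} (F : Forest w N tr h)
    (hN : 8 * (N + 1) ≤ lim w) (hx : x < N) (e : h.var 20 = x) :
    Runs w markProg h fun h' t => (∃ tr', Forest w N tr' h' ∧
        t + potential N tr' h' ≤ potential N tr h + 10) ∧
      (∀ j < N, Mkd h' j ↔ Mkd h j ∨ j = x) ∧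
      (∀ k, k ≠ aStk → k ≠ aMk → k ≠ aLab → k ≠ aTop → k ≠ aNx → k ≠ aPv →
        h'.arr k = h.arr k) ∧
      (∀ i, i < 20 ∨ 40 ≤ i → h'.var i = h.var i) ∧ h'.inp = h.inp := by
  have H := F.micro
  have hlw := lim_lt w
  have hmN := H.mic_lt hx
  -- the state before the mark is set
  have fin : ∀ (h1 : AState) (V : List ℕ) (tr1 : ℕ → Grove) (t1 : ℕ), V.Nodup →
      (∀ z, z ∈ V ↔ z < N ∧ Below h x z ∧ ¬ Cov h z) →
      Components (FullM h N) (fun M => Cov h (h.arr aPar M) ∨ h.arr aPar M ∈ V)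
        (fun M => h.arr aMic (h.arr aPar M)) (h1.arr aLab) (h1.arr aTop) (h1.arr aNx)
        (h1.arr aPv) tr1 →
      (∀ k, k ≠ aStk → k ≠ aLab → k ≠ aTop → k ≠ aNx → k ≠ aPv → h1.arr k = h.arr k) →
      (∀ i, i < 20 ∨ 40 ≤ i → h1.var i = h.var i) → h1.inp = h.inp → h1.var 20 = x →
      h1.var 21 = h.arr aMic x →
      t1 + 12 * groveSum N tr1 ≤ 12 * groveSum N tr + 30 * coverCost N (h.arr aPar) V + 9 →
      Runs w setMark h1 fun h' t =>
        (∃ tr', Forest w N tr' h' ∧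
          t1 + t + potential N tr' h' ≤ potential N tr h + 10) ∧
        (∀ j < N, Mkd h' j ↔ Mkd h j ∨ j = x) ∧
        (∀ k, k ≠ aStk → k ≠ aMk → k ≠ aLab → k ≠ aTop → k ≠ aNx → k ≠ aPv →
          h'.arr k = h.arr k) ∧
        (∀ i, i < 20 ∨ 40 ≤ i → h'.var i = h.var i) ∧ h'.inp = h.inp := by
    intro h1 V tr1 t1 hVn hV C1 ea ev ei e20 e21 ht
    have a8 : h1.arr aMk = h.arr aMk := ea _ (by simp) (by simp) (by simp) (by simp) (by simp)
    have a3 : h1.arr aBit = h.arr aBit := ea _ (by simp) (by simp) (by simp) (by simp) (by simp)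
    simp only [setMark, runs_st, AExp.Ok, AExp.ev, e20, e21, BinOp.fits_or, BinOp.val_or, true_and,
      and_true, a8, a3]
    refine ⟨⟨by omega, by omega⟩, by omega, ?_⟩
    set v := h.arr aMk (h.arr aMic x) ||| h.arr aBit x with hv
    have ek : ∀ k, k ≠ aStk → k ≠ aMk → k ≠ aLab → k ≠ aTop → k ≠ aNx → k ≠ aPv →
        (h1.setArr aMk (h.arr aMic x) v).arr k = h.arr k := by
      intro k k1 k2 k3 k4 k5 k6
      rw [AState.setArr_arr, if_neg k2]; exact ea k k1 k3 k4 k5 k6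
    have ek' : ∀ k ∈ [aPar, aMic, aAnc, aBit, aNb, aSz, aBase, aSlot, aIdx, aCap],
        (h1.setArr aMk (h.arr aMic x) v).arr k = h.arr k := fun k hk =>
      ek k (by rintro rfl; simp at hk) (by rintro rfl; simp at hk) (by rintro rfl; simp at hk)
        (by rintro rfl; simp at hk) (by rintro rfl; simp at hk) (by rintro rfl; simp at hk)
    have em : (h1.setArr aMk (h.arr aMic x) v).arr aMk =
        Function.update (h.arr aMk) (h.arr aMic x) v := by
      rw [AState.setArr_arr, if_pos rfl, a8]
    have hcov : ∀ z < N, Cov (h1.setArr aMk (h.arr aMic x) v) z ↔ Cov h z ∨ z ∈ V := by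
      intro z hz
      rw [Micro.mark_cov (ek' _ (by simp)) (ek' _ (by simp)) em, hV]
      tauto
    have hsum := covSum_add_coverCost hVn (ek' aPar (by simp)) (fun z hz => ⟨((hV z).1 hz).1,
      ((hV z).1 hz).2.2⟩) hcov
    refine ⟨⟨tr1, ⟨?_, ?_, ?_, ?_, ?_⟩, ?_⟩, fun j hj => H.mark_mkd hx ek' em hj, ek, ev, ei⟩
    · have := H.mark hx ek' em
      simpa [ev] using this
    · simpa [ev] using F.size
    · simpa [ev] using F.topBit
    · rw [ek aPar (by simp) (by simp) (by simp) (by simp) (by simp) (by simp),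
        ek aHead (by simp) (by simp) (by simp) (by simp) (by simp) (by simp),
        ek aSib (by simp) (by simp) (by simp) (by simp) (by simp) (by simp)]
      exact F.kidLists
    · rw [ek' aPar (by simp), ek' aMic (by simp)]
      refine Components.congr (by simpa using C1) (fun M => ?_) (fun M hM => ?_) (fun _ _ => rfl)
      · unfold FullM; rw [ek' aNb (by simp), ek' aMic (by simp)]
      · exact hcov _ (H.par_lt' hM.1)
    · unfold potential
      rw [ek' aNb (by simp), ek' aSz (by simp), ek' aCap (by simp)]
      omega
  rw [markProg, runs_seq, runs_set]
  simp only [AExp.Ok, AExp.ev, e, true_and]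
  refine ⟨by omega, ?_⟩
  rw [runs_seq]
  by_cases hc : Cov h x
  · refine runs_ite_of_ne ?_ ?_ ?_
    · simp only [AExp.Ok, AExp.ev, e, BinOp.fits_and, and_true, true_and, AState.setVar_var,
        if_true, if_false, Nat.reduceEqDiff]
      omega
    · simpa [AExp.ev, e, Cov] using hc
    rw [runs_skip]
    -- If `x` is covered, so are all nodes below it in the microtree, and no exploration is needed.
    refine (fin (h.setVar 21 (h.arr aMic x)) [] tr 3 List.nodup_nil ?_ ?_ (fun _ _ _ _ _ _ => rfl) ?_ rfl
      (by simpa using e) (by simp) (by omega)).mono ?_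
    · intro z
      simp only [List.not_mem_nil, false_iff, not_and, not_not]
      exact H.below_induct hx hc (fun j hj hm _ hp => (H.cov_step hj hm).2 (.inr hp)) z
    · simpa using F.comps
    · intro i hi
      rw [AState.setVar_var, if_neg (by omega)]
    · rintro h' t ⟨⟨tr', b1, b2⟩, b3⟩
      exact ⟨⟨tr', b1, by omega⟩, b3⟩
  · have hx0 : x ≠ 0 := by
      rintro rfl
      exact hc (H.cov_of_mkd hx H.mkd_zero)
    refine runs_ite_of_eq ?_ ?_ ?_
    · simp only [AExp.Ok, AExp.ev, e, BinOp.fits_and, and_true, true_and, AState.setVar_var,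
        if_true, if_false, Nat.reduceEqDiff]
      omega
    · simpa [AExp.ev, e, Cov] using hc
    simp only [runs_seq, runs_st, runs_set, AExp.Ok, AExp.ev, AState.setVar_var, e, if_false,
      true_and, Nat.reduceEqDiff, AState.setArr_var]
    refine ⟨by omega, (Cover.runs_coverLoop (h₀ := h) (w := w) H F.kidLists hN hx N [] [x] tr
      (((h.setVar 21 (h.arr aMic x)).setArr aStk x 0).setVar 23 x) (by simp)
      ⟨?_, ?_, rfl, ?_, ?_, ?_, ?_, ?_, ?_, ?_, ?_, ?_⟩).mono ?_⟩
    · intro k k1 k2 k3 k4 k5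
      rw [AState.setVar_arr, AState.setArr_arr, if_neg k1]; rfl
    · intro i hi
      rw [AState.setVar_var, if_neg (by omega), AState.setArr_var, AState.setVar_var,
        if_neg (by omega)]
    · simpa using e
    · simp
    · simp [LinkedFrom, hx0]
    · simp
    · simp only [List.nil_append, List.mem_singleton, forall_eq]
      exact ⟨hx, H.below_self hx, hc, le_rfl⟩
    · simp
    · simp
    · simp
    · simpa using F.comps
    · rintro h1 t1 ⟨V, tr1, I, ht⟩
      refine (fin h1 V tr1 (1 + (1 + (1 + (1 + t1)))) (by simpa using I.nodup) ?_ ?_ I.arr I.var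
        I.inp I.var_x I.var_m ?_).mono ?_
      · intro z
        constructor
        · intro hz
          have := I.below z (by simpa using hz)
          exact ⟨this.1, this.2.1, this.2.2.1⟩
        · rintro ⟨hz, hb, hzc⟩
          -- The visited set contains `x` and, with a node, its uncovered children in the microtree.
          -- Since the parent of an uncovered non-root is uncovered, all uncovered nodes below `x`
          -- are reached.
          refine H.below_induct (P := fun z => ¬ Cov h z → z ∈ V) hx
            (fun _ => by simpa using I.mem) ?_ z hz hb hzc
          intro j hj hm hb' ih hjc
          rw [H.cov_step hj hm, not_or] at hjc
          have hj0 := ((H.mic_or j hj).resolve_left hm).1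
          have := I.closed j hj ⟨hj0, hj, ih hjc.2⟩
            (by rw [← hb'.1, H.mic_eq_par hj hm]) (by rw [H.cov_step hj hm, not_or]; exact hjc)
          simpa using this
      · refine I.comps.congr (fun _ => Iff.rfl) (fun M hM => ?_) (fun _ _ => rfl)
        -- The root `0` is its own parent and not a listed child; its edge counts as cut anyway
        -- because `0` is covered.
        rcases Nat.eq_zero_or_pos M with rfl | h0
        · rw [H.par_zero]
          have := H.cov_of_mkd hM.1 H.mkd_zero
          tauto
        · have := hM.1
          tauto
      · simp only [coverCost, List.map_nil, List.sum_nil] at ht ⊢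
        omega
      · rintro h' t ⟨⟨tr', b1, b2⟩, b3⟩
        exact ⟨⟨tr', b1, by omega⟩, b3⟩

/-! ### Doubling the space of a microtree -/

/-- Copies the remaining entries of the array of the microtree `12` to the free place. -/
def copyLoop : AProg :=
  .while (.op .lt (.v 16) (.v 14))
    (.st aSlot (.op .add (.v 2) (.v 16)) (.ld aSlot (.op .add (.ld aBase (.v 12)) (.v 16)));;
      .set 16 (.op .add (.v 16) (.c 1)))

/-- Doubles the space of the microtree `12`. -/
def growProg : AProg :=
  .set 16 (.c 0);;
  copyLoop;;
  .st aBase (.v 12) (.v 2);;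
  .st aCap (.v 12) (.op .add (.v 14) (.v 14));;
  .set 2 (.op .add (.v 2) (.op .add (.v 14) (.v 14)))

theorem runs_copyLoop {w m s b : ℕ} {h₀ : AState} (hs : h₀.var 14 = s) (hm : h₀.var 12 = m)
    (hb : h₀.arr aBase m = b) (hml : m < lim w) (hbs : b + s ≤ h₀.var 2)
    (hl : h₀.var 2 + s < lim w) :
    ∀ (f i : ℕ) (h : AState), i + f = s → h.var 16 = i →
    (∀ k, k ≠ aSlot → h.arr k = h₀.arr k) → (∀ j, j ≠ 16 → h.var j = h₀.var j) →
    h.inp = h₀.inp → (∀ j < h₀.var 2, h.arr aSlot j = h₀.arr aSlot j) →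
    (∀ j < i, h.arr aSlot (h₀.var 2 + j) = h₀.arr aSlot (b + j)) →
    Runs w copyLoop h fun h' t => t ≤ 3 * f + 1 ∧ (∀ k, k ≠ aSlot → h'.arr k = h₀.arr k) ∧
      (∀ j, j ≠ 16 → h'.var j = h₀.var j) ∧ h'.inp = h₀.inp ∧
      (∀ j < h₀.var 2, h'.arr aSlot j = h₀.arr aSlot j) ∧
      ∀ j < s, h'.arr aSlot (h₀.var 2 + j) = h₀.arr aSlot (b + j) := by
  have hlw := lim_lt w
  intro f
  induction f with
  | zero =>
    intro i h hi e16 ha hv hp h1 h2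
    obtain rfl : i = s := by omega
    refine runs_while_of_eq ?_ ?_ ⟨by omega, ha, hv, hp, h1, h2⟩
    · simp
    · simp [e16, hv, hs]
  | succ f ih =>
    intro i h hi e16 ha hv hp h1 h2
    have e12 : h.var 12 = m := by rw [hv _ (by simp), hm]
    have e14 : h.var 14 = s := by rw [hv _ (by simp), hs]
    have e2 : h.var 2 = h₀.var 2 := hv _ (by simp)
    have eb : h.arr aBase m = b := by rw [ha _ (by simp), hb]
    refine runs_while_of_ne ?_ ?_ ?_
    · simp
    · simp [e16, e14]; omega
    simp only [runs_seq, runs_st, runs_set, AExp.Ok, AExp.ev, e16, e12, e2, eb, true_and, and_true,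
      BinOp.fits_add, BinOp.val_add, AState.setArr_var]
    refine ⟨by omega, by omega, by omega, by omega, ?_⟩
    refine (ih (i + 1) _ (by omega) ?_ ?_ ?_ ?_ ?_ ?_).mono ?_
    · simp
    · intro k hk
      rw [AState.setVar_arr, AState.setArr_arr, if_neg hk, ha k hk]
    · intro j hj
      rw [AState.setVar_var, if_neg hj, AState.setArr_var, hv j hj]
    · exact hp
    · intro j hj
      rw [AState.setVar_arr, AState.setArr_arr, if_pos rfl, Function.update_of_ne (by omega),
        h1 j hj]
    · intro j hj
      rw [AState.setVar_arr, AState.setArr_arr, if_pos rfl, Function.update_apply]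
      split_ifs with e
      · obtain rfl : j = i := by omega
        exact h1 _ (by omega)
      · exact h2 j (by omega)
    · rintro h' t ⟨ht, r⟩
      exact ⟨by omega, r⟩

/-- Copying takes three steps per entry, and the last term of the potential releases three units per
entry. -/
theorem Forest.runs_growProg {w N m : ℕ} {tr : ℕ → Grove} {h : AState} (F : Forest w N tr h)
    (hN : 8 * (N + 1) ≤ lim w) (hm : m < N) (hmm : h.arr aMic m = m) (e12 : h.var 12 = m)
    (e14 : h.var 14 = h.arr aSz m) (hc : h.arr aSz m = h.arr aCap m) :
    Runs w growProg h fun h' t => Forest w N tr h' ∧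
      t + potential N tr h' ≤ potential N tr h + 5 ∧ h'.arr aCap m = 2 * h.arr aSz m ∧
      (∀ k, k ≠ aSlot → k ≠ aBase → k ≠ aCap → h'.arr k = h.arr k) ∧
      (∀ i, i ≠ 16 → i ≠ 2 → h'.var i = h.var i) ∧ h'.inp = h.inp := by
  have H := F.micro
  have hlw := lim_lt w
  have hsp := H.space
  have hseg := H.seg m hm hmm
  -- The share of `m` in `space` reserves the room for the new segment, so the writes stay within
  -- the array.
  have hle := Finset.single_le_sum (f := fun j => 2 * h.arr aSz j - h.arr aCap j)
    (fun _ _ => Nat.zero_le _) (Finset.mem_range.2 hm)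
  rw [growProg, runs_seq, runs_set]
  refine ⟨trivial, ?_⟩
  rw [runs_seq]
  refine (runs_copyLoop (w := w) (h₀ := h) e14 e12 rfl (by omega) (by omega) (by omega)
    (h.arr aSz m) 0 (h.setVar 16 0) (by omega) (by simp) (fun _ _ => rfl) ?_ rfl (fun _ _ => rfl)
    (by simp)).mono ?_
  · intro j hj
    rw [AState.setVar_var, if_neg hj]
  rintro h1 t1 ⟨ht, ea, ev, ei, s1, s2⟩
  have v12 : h1.var 12 = m := by rw [ev _ (by simp), e12]
  have v14 : h1.var 14 = h.arr aSz m := by rw [ev _ (by simp), e14]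
  have v2 : h1.var 2 = h.var 2 := by rw [ev _ (by simp)]
  simp only [runs_seq, runs_st, runs_set, AExp.Ok, AExp.ev, v12, v2, v14, true_and, and_true,
    BinOp.fits_add, BinOp.val_add, AState.setArr_var]
  refine ⟨by omega, by omega, by omega, ⟨by omega, by omega⟩, ?_⟩
  generalize hh : ((h1.setArr aBase m (h.var 2)).setArr aCap m (h.arr aSz m + h.arr aSz m)).setVar 2
    (h.var 2 + (h.arr aSz m + h.arr aSz m)) = h2
  have fa : ∀ k, k ≠ aSlot → k ≠ aBase → k ≠ aCap → h2.arr k = h.arr k := by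
    intro k k1 k2 k3
    rw [← hh, AState.setVar_arr, AState.setArr_arr, if_neg k3, AState.setArr_arr, if_neg k2,
      ea k k1]
  have fc : h2.arr aCap = Function.update (h.arr aCap) m (2 * h.arr aSz m) := by
    rw [← hh, two_mul, ← ea aCap (by simp)]; simp
  obtain ⟨D1, D2⟩ := H.double (h' := h2) hm hmm hc (by simp [fa]) (by simpa [← hh] using s1)
    (by simpa [← hh] using s2) (by rw [← hh, ← ea aBase (by simp)]; simp) fc
  have fv : ∀ i, i ≠ 16 → i ≠ 2 → h2.var i = h.var i := by
    intro i i1 i2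
    rw [← hh, AState.setVar_var, if_neg i2]; exact ev i i1
  have f2 : h2.var 2 = h.var 2 + 2 * h.arr aSz m := by
    rw [← hh, AState.setVar_var, if_pos rfl, two_mul]
  have fP := fa aPar (by simp) (by simp) (by simp)
  have fM := fa aMic (by simp) (by simp) (by simp)
  have fA := fa aAnc (by simp) (by simp) (by simp)
  have fK := fa aMk (by simp) (by simp) (by simp)
  have fN := fa aNb (by simp) (by simp) (by simp)
  have fS := fa aSz (by simp) (by simp) (by simp)
  have hC : ∀ z, Cov h2 z ↔ Cov h z := fun z => by simp only [Cov, fM, fA, fK]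
  refine ⟨⟨?_, ?_, ?_, ?_, ?_⟩, ?_, ?_, fa, fv, ?_⟩
  · rwa [f2]
  · rw [fv 1 (by simp) (by simp), F.size]
  · rw [fv 4 (by simp) (by simp), F.topBit]
  · rw [fP, fa aHead (by simp) (by simp) (by simp), fa aSib (by simp) (by simp) (by simp)]
    exact F.kidLists
  · rw [fP, fM, fa aLab (by simp) (by simp) (by simp), fa aTop (by simp) (by simp) (by simp),
      fa aNx (by simp) (by simp) (by simp), fa aPv (by simp) (by simp) (by simp)]
    refine F.comps.congr (fun M => ?_) (fun M _ => hC _) (fun _ _ => rfl)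
    simp only [FullM, fM, fN]
  · have : covSum N h2 = covSum N h := by
      unfold covSum
      refine Finset.sum_congr rfl fun z _ => ?_
      rw [fP]
      by_cases hz : Cov h z
      · rw [if_pos hz, if_pos ((hC z).2 hz)]
      · rw [if_neg hz, if_neg (mt (hC z).1 hz)]
    unfold potential
    rw [this, fN, fS]
    rw [fS] at D2
    omega
  · rw [fc]; simp
  · rw [← hh]; exact ei

/-! ### Adding a node to the forest -/

/-- Adds a node below the node `10`. -/
def linkProg : AProg :=
  .set 11 (.v 1);;
  .set 1 (.op .add (.v 1) (.c 1));;
  .st aPar (.v 11) (.v 10);;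
  .st aSib (.v 11) (.ld aHead (.v 10));;
  .st aHead (.v 10) (.v 11);;
  .st aHead (.v 11) (.c 0)

/-- The new node `11` joins the microtree `12` of its parent. -/
def joinProg : AProg :=
  .st aMic (.v 11) (.v 12);;
  .st aBit (.v 11) (.v 13);;
  .st aAnc (.v 11) (.op .or (.ld aAnc (.v 10)) (.v 13));;
  .st aIdx (.v 13) (.v 14);;
  .st aSlot (.op .add (.ld aBase (.v 12)) (.v 14)) (.v 11);;
  .st aNb (.v 12) (.op .shr (.v 13) (.c 1));;
  .st aSz (.v 12) (.op .add (.v 14) (.c 1));;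
  .st aSz (.v 11) (.c 0);;
  .st aCap (.v 11) (.c 0)

/-- The new node `11` starts a microtree. -/
def freshProg : AProg :=
  .st aMic (.v 11) (.v 11);;
  .st aBit (.v 11) (.v 4);;
  .st aAnc (.v 11) (.v 4);;
  .st aMk (.v 11) (.c 0);;
  .st aNb (.v 11) (.op .shr (.v 4) (.c 1));;
  .st aSz (.v 11) (.c 1);;
  .st aCap (.v 11) (.c 1);;
  .st aBase (.v 11) (.v 2);;
  .st aSlot (.v 2) (.v 11);;
  .st aIdx (.v 4) (.c 0);;
  .set 2 (.op .add (.v 2) (.c 1))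

/-- Inserts the complete microtree `12` into the component of its parent or into a component of its
own. -/
def insertProg : AProg :=
  .set 15 (.ld aMic (.ld aPar (.v 12)));;
  .ite (.op .and (.ld aAnc (.ld aPar (.v 12))) (.ld aMk (.v 15)))
    (.st aLab (.v 12) (.v 12);;
      .st aTop (.v 12) (.v 12);;
      .st aNx (.op .add (.v 12) (.v 12)) (.op .add (.op .add (.v 12) (.v 12)) (.c 1));;
      .st aPv (.op .add (.op .add (.v 12) (.v 12)) (.c 1)) (.op .add (.v 12) (.v 12)))
    (.st aLab (.v 12) (.ld aLab (.v 15));;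
      .set 16 (.ld aNx (.op .add (.v 15) (.v 15)));;
      .st aNx (.op .add (.v 15) (.v 15)) (.op .add (.v 12) (.v 12));;
      .st aNx (.op .add (.v 12) (.v 12)) (.op .add (.op .add (.v 12) (.v 12)) (.c 1));;
      .st aNx (.op .add (.op .add (.v 12) (.v 12)) (.c 1)) (.v 16);;
      .st aPv (.op .add (.v 12) (.v 12)) (.op .add (.v 15) (.v 15));;
      .st aPv (.op .add (.op .add (.v 12) (.v 12)) (.c 1)) (.op .add (.v 12) (.v 12));;
      .st aPv (.v 16) (.op .add (.op .add (.v 12) (.v 12)) (.c 1)))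

/-- Adds a node below the node `10` and puts its number into the variable `11`. -/
def newLeafProg : AProg :=
  .set 12 (.ld aMic (.v 10));;
  .set 13 (.ld aNb (.v 12));;
  .set 14 (.ld aSz (.v 12));;
  .ite (.v 13)
    (.ite (.op .eq (.v 14) (.ld aCap (.v 12))) growProg (.set 14 (.v 14));;
      linkProg;;
      joinProg;;
      .ite (.ld aNb (.v 12)) (.set 14 (.v 14)) insertProg)
    (linkProg;; freshProg)

/-- The effect of `linkProg`. -/
structure LinkStep (N p : ℕ) (h h' : AState) : Prop where
  par : h'.arr aPar = Function.update (h.arr aPar) N p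
  sib : h'.arr aSib = Function.update (h.arr aSib) N (h.arr aHead p)
  head : h'.arr aHead = Function.update (Function.update (h.arr aHead) p N) N 0
  arr : ∀ k, k ≠ aPar → k ≠ aSib → k ≠ aHead → h'.arr k = h.arr k
  var_N : h'.var 11 = N
  size : h'.var 1 = N + 1
  var : ∀ i, i ≠ 1 → i ≠ 11 → h'.var i = h.var i
  inp : h'.inp = h.inp

theorem runs_linkProg {w N p : ℕ} {h : AState} (hN : N + 1 < lim w) (hp : p < N)
    (e1 : h.var 1 = N) (e10 : h.var 10 = p) :
    Runs w linkProg h fun h' t => t = 6 ∧ LinkStep N p h h' := by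
  have hlw := lim_lt w
  simp only [linkProg, runs_seq, runs_st, runs_set, AExp.Ok, AExp.ev, e1, e10, true_and, and_true,
    BinOp.fits_add, BinOp.val_add, AState.setArr_var, AState.setVar_var, AState.setVar_arr,
    AState.setArr_arr, if_true, if_false, Nat.reduceEqDiff]
  refine ⟨by omega, by omega, by omega, by omega, by omega, by omega, ?_⟩
  constructor <;> intros <;> first | rfl | simp [*]

/-- The effect of `joinProg`. -/
structure JoinStep (N p m b s : ℕ) (h h' : AState) : Prop where
  mic : h'.arr aMic = Function.update (h.arr aMic) N m
  bit : h'.arr aBit = Function.update (h.arr aBit) N b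
  anc : h'.arr aAnc = Function.update (h.arr aAnc) N (h.arr aAnc p ||| b)
  idx : h'.arr aIdx = Function.update (h.arr aIdx) b s
  slot : h'.arr aSlot = Function.update (h.arr aSlot) (h.arr aBase m + s) N
  nb : h'.arr aNb = Function.update (h.arr aNb) m (b >>> 1)
  sz : h'.arr aSz = Function.update (Function.update (h.arr aSz) m (s + 1)) N 0
  cap : h'.arr aCap = Function.update (h.arr aCap) N 0
  arr : ∀ k ∈ [aPar, aHead, aSib, aMk, aBase, aLab, aTop, aNx, aPv, aOwn, aStk, aCur, aHp],
    h'.arr k = h.arr k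
  var : h'.var = h.var
  inp : h'.inp = h.inp

theorem runs_joinProg {w N p m b s : ℕ} {h : AState} (hN : N < lim w) (hp : p < N) (hm : m < N)
    (hb : b < lim w) (hs : h.arr aBase m + s + 1 < lim w)
    (e10 : h.var 10 = p) (e11 : h.var 11 = N) (e12 : h.var 12 = m) (e13 : h.var 13 = b)
    (e14 : h.var 14 = s) :
    Runs w joinProg h fun h' t => t = 9 ∧ JoinStep N p m b s h h' := by
  have hlw := lim_lt w
  simp only [joinProg, runs_seq, runs_st, runs_set, AExp.Ok, AExp.ev, e10, e11, e12, e13, e14,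
    true_and, and_true, BinOp.fits_add, BinOp.val_add, BinOp.fits_or, BinOp.val_or, BinOp.fits_shr,
    BinOp.val_shr, AState.setArr_var, AState.setArr_arr, if_true, if_false, Nat.reduceEqDiff]
  refine ⟨by omega, by omega, by omega, by omega, by omega, ⟨by omega, by omega⟩, by omega,
    by omega, by omega, by omega, by omega, by omega, ?_⟩
  constructor
  case arr =>
    intro k hk
    simp only [List.mem_cons, List.not_mem_nil, or_false] at hk
    rcases hk with rfl | rfl | rfl | rfl | rfl | rfl | rfl | rfl | rfl | rfl | rfl | rfl | rfl <;>
      rfl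
  all_goals rfl

/-- The effect of `freshProg`. -/
structure FreshStep (N b : ℕ) (h h' : AState) : Prop where
  mic : h'.arr aMic = Function.update (h.arr aMic) N N
  bit : h'.arr aBit = Function.update (h.arr aBit) N b
  anc : h'.arr aAnc = Function.update (h.arr aAnc) N b
  marks : h'.arr aMk = Function.update (h.arr aMk) N 0
  nb : h'.arr aNb = Function.update (h.arr aNb) N (b >>> 1)
  sz : h'.arr aSz = Function.update (h.arr aSz) N 1
  cap : h'.arr aCap = Function.update (h.arr aCap) N 1
  base : h'.arr aBase = Function.update (h.arr aBase) N (h.var 2)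
  slot : h'.arr aSlot = Function.update (h.arr aSlot) (h.var 2) N
  idx : h'.arr aIdx = Function.update (h.arr aIdx) b 0
  arr : ∀ k ∈ [aPar, aHead, aSib, aLab, aTop, aNx, aPv, aOwn, aStk, aCur, aHp],
    h'.arr k = h.arr k
  top : h'.var 2 = h.var 2 + 1
  var : ∀ i, i ≠ 2 → h'.var i = h.var i
  inp : h'.inp = h.inp

theorem runs_freshProg {w N b : ℕ} {h : AState} (hN : N < lim w)
    (hb : b < lim w) (hs : h.var 2 + 1 < lim w) (e11 : h.var 11 = N) (e4 : h.var 4 = b) :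
    Runs w freshProg h fun h' t => t = 11 ∧ FreshStep N b h h' := by
  have hlw := lim_lt w
  simp only [freshProg, runs_seq, runs_st, runs_set, AExp.Ok, AExp.ev, e11, e4,
    true_and, and_true, BinOp.fits_add, BinOp.val_add, BinOp.fits_shr,
    BinOp.val_shr, AState.setArr_var, AState.setArr_arr, if_true, if_false, Nat.reduceEqDiff]
  refine ⟨by omega, by omega, by omega, by omega, by omega, by omega, by omega, by omega,
    by omega, by omega, by omega, ?_⟩
  constructor
  case arr =>
    intro k hk
    simp only [List.mem_cons, List.not_mem_nil, or_false] at hk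
    rcases hk with rfl | rfl | rfl | rfl | rfl | rfl | rfl | rfl | rfl | rfl | rfl <;> rfl
  all_goals intros
  all_goals first | rfl | simp [*]

-- At most one unit is due to the new node and one to its parent, which gains a child.
open Classical in
theorem covSum_newNode {B N top p : ℕ} {h h' : AState} (H : Micro B N top h) (hp : p < N)
    (E : NewNode N p h h') : covSum (N + 1) h' ≤ covSum N h + 2 := by
  have hk : ∀ z, kids (N + 1) (h'.arr aPar) z =
      if z = p then N :: kids N (h.arr aPar) z else kids N (h.arr aPar) z :=
    kids_succ H.pos (fun j hj => E.par hj) E.par_new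
  have h0 : kids N (h.arr aPar) N = [] := by
    rw [List.eq_nil_iff_forall_not_mem]
    intro j hj
    obtain ⟨a, b, c⟩ := mem_kids.1 hj
    have := H.par_lt j a b
    omega
  have h1 : ∑ z ∈ Finset.range N, (if z = p then 1 else 0) = 1 := by
    rw [Finset.sum_ite_eq', if_pos (Finset.mem_range.2 hp)]
  unfold covSum
  rw [Finset.sum_range_succ, hk N, if_neg hp.ne', h0]
  have h2 : ∀ z ∈ Finset.range N,
      (if Cov h' z then 0 else 1 + (kids (N + 1) (h'.arr aPar) z).length) ≤
      (if Cov h z then 0 else 1 + (kids N (h.arr aPar) z).length) + if z = p then 1 else 0 := by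
    intro z hz
    have hc := H.cov_new E (Finset.mem_range.1 hz)
    rw [hk z]
    by_cases hz : Cov h z
    · rw [if_pos hz, if_pos (hc.2 hz)]; omega
    · rw [if_neg hz, if_neg (mt hc.1 hz)]
      split_ifs
      · simp; omega
      · omega
  have h3 := Finset.sum_le_sum h2
  rw [Finset.sum_add_distrib, h1] at h3
  by_cases hN : Cov h' N
  · rw [if_pos hN]; omega
  · rw [if_neg hN, List.length_nil]; omega

/-- Needed to see that the pointer `aNx` at an opening is a legal array index. -/
theorem Components.full_nx {full cut : ℕ → Prop} {up lab top nx pv : ℕ → ℕ} {tr : ℕ → Grove}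
    (H : Components full cut up lab top nx pv tr) {q : ℕ} (hq : full q) :
    full (nx (2 * q) / 2) := by
  have hq' : q ∈ (tr (lab q)).verts := (H.mem _ _).2 ⟨hq, rfl⟩
  obtain ⟨A, B, e1, -⟩ := Grove.tour_ins (y := 0) (H.nodup _) hq'
  obtain ⟨c, er, -⟩ := H.root _ (H.tr_ne_nil hq)
  have hch := H.chain (lab q)
  cases B with
  | nil =>
    exfalso
    have h1 : (tr (lab q)).tour.getLast? = some (2 * q) := by rw [e1]; simp
    have h2 : (tr (lab q)).tour.getLast? = some (2 * top (lab q) + 1) := by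
      rw [er]; simp [Grove.tour, List.getLast?_cons]
    rw [h1] at h2; simp at h2; omega
  | cons b B =>
    rw [e1, List.isChain_append_cons] at hch
    obtain ⟨-, ⟨hb, -⟩, -⟩ := List.isChain_append_cons_cons.1 (e1 ▸ H.chain (lab q))
    rw [hb]
    exact (H.full_of_mem_tour (l := lab q) (by rw [e1]; simp)).1

/-- If the edge above `m` is cut, `m` forms its own component, otherwise it joins that of its
parent. The potential grows by the logarithm of the new component size, which is at most `N`. -/
theorem Components.runs_insertProg {w N m : ℕ} {h : AState} {full cut : ℕ → Prop} {up : ℕ → ℕ}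
    {tr : ℕ → Grove}
    (H : Components full cut up (h.arr aLab) (h.arr aTop) (h.arr aNx) (h.arr aPv) tr)
    (hN : ∀ M, full M → M < N) (hl : 2 * N ≤ lim w) (hm : ¬ full m) (hmN : m < N)
    (e12 : h.var 12 = m) (hp : h.arr aPar m < N) (hq : h.arr aMic (h.arr aPar m) < N)
    (hc : cut m ↔ Cov h (h.arr aPar m)) (hu : up m = h.arr aMic (h.arr aPar m))
    (hf : ¬ cut m → full (up m)) :
    Runs w insertProg h fun h' t =>
      (∃ tr', Components (fun M => full M ∨ M = m) cut up (h'.arr aLab) (h'.arr aTop) (h'.arr aNx)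
        (h'.arr aPv) tr' ∧ groveSum N tr' ≤ groveSum N tr + Nat.log 2 N) ∧ t ≤ 10 ∧
      (∀ k, k ≠ aLab → k ≠ aTop → k ≠ aNx → k ≠ aPv → h'.arr k = h.arr k) ∧
      (∀ i, i ≠ 15 → i ≠ 16 → h'.var i = h.var i) ∧ h'.inp = h.inp := by
  have hlw := lim_lt w
  simp only [insertProg, runs_seq (p := .set _ _), runs_set, AExp.Ok, AExp.ev, e12, true_and]
  refine ⟨⟨by omega, by omega⟩, ?_⟩
  set q := h.arr aMic (h.arr aPar m) with hqd
  rw [hu] at hf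
  by_cases hcm : cut m
  · refine runs_ite_of_ne ?_ ?_ ?_
    · simp [e12]; omega
    · simpa [e12, Cov] using hc.1 hcm
    simp only [runs_seq, runs_st, runs_set, AExp.Ok, AExp.ev, e12, true_and, and_true, and_assoc,
      BinOp.fits_add, BinOp.val_add, AState.setArr_var, AState.setVar_var, if_false,
      Nat.reduceEqDiff]
    repeat refine ⟨by omega, ?_⟩
    refine ⟨⟨Function.update tr m (.node m .nil .nil), ?_, ?_⟩, by omega, ?_, ?_, rfl⟩
    · have := H.insertRoot hm hcm
      convert this using 1 <;> simp [← two_mul]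
    · have e0 : tr m = .nil := H.eq_nil fun h => hm h.1
      have := groveSum_update (tr := tr) hmN (.node m .nil .nil)
      simp only [e0, Grove.verts, List.length_nil, phi_zero, List.append_nil, List.length_cons,
        phi_succ, zero_add, Nat.log_one_right, add_zero] at this
      omega
    · intro k k1 k2 k3 k4
      simp [k1, k2, k3, k4]
    · intro i i1 i2
      simp [i1]
  · have hf := hf hcm
    have hx := hN _ (H.full_nx hf)
    have hxl : h.arr aNx (2 * q) < lim w := by omega
    have hqm : q ≠ m := fun e => hm (e ▸ hf)
    refine runs_ite_of_eq ?_ ?_ ?_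
    · simp [e12]; omega
    · simpa [e12, Cov] using mt hc.2 hcm
    simp only [runs_seq, runs_st, runs_set, AExp.Ok, AExp.ev, e12, true_and, and_true, and_assoc,
      BinOp.fits_add, BinOp.val_add, AState.setArr_var, AState.setVar_var, if_false, if_true,
      Nat.reduceEqDiff, AState.setVar_arr, AState.setArr_arr, ← two_mul]
    repeat refine ⟨by omega, ?_⟩
    refine ⟨⟨Function.update tr (h.arr aLab q) ((tr (h.arr aLab q)).ins q m), ?_, ?_⟩, by omega, ?_, ?_, rfl⟩
    · have := H.insertLeaf hm hcm hf hu
      convert this using 1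
    · have hq' : q ∈ (tr (h.arr aLab q)).verts := (H.mem _ _).2 ⟨hf, rfl⟩
      have hv := Grove.verts_ins (y := m) (H.nodup _) hq'
      have h1 := hN _ (H.label _ (H.tr_ne_nil hf)).1
      have := groveSum_update (tr := tr) h1 ((tr (h.arr aLab q)).ins q m)
      have hnd : (m :: (tr (h.arr aLab q)).verts).Nodup :=
        List.nodup_cons.2 ⟨fun h => hm ((H.mem _ _).1 h).1, H.nodup _⟩
      have hle := (hnd.subperm (l₂ := List.range N) (fun a ha => by
        rw [List.mem_range]
        rcases List.mem_cons.1 ha with rfl | ha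
        · exact hmN
        · exact hN _ ((H.mem _ _).1 ha).1)).length_le
      rw [List.length_range, List.length_cons] at hle
      rw [hv.length_eq, List.length_cons, phi_succ] at this
      have := Nat.log_mono_right (b := 2) hle
      omega
    · intro k k1 k2 k3 k4
      simp [k1, k2, k3, k4]
    · intro i i1 i2
      simp [i1, i2]

/-- The data structure after a new node has been added. -/
theorem Forest.newNode {w N p : ℕ} {tr tr' : ℕ → Grove} {h h₁ h' : AState} {full : ℕ → Prop}
    (F : Forest w N tr h) (hp : p < N) (L : LinkStep N p h h₁) (E : NewNode N p h h')
    (M : Micro (w - 6) (N + 1) (h'.var 2) h') (v1 : h'.var 1 = h₁.var 1) (v4 : h'.var 4 = h₁.var 4)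
    (a4 : h'.arr aHead = h₁.arr aHead) (a5 : h'.arr aSib = h₁.arr aSib)
    (C : Components full (fun M => Cov h (h.arr aPar M)) (fun M => h.arr aMic (h.arr aPar M))
      (h'.arr aLab) (h'.arr aTop) (h'.arr aNx) (h'.arr aPv) tr')
    (hf : ∀ M, FullM h' (N + 1) M ↔ full M) (hN : ∀ M, full M → M < N) :
    Forest w (N + 1) tr' h' ∧ groveSum (N + 1) tr' = groveSum N tr' := by
  have H := F.micro
  refine ⟨⟨M, by rw [v1, L.size], ?_, ?_, ?_⟩, ?_⟩
  · rw [v4, L.var _ (by simp) (by simp), F.topBit]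
  · refine F.kidLists.newNode H.pos hp H.par_lt (fun j hj => E.par hj) E.par_new ?_ ?_ ?_ ?_ ?_
    · intro j hj hjp
      rw [a4, L.head, Function.update_of_ne hj.ne, Function.update_of_ne hjp]
    · rw [a4, L.head, Function.update_of_ne hp.ne, Function.update_self]
    · rw [a4, L.head, Function.update_self]
    · intro j hj
      rw [a5, L.sib, Function.update_of_ne hj.ne]
    · rw [a5, L.sib, Function.update_self]
  · refine C.congr hf (fun M hM => ?_) (fun M hM => ?_)
    · rw [E.par (hN M hM)]; exact H.cov_new E (H.par_lt' (hN M hM))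
    · rw [E.par (hN M hM), E.mic (H.par_lt' (hN M hM))]
  · have : tr' N = .nil := C.eq_nil fun h => lt_irrefl _ (hN N h.1)
    rw [groveSum, Finset.sum_range_succ, this]
    simp [groveSum, Grove.verts]

theorem LinkStep.newNode {N p m b s : ℕ} {h h₁ h₂ : AState} (L : LinkStep N p h h₁)
    (J : JoinStep N p m b s h₁ h₂) : NewNode N p h h₂ := by
  refine ⟨fun k hk j hj => ?_, ?_⟩
  · simp only [List.mem_cons, List.not_mem_nil, or_false] at hk
    rcases hk with rfl | rfl | rfl | rfl | rfl | rfl | rfl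
    · rw [J.arr _ (by simp), L.par, Function.update_of_ne hj.ne]
    · rw [J.mic, Function.update_of_ne hj.ne, L.arr _ (by simp) (by simp) (by simp)]
    · rw [J.anc, Function.update_of_ne hj.ne, L.arr _ (by simp) (by simp) (by simp)]
    · rw [J.bit, Function.update_of_ne hj.ne, L.arr _ (by simp) (by simp) (by simp)]
    · rw [J.arr _ (by simp), L.arr _ (by simp) (by simp) (by simp)]
    · rw [J.arr _ (by simp), L.arr _ (by simp) (by simp) (by simp)]
    · rw [J.cap, Function.update_of_ne hj.ne, L.arr _ (by simp) (by simp) (by simp)]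
  · rw [J.arr _ (by simp), L.par, Function.update_self]

theorem LinkStep.newNode_fresh {N p b : ℕ} {h h₁ h₂ : AState} (L : LinkStep N p h h₁)
    (J : FreshStep N b h₁ h₂) : NewNode N p h h₂ := by
  refine ⟨fun k hk j hj => ?_, ?_⟩
  · simp only [List.mem_cons, List.not_mem_nil, or_false] at hk
    rcases hk with rfl | rfl | rfl | rfl | rfl | rfl | rfl
    · rw [J.arr _ (by simp), L.par, Function.update_of_ne hj.ne]
    · rw [J.mic, Function.update_of_ne hj.ne, L.arr _ (by simp) (by simp) (by simp)]
    · rw [J.anc, Function.update_of_ne hj.ne, L.arr _ (by simp) (by simp) (by simp)]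
    · rw [J.bit, Function.update_of_ne hj.ne, L.arr _ (by simp) (by simp) (by simp)]
    · rw [J.marks, Function.update_of_ne hj.ne, L.arr _ (by simp) (by simp) (by simp)]
    · rw [J.base, Function.update_of_ne hj.ne, L.arr _ (by simp) (by simp) (by simp)]
    · rw [J.cap, Function.update_of_ne hj.ne, L.arr _ (by simp) (by simp) (by simp)]
  · rw [J.arr _ (by simp), L.par, Function.update_self]

theorem two_pow_shiftRight_one {B s : ℕ} (hs : s < B) :
    2 ^ (B - 1 - s) >>> 1 = if s + 1 < B then 2 ^ (B - 1 - (s + 1)) else 0 := by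
  rw [Nat.shiftRight_one]
  split_ifs with h
  · rw [show B - 1 - s = (B - 1 - (s + 1)) + 1 by omega, pow_succ, Nat.mul_div_cancel _ (by norm_num)]
  · rw [show B - 1 - s = 0 by omega]; rfl

/-- The final state of `newLeafProg`. -/
structure Extended (w N p : ℕ) (tr : ℕ → Grove) (h h' : AState) (t : ℕ) : Prop where
  forest : ∃ tr', Forest w (N + 1) tr' h' ∧
    t + potential (N + 1) tr' h' ≤ potential N tr h + 150
  mkd : ∀ j < N, Mkd h' j ↔ Mkd h j
  mkd_new : ¬ Mkd h' N
  par : ∀ j < N, h'.arr aPar j = h.arr aPar j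
  par_new : h'.arr aPar N = p
  arr : ∀ k ∈ [aOwn, aStk, aCur, aHp], h'.arr k = h.arr k
  var_N : h'.var 11 = N
  var : ∀ i, i = 0 ∨ 2 < i ∧ i < 10 ∨ 20 ≤ i → h'.var i = h.var i
  inp : h'.inp = h.inp

/-- Each insertion saves `12` units for its microtree. When the microtree becomes full, its savings
are released and pay for its entry into a component. The `20` steps added to `t` leave room for the
surrounding program. -/
theorem Forest.runs_join {w N p : ℕ} {tr : ℕ → Grove} {h : AState} (F : Forest w N tr h)
    (hN : 8 * (N + 2) ≤ lim w) (hp : p < N) (e10 : h.var 10 = p)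
    (e12 : h.var 12 = h.arr aMic p) (e13 : h.var 13 = h.arr aNb (h.arr aMic p))
    (e14 : h.var 14 = h.arr aSz (h.arr aMic p)) (hnb : h.arr aNb (h.arr aMic p) ≠ 0)
    (hc : h.arr aSz (h.arr aMic p) < h.arr aCap (h.arr aMic p)) :
    Runs w (linkProg;; joinProg;; .ite (.ld aNb (.v 12)) (.set 14 (.v 14)) insertProg) h
      fun h' t => Extended w N p tr h h' (t + 20) := by
  have H := F.micro
  have hlw := lim_lt w
  have hmN := H.mic_lt hp
  have hmm := H.mic_mic p hp
  generalize hm : h.arr aMic p = m at *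
  generalize hs : h.arr aSz m = s at *
  have hsB : s < w - 6 := by
    by_contra hle
    rw [H.nb_eq m hmN hmm, if_neg (by omega)] at hnb
    exact hnb rfl
  have hb : h.arr aNb m = 2 ^ (w - 6 - 1 - s) := by
    rw [H.nb_eq m hmN hmm, hs, if_pos hsB]
  have hbl : 2 ^ (w - 6 - 1 - s) < lim w := Nat.pow_lt_pow_right (by norm_num) (by omega)
  have htop := H.top_le
  have hseg := H.seg m hmN hmm
  rw [runs_seq]
  refine (runs_linkProg (w := w) (by omega) hp F.size e10).mono ?_
  rintro h1 _ ⟨rfl, L⟩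
  rw [runs_seq]
  have eL : ∀ k, k ≠ aPar → k ≠ aSib → k ≠ aHead → h1.arr k = h.arr k := L.arr
  have eb : h1.arr aBase = h.arr aBase := eL _ (by simp) (by simp) (by simp)
  refine (runs_joinProg (w := w) (p := p) (m := m) (b := 2 ^ (w - 6 - 1 - s)) (s := s) (N := N)
    (by omega) hp hmN hbl (by rw [eb]; omega) (by rw [L.var _ (by simp) (by simp), e10]) L.var_N
    (by rw [L.var _ (by simp) (by simp), e12]) (by rw [L.var _ (by simp) (by simp), e13, hb])
    (by rw [L.var _ (by simp) (by simp), e14])).mono ?_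
  rintro h2 _ ⟨rfl, J⟩
  have E := L.newNode J
  have n2 : ∀ j, j ≠ m → h2.arr aNb j = h.arr aNb j := by
    intro j hj
    rw [J.nb, Function.update_of_ne hj, eL _ (by simp) (by simp) (by simp)]
  have n1 : h2.arr aNb m = if s + 1 < w - 6 then 2 ^ (w - 6 - 1 - (s + 1)) else 0 := by
    rw [J.nb, Function.update_self, two_pow_shiftRight_one hsB]
  have s1 : h2.arr aSz m = s + 1 := by
    rw [J.sz, Function.update_of_ne hmN.ne, Function.update_self]
  have s2 : ∀ j < N, j ≠ m → h2.arr aSz j = h.arr aSz j := by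
    intro j hj hjm
    rw [J.sz, Function.update_of_ne hj.ne, Function.update_of_ne hjm,
      eL _ (by simp) (by simp) (by simp)]
  have s3 : h2.arr aSz N = 0 := by rw [J.sz, Function.update_self]
  have m1 : h2.arr aMic N = m := by rw [J.mic, Function.update_self]
  have b1 : h2.arr aBit N = 2 ^ (w - 6 - 1 - s) := by rw [J.bit, Function.update_self]
  obtain ⟨M2, S2⟩ := H.join E hp hm.symm hs.symm hsB hc m1
    (by rw [J.anc, Function.update_self, eL _ (by simp) (by simp) (by simp)]) b1 n1
    (fun j _ => n2 j) s1 s2 s3 (by rw [J.cap, Function.update_self])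
    (by rw [J.slot, eb, Function.update_self])
    (fun i hi => by
      rw [J.slot, eb, Function.update_of_ne hi, eL _ (by simp) (by simp) (by simp)])
    (by rw [J.idx, Function.update_self])
    (fun i hi => by rw [J.idx, Function.update_of_ne hi, eL _ (by simp) (by simp) (by simp)])
  have K := H.join_mkd E hp hm.symm hs.symm hsB m1 b1
  have T2 : ∑ j ∈ Finset.range (N + 1), (if h2.arr aNb j = 0 then 0 else h2.arr aSz j) + s =
      ∑ j ∈ Finset.range N, (if h.arr aNb j = 0 then 0 else h.arr aSz j) +
        if h2.arr aNb m = 0 then 0 else s + 1 := by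
    have := Finset.sum_range_update hmN (fun j => if h.arr aNb j = 0 then 0 else h.arr aSz j)
      (if h2.arr aNb m = 0 then 0 else s + 1)
    simp only [if_neg hnb, hs] at this
    rw [← this, Finset.sum_range_succ, s3, ite_self, add_zero]
    congr 1
    refine Finset.sum_congr rfl fun j hj => ?_
    rw [Function.update_apply]
    by_cases hj' : j = m
    · rw [if_pos hj', hj', s1]
    · rw [if_neg hj', n2 j hj', s2 j (Finset.mem_range.1 hj) hj']
  have V2 : ∀ i, i ≠ 1 → i ≠ 11 → h2.var i = h.var i := by
    intro i i1 i2
    rw [J.var, L.var i i1 i2]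
  have fin : ∀ (h3 : AState) (tr3 : ℕ → Grove) (t3 : ℕ) (full : ℕ → Prop),
      Components full (fun M => Cov h (h.arr aPar M)) (fun M => h.arr aMic (h.arr aPar M))
        (h3.arr aLab) (h3.arr aTop) (h3.arr aNx) (h3.arr aPv) tr3 →
      (∀ M, FullM h2 (N + 1) M ↔ full M) → (∀ M, full M → M < N) →
      (∀ k, k ≠ aLab → k ≠ aTop → k ≠ aNx → k ≠ aPv → h3.arr k = h2.arr k) →
      (∀ i, i ≠ 15 → i ≠ 16 → h3.var i = h2.var i) → h3.inp = h2.inp →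
      t3 + 12 * groveSum N tr3 + 12 * (if h2.arr aNb m = 0 then 0 else s + 1) ≤
        12 * groveSum N tr + 12 * s + 40 →
      Extended w N p tr h h3 (6 + (9 + t3) + 20) := by
    intro h3 tr3 t3 full C hf hfN ea ev ei ht
    have ea' : ∀ k ∈ [aPar, aMic, aAnc, aBit, aMk, aNb, aSz, aBase, aSlot, aIdx, aCap, aHead, aSib,
        aOwn, aStk, aCur, aHp], h3.arr k = h2.arr k := fun k hk =>
      ea k (by rintro rfl; simp at hk) (by rintro rfl; simp at hk) (by rintro rfl; simp at hk)
        (by rintro rfl; simp at hk)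
    have E3 : NewNode N p h h3 := by
      refine ⟨fun k hk j hj => ?_, by rw [ea' _ (by simp), E.par_new]⟩
      rw [ea' k (by simp at hk ⊢; tauto), E.old k hk j hj]
    have M3 : Micro (w - 6) (N + 1) (h3.var 2) h3 := by
      rw [ev _ (by simp) (by simp), V2 _ (by simp) (by simp)]
      exact M2.congr fun k hk => ea' k (by simp at hk ⊢; tauto)
    obtain ⟨F3, G3⟩ := F.newNode hp L E3 M3
      (by rw [ev _ (by simp) (by simp), J.var]) (by rw [ev _ (by simp) (by simp), J.var])
      (by rw [ea' _ (by simp), J.arr _ (by simp)]) (by rw [ea' _ (by simp), J.arr _ (by simp)])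
      C (fun M => by rw [← hf, FullM, FullM, ea' aMic (by simp), ea' aNb (by simp)]) hfN
    refine ⟨⟨tr3, F3, ?_⟩, fun j hj => H.mkd_new E3 hj, ?_, fun j hj => E3.par hj, E3.par_new,
      ?_, ?_, ?_, ?_⟩
    · have := covSum_newNode H hp E3
      unfold potential
      rw [G3, ea' aNb (by simp), ea' aSz (by simp), ea' aCap (by simp), S2]
      omega
    · unfold Mkd at K ⊢
      rwa [ea' _ (by simp), ea' _ (by simp), ea' _ (by simp)]
    · intro k hk
      simp only [List.mem_cons, List.not_mem_nil, or_false] at hk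
      rcases hk with rfl | rfl | rfl | rfl <;>
        rw [ea' _ (by simp), J.arr _ (by simp), eL _ (by simp) (by simp) (by simp)]
    · rw [ev _ (by simp) (by simp), J.var, L.var_N]
    · intro i hi
      rw [ev _ (by omega) (by omega), V2 _ (by omega) (by omega)]
    · rw [ei, J.inp, L.inp]
  have aL : ∀ k ∈ [aLab, aTop, aNx, aPv], h2.arr k = h.arr k := by
    intro k hk
    simp only [List.mem_cons, List.not_mem_nil, or_false] at hk
    rcases hk with rfl | rfl | rfl | rfl <;>
      rw [J.arr _ (by simp), eL _ (by simp) (by simp) (by simp)]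
  have C2 := F.comps
  rw [← aL aLab (by simp), ← aL aTop (by simp), ← aL aNx (by simp), ← aL aPv (by simp)] at C2
  have v12 : h2.var 12 = m := by rw [V2 _ (by simp) (by simp), e12]
  -- Only the microtree `m` that received the node can have become full.
  have hfull : ∀ M, FullM h2 (N + 1) M ↔
      FullM h N M ∨ (M = m ∧ h2.arr aNb m = 0) := by
    intro M
    unfold FullM
    by_cases hMN : M = N
    · subst hMN
      rw [m1]
      have : m ≠ M := hmN.ne
      simp [this, this.symm]
    · by_cases hMm : M = m
      · subst hMm
        rw [E.mic hmN]
        simp [hmm, hnb, hmN, show M < N + 1 by omega]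
      · rw [n2 M hMm]
        constructor
        · rintro ⟨h3, h4, h5⟩
          rw [E.mic (by omega)] at h4
          exact .inl ⟨by omega, h4, h5⟩
        · rintro (⟨h3, h4, h5⟩ | h3)
          · exact ⟨by omega, by rw [E.mic h3, h4], h5⟩
          · exact absurd h3.1 hMm
  by_cases hz : h2.arr aNb m = 0
  · refine runs_ite_of_eq ?_ ?_ ?_
    · simp only [AExp.Ok, AExp.ev, v12, true_and]; omega
    · simpa [v12] using hz
    have hpm := H.par_lt' hmN
    refine (C2.runs_insertProg (w := w) (N := N) (m := m) (fun M hM => hM.1) (by omega)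
      (fun hM => hnb hM.2.2) hmN v12 ?_ ?_ ?_ ?_ ?_).mono ?_
    · rwa [E.par hmN]
    · rw [E.par hmN, E.mic hpm]; exact H.mic_lt hpm
    · rw [E.par hmN]; exact (H.cov_new E hpm).symm
    · rw [E.par hmN, E.mic hpm]
    · intro hcm
      refine ⟨H.mic_lt hpm, H.mic_mic _ hpm, H.full m hmN (Nat.pos_of_ne_zero ?_) hmm⟩
      -- The microtree of node `0` counts as cut, since `aPar 0 = 0` is covered; so an uncut `m` has
      -- a parent microtree.
      rintro rfl
      exact hcm (by rw [H.par_zero]; exact H.cov_of_mkd H.pos H.mkd_zero)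
    · rintro h3 t3 ⟨⟨tr3, C3, g3⟩, ht3, b1, b2, b3⟩
      refine fin h3 tr3 (t3 + 1) _ C3 ?_ ?_ b1 b2 b3 ?_
      · intro M; rw [hfull]; simp [hz]
      · rintro M (hM | rfl)
        · exact hM.1
        · exact hmN
      · rw [if_pos hz]
        -- A full microtree has released `12 * s` units with `s = w - 7`, and `Nat.log 2 N ≤ w - 7`
        -- because `N < 2 ^ (w - 6)`.
        have hs1 : ¬ s + 1 < w - 6 := by
          intro hlt
          rw [n1, if_pos hlt] at hz
          exact absurd hz (by positivity)
        have : Nat.log 2 N < w - 6 := Nat.log_lt_of_lt_pow (by omega) (by unfold lim at hN; omega)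
        omega
  · refine runs_ite_of_ne ?_ ?_ ?_
    · simp only [AExp.Ok, AExp.ev, v12, true_and]; omega
    · simpa [v12] using hz
    rw [runs_skip]
    refine fin h2 tr 2 _ C2 ?_ (fun M hM => hM.1) (fun _ _ _ _ _ => rfl) (fun _ _ _ => rfl) rfl ?_
    · intro M; rw [hfull]; simp [hz]
    · rw [if_neg hz]; omega

/-- As microtrees may have more than one node, the new one is not full and the contracted forest
does not change. -/
theorem Forest.runs_fresh {w N p : ℕ} {tr : ℕ → Grove} {h : AState} (F : Forest w N tr h)
    (hN : 8 * (N + 2) ≤ lim w) (hp : p < N) (e10 : h.var 10 = p)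
    (hnb : h.arr aNb (h.arr aMic p) = 0) :
    Runs w (linkProg;; freshProg) h fun h' t => Extended w N p tr h h' (t + 20) := by
  have H := F.micro
  have hlw := lim_lt w
  have htop := H.top_le
  have hB : 1 < w - 6 := by
    by_contra hle
    have : lim w ≤ 2 ^ 1 := Nat.pow_le_pow_right (by norm_num) (by omega)
    omega
  rw [runs_seq]
  refine (runs_linkProg (w := w) (by omega) hp F.size e10).mono ?_
  rintro h1 _ ⟨rfl, L⟩
  have eL : ∀ k, k ≠ aPar → k ≠ aSib → k ≠ aHead → h1.arr k = h.arr k := L.arr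
  have v2 : h1.var 2 = h.var 2 := L.var _ (by simp) (by simp)
  refine (runs_freshProg (w := w) (b := 2 ^ (w - 6 - 1)) (N := N) (by omega)
    (Nat.pow_lt_pow_right (by norm_num) (by omega)) (by omega) L.var_N
    (by rw [L.var _ (by simp) (by simp), F.topBit])).mono ?_
  rintro h2 _ ⟨rfl, J⟩
  have E := L.newNode_fresh J
  have n1 : h2.arr aNb N = 2 ^ (w - 6 - 1 - 1) := by
    have := two_pow_shiftRight_one (B := w - 6) (s := 0) (by omega)
    rw [J.nb, Function.update_self]
    simpa [hB] using this
  have n2 : ∀ j < N, h2.arr aNb j = h.arr aNb j := by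
    intro j hj
    rw [J.nb, Function.update_of_ne hj.ne, eL _ (by simp) (by simp) (by simp)]
  have s1 : h2.arr aSz N = 1 := by rw [J.sz, Function.update_self]
  have s2 : ∀ j < N, h2.arr aSz j = h.arr aSz j := by
    intro j hj
    rw [J.sz, Function.update_of_ne hj.ne, eL _ (by simp) (by simp) (by simp)]
  have m1 : h2.arr aMic N = N := by rw [J.mic, Function.update_self]
  have k1 : h2.arr aMk N = 0 := by rw [J.marks, Function.update_self]
  obtain ⟨M2, S2⟩ := H.fresh E hp hB hnb m1 (by rw [J.anc, Function.update_self])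
    (by rw [J.bit, Function.update_self]) k1 n1 n2 s1 s2 (by rw [J.cap, Function.update_self])
    (by rw [J.base, Function.update_self, v2]) (by rw [J.slot, v2, Function.update_self])
    (fun i hi => by
      rw [J.slot, v2, Function.update_of_ne hi, eL _ (by simp) (by simp) (by simp)])
    (by rw [J.idx, Function.update_self])
    (fun i hi => by rw [J.idx, Function.update_of_ne hi, eL _ (by simp) (by simp) (by simp)])
  have aL : ∀ k ∈ [aLab, aTop, aNx, aPv, aOwn, aStk, aCur, aHp], h2.arr k = h.arr k := by
    intro k hk
    rw [J.arr k (by simp at hk ⊢; tauto)]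
    exact eL k (by rintro rfl; simp at hk) (by rintro rfl; simp at hk) (by rintro rfl; simp at hk)
  have C2 := F.comps
  rw [← aL aLab (by simp), ← aL aTop (by simp), ← aL aNx (by simp), ← aL aPv (by simp)] at C2
  obtain ⟨F2, G2⟩ := F.newNode (full := FullM h N) hp L E (by rw [J.top, v2]; exact M2)
    (J.var _ (by simp)) (J.var _ (by simp)) (J.arr _ (by simp)) (J.arr _ (by simp)) C2
    (fun M => by
      unfold FullM
      by_cases hMN : M = N
      · subst hMN; simp [n1]
      · by_cases hM : M < N
        · simp [E.mic hM, n2 M hM, hM, show M < N + 1 by omega]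
        · simp [hM, show ¬ M < N + 1 by omega])
    (fun M hM => hM.1)
  refine ⟨⟨tr, F2, ?_⟩, fun j hj => H.mkd_new E hj, ?_, fun j hj => E.par hj, E.par_new,
    fun k hk => aL k (by simp at hk ⊢; tauto), by rw [J.var _ (by simp), L.var_N], ?_, ?_⟩
  · have h3 := covSum_newNode H hp E
    have h4 : ∑ j ∈ Finset.range (N + 1), (if h2.arr aNb j = 0 then 0 else h2.arr aSz j) ≤
        ∑ j ∈ Finset.range N, (if h.arr aNb j = 0 then 0 else h.arr aSz j) + 1 := by
      rw [Finset.sum_range_succ]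
      refine Nat.add_le_add (le_of_eq (Finset.sum_congr rfl fun j hj => ?_)) ?_
      · rw [n2 j (Finset.mem_range.1 hj), s2 j (Finset.mem_range.1 hj)]
      · split_ifs <;> omega
    unfold potential
    rw [G2, S2]
    omega
  · unfold Mkd
    rw [m1, k1]; simp
  · intro i hi
    rw [J.var _ (by omega), L.var _ (by omega) (by omega)]
  · rw [J.inp, L.inp]

theorem Forest.congr {w N : ℕ} {tr : ℕ → Grove} {h h' : AState} (F : Forest w N tr h)
    (ha : h'.arr = h.arr) (h1 : h'.var 1 = h.var 1) (h2 : h'.var 2 = h.var 2)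
    (h4 : h'.var 4 = h.var 4) : Forest w N tr h' := by
  obtain ⟨v, a, i⟩ := h
  obtain ⟨v', a', i'⟩ := h'
  obtain rfl : a' = a := ha
  obtain ⟨b1, b2, b3, b4, b5⟩ := F
  exact ⟨by rw [h2]; exact b1.congr fun _ _ => rfl, by rw [h1, b2], by rw [h4, b3], b4, b5⟩

theorem potential_congr {N : ℕ} {tr : ℕ → Grove} {h h' : AState} (ha : h'.arr = h.arr) :
    potential N tr h' = potential N tr h := by
  obtain ⟨v, a, i⟩ := h
  obtain ⟨v', a', i'⟩ := h'
  obtain rfl : a' = a := ha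
  rfl

/-- Preparations that only touch temporaries or move the array of a microtree can be put in front.
-/
theorem Extended.of_forest {w N p t t' : ℕ} {tr tr₁ : ℕ → Grove} {h h₁ h' : AState}
    (X : Extended w N p tr₁ h₁ h' t)
    (ht : t' + potential N tr₁ h₁ ≤ potential N tr h + t)
    (ha : ∀ k, k ≠ aSlot → k ≠ aBase → k ≠ aCap → h₁.arr k = h.arr k)
    (hv : ∀ i, i = 0 ∨ 2 < i ∧ i < 10 ∨ 20 ≤ i → h₁.var i = h.var i) (hi : h₁.inp = h.inp) :
    Extended w N p tr h h' t' := by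
  obtain ⟨⟨tr', F, h1⟩, h2, h3, h4, h5, h6, h7, h8, h9⟩ := X
  refine ⟨⟨tr', F, by omega⟩, fun j hj => ?_, h3, fun j hj => ?_, h5, fun k hk => ?_, h7,
    fun i hi => by rw [h8 i hi, hv i hi], by rw [h9, hi]⟩
  · rw [h2 j hj]
    unfold Mkd
    rw [ha _ (by simp) (by simp) (by simp), ha _ (by simp) (by simp) (by simp),
      ha _ (by simp) (by simp) (by simp)]
  · rw [h4 j hj, ha _ (by simp) (by simp) (by simp)]
  · rw [h6 k hk]
    exact ha k (by rintro rfl; simp at hk) (by rintro rfl; simp at hk) (by rintro rfl; simp at hk)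

/-- Adding a node takes constant time apart from the change of the potential. -/
theorem Forest.runs_newLeafProg {w N p : ℕ} {tr : ℕ → Grove} {h : AState} (F : Forest w N tr h)
    (hN : 8 * (N + 2) ≤ lim w) (hp : p < N) (e10 : h.var 10 = p) :
    Runs w newLeafProg h fun h' t => Extended w N p tr h h' t := by
  have H := F.micro
  have hlw := lim_lt w
  have hmN := H.mic_lt hp
  have hmm := H.mic_mic p hp
  rw [newLeafProg]
  simp only [runs_seq (p := .set _ _), runs_set, AExp.Ok, AExp.ev, e10, true_and,
    AState.setVar_var, AState.setVar_arr, if_true, Nat.reduceEqDiff, if_false]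
  refine ⟨by omega, by omega, by omega, ?_⟩
  generalize hm : h.arr aMic p = m at *
  generalize hh : ((h.setVar 12 m).setVar 13 (h.arr aNb m)).setVar 14 (h.arr aSz m) = h₁
  have a1 : h₁.arr = h.arr := by rw [← hh]; rfl
  have i1 : h₁.inp = h.inp := by rw [← hh]; rfl
  have v1 : ∀ i, i ≠ 12 → i ≠ 13 → i ≠ 14 → h₁.var i = h.var i := by
    intro i i1 i2 i3; rw [← hh]; simp [i1, i2, i3]
  have F1 : Forest w N tr h₁ := F.congr a1 (v1 _ (by simp) (by simp) (by simp))
    (v1 _ (by simp) (by simp) (by simp)) (v1 _ (by simp) (by simp) (by simp))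
  have P1 : potential N tr h₁ = potential N tr h := potential_congr a1
  have e12 : h₁.var 12 = m := by rw [← hh]; simp
  have e13 : h₁.var 13 = h₁.arr aNb m := by rw [a1, ← hh]; simp
  have e14 : h₁.var 14 = h₁.arr aSz m := by rw [a1, ← hh]; simp
  have e10' : h₁.var 10 = p := by rw [v1 _ (by simp) (by simp) (by simp), e10]
  have hm1 : h₁.arr aMic p = m := by rw [a1, hm]
  have hmm1 : h₁.arr aMic m = m := by rw [a1, hmm]
  by_cases hnb : h₁.arr aNb m = 0
  · refine runs_ite_of_eq trivial (by rw [AExp.ev, e13, hnb]) ?_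
    refine (F1.runs_fresh hN hp e10' (by rw [hm1, hnb])).mono ?_
    rintro h2 t2 X
    exact X.of_forest (by omega) (fun k _ _ _ => by rw [a1])
      (fun i hi => v1 i (by omega) (by omega) (by omega)) i1
  · refine runs_ite_of_ne trivial (by rwa [AExp.ev, e13]) ?_
    rw [runs_seq (p := .ite _ _ _)]
    -- The common continuation, entered with a free slot either at once or after doubling.
    have join : ∀ (h2 : AState) (t2 : ℕ), Forest w N tr h2 →
        t2 + potential N tr h2 ≤ potential N tr h + 10 →
        h2.arr aSz m < h2.arr aCap m →
        (∀ k, k ≠ aSlot → k ≠ aBase → k ≠ aCap → h2.arr k = h₁.arr k) →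
        (∀ i, i ≠ 16 → i ≠ 2 → h2.var i = h₁.var i) → h2.inp = h₁.inp →
        Runs w (linkProg;; joinProg;; .ite (.ld aNb (.v 12)) (.set 14 (.v 14)) insertProg) h2
          fun h3 t3 => Extended w N p tr h h3 (1 + (1 + (1 + (t2 + t3 + 1)))) := by
      intro h2 t2 F2 ht hc ea ev ei
      have b1 : h2.arr aMic p = m := by rw [ea _ (by simp) (by simp) (by simp), hm1]
      refine (F2.runs_join hN hp (by rw [ev _ (by simp) (by simp), e10']) ?_ ?_ ?_ ?_ ?_).mono ?_
      · rw [b1, ev _ (by simp) (by simp), e12]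
      · rw [b1, ev _ (by simp) (by simp), e13, ea _ (by simp) (by simp) (by simp)]
      · rw [b1, ev _ (by simp) (by simp), e14, ea _ (by simp) (by simp) (by simp)]
      · rwa [b1, ea _ (by simp) (by simp) (by simp)]
      · rwa [b1]
      · rintro h3 t3 X
        refine X.of_forest (by omega) (fun k k1 k2 k3 => by rw [ea k k1 k2 k3, a1])
          (fun i hi => by rw [ev i (by omega) (by omega), v1 i (by omega) (by omega) (by omega)])
          (by rw [ei, i1])
    by_cases hc : h₁.arr aSz m = h₁.arr aCap m
    · refine runs_ite_of_ne ?_ ?_ ?_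
      · simp only [AExp.Ok, AExp.ev, e12, BinOp.fits_eq, true_and, and_true]; omega
      · simp [e12, e14, hc]
      have hs := F1.micro.sz_pos m hmN hmm1
      refine (F1.runs_growProg (by omega) hmN hmm1 e12 e14 hc).mono ?_
      rintro h2 t2 ⟨F2, ht, hcap, ea, ev, ei⟩
      refine join h2 _ F2 (by omega) ?_ ea ev ei
      rw [hcap, ea _ (by simp) (by simp) (by simp)]
      omega
    · refine runs_ite_of_eq ?_ ?_ ?_
      · simp only [AExp.Ok, AExp.ev, e12, BinOp.fits_eq, true_and, and_true]; omega
      · simp [e12, e14, hc]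
      rw [runs_skip]
      have hs := F1.micro.sz_le_cap m hmN hmm1
      exact join h₁ _ F1 (by omega) (by omega) (fun _ _ _ _ => rfl) (fun _ _ _ => rfl) rfl

/-! ### Handles and the demotion of marks -/

/-- Puts the handle of the nearest marked ancestor of the handle `0` into the variable `0`. -/
def nmaProg : AProg :=
  .set 40 (.ld aCur (.v 0));;
  findProg;;
  .set 0 (.ld aOwn (.v 43))

/-- Marks the handle `0`. -/
def markHandleProg : AProg :=
  .set 20 (.ld aCur (.v 0));;
  markProg

/-- Adds a new handle below the handle `0`. -/
def addLeafProg : AProg :=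
  .set 10 (.ld aCur (.v 0));;
  newLeafProg;;
  .st aCur (.v 3) (.v 11);;
  .st aOwn (.v 11) (.v 3);;
  .st aHp (.v 3) (.v 0);;
  .set 0 (.v 3);;
  .set 3 (.op .add (.v 3) (.c 1))

/-- Marks the siblings from `52` on. -/
def markKidsProg : AProg :=
  .while (.v 52)
    (.set 20 (.v 52);;
      markProg;;
      .set 52 (.ld aSib (.v 52)))

/-- Moves the mark of the handle `0` to its children. -/
def demoteProg : AProg :=
  .set 51 (.ld aCur (.v 0));;
  .ite (.op .and (.ld aBit (.v 51)) (.ld aMk (.ld aMic (.v 51))))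
    (.set 52 (.ld aHead (.v 51));;
      markKidsProg;;
      .set 10 (.ld aCur (.ld aHp (.v 0)));;
      newLeafProg;;
      .st aCur (.v 0) (.v 11);;
      .st aOwn (.v 11) (.v 0))
    (.set 51 (.v 51))

theorem cov_congr {h h' : AState} (ha : ∀ k, k ≠ aCur → k ≠ aOwn → k ≠ aHp → h'.arr k = h.arr k) :
    Cov h' = Cov h := by
  funext j
  unfold Cov
  rw [ha aAnc (by simp) (by simp) (by simp), ha aMic (by simp) (by simp) (by simp),
    ha aMk (by simp) (by simp) (by simp)]

theorem Forest.congr_arr {w N : ℕ} {tr : ℕ → Grove} {h h' : AState} (F : Forest w N tr h)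
    (ha : ∀ k, k ≠ aCur → k ≠ aOwn → k ≠ aHp → h'.arr k = h.arr k) (h1 : h'.var 1 = h.var 1)
    (h2 : h'.var 2 = h.var 2) (h4 : h'.var 4 = h.var 4) : Forest w N tr h' := by
  refine ⟨?_, by rw [h1, F.size], by rw [h4, F.topBit], ?_, ?_⟩
  · rw [h2]
    exact F.micro.congr fun k hk =>
      ha k (by rintro rfl; simp at hk) (by rintro rfl; simp at hk) (by rintro rfl; simp at hk)
  · rw [ha aPar (by simp) (by simp) (by simp), ha aHead (by simp) (by simp) (by simp),
      ha aSib (by simp) (by simp) (by simp)]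
    exact F.kidLists
  · rw [ha aPar (by simp) (by simp) (by simp), ha aMic (by simp) (by simp) (by simp),
      ha aLab (by simp) (by simp) (by simp), ha aTop (by simp) (by simp) (by simp),
      ha aNx (by simp) (by simp) (by simp), ha aPv (by simp) (by simp) (by simp), cov_congr ha]
    refine F.comps.congr (fun M => ?_) (fun _ _ => Iff.rfl) (fun _ _ => rfl)
    rw [FullM, FullM, ha aMic (by simp) (by simp) (by simp), ha aNb (by simp) (by simp) (by simp)]

theorem potential_congr_arr {N : ℕ} {tr : ℕ → Grove} {h h' : AState}
    (ha : ∀ k, k ≠ aCur → k ≠ aOwn → k ≠ aHp → h'.arr k = h.arr k) :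
    potential N tr h' = potential N tr h := by
  rw [potential, potential, covSum, covSum, cov_congr ha,
    ha aPar (by simp) (by simp) (by simp), ha aNb (by simp) (by simp) (by simp),
    ha aSz (by simp) (by simp) (by simp), ha aCap (by simp) (by simp) (by simp)]

/-- The state `h` represents a forest with the handles `1, …, n`, where `up` gives the parents, with
`0` as the parent of the roots, and `mkd` the marked handles. Every handle has a current node. -/
structure Handles (w N n : ℕ) (tr : ℕ → Grove) (up : ℕ → ℕ) (mkd : ℕ → Prop) (h : AState) : Prop where
  forest : Forest w N tr h
  size_lt : n < N
  next : h.var 3 = n + 1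
  up_lt : ∀ u, 0 < u → u ≤ n → up u < u
  hp : ∀ u, 0 < u → u ≤ n → h.arr aHp u = up u
  cur_lt : ∀ u ≤ n, h.arr aCur u < N
  own : ∀ u ≤ n, h.arr aOwn (h.arr aCur u) = u
  cur_zero : h.arr aCur 0 = 0
  mkd_iff : ∀ u, 0 < u → u ≤ n → (Mkd h (h.arr aCur u) ↔ mkd u)
  par : ∀ u, 0 < u → u ≤ n → ¬ mkd u → h.arr aPar (h.arr aCur u) = h.arr aCur (up u)

/-- The potential of the data structure and of the lists of children. -/
noncomputable def handlePotential (N n : ℕ) (tr : ℕ → Grove) (h : AState) : ℕ :=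
  potential N tr h +
    20 * ∑ u ∈ Finset.range (n + 1), (kids N (h.arr aPar) (h.arr aCur u)).length

namespace Handles

variable {w N n : ℕ} {tr : ℕ → Grove} {up : ℕ → ℕ} {mkd : ℕ → Prop} {h : AState}

theorem cur_inj (R : Handles w N n tr up mkd h) {u v : ℕ} (hu : u ≤ n) (hv : v ≤ n)
    (e : h.arr aCur u = h.arr aCur v) : u = v := by
  rw [← R.own u hu, ← R.own v hv, e]

theorem congr (R : Handles w N n tr up mkd h) {up' : ℕ → ℕ} {mkd' : ℕ → Prop}
    (h1 : ∀ u, 0 < u → u ≤ n → up' u = up u) (h2 : ∀ u, 0 < u → u ≤ n → (mkd' u ↔ mkd u)) :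
    Handles w N n tr up' mkd' h :=
  { R with
    up_lt := fun u a b => by rw [h1 u a b]; exact R.up_lt u a b
    hp := fun u a b => by rw [h1 u a b]; exact R.hp u a b
    mkd_iff := fun u a b => by rw [h2 u a b]; exact R.mkd_iff u a b
    par := fun u a b => by rw [h1 u a b, h2 u a b]; exact R.par u a b }

theorem congr_state (R : Handles w N n tr up mkd h) {h' : AState} (ha : h'.arr = h.arr)
    (h1 : h'.var 1 = h.var 1) (h2 : h'.var 2 = h.var 2) (h4 : h'.var 4 = h.var 4)
    (h3 : h'.var 3 = h.var 3) : Handles w N n tr up mkd h' := by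
  obtain ⟨b1, b2, b3, b4, b5, b6, b7, b8, b9, b10⟩ := R
  have c1 := b1.congr ha h1 h2 h4
  obtain ⟨v, a, i⟩ := h
  obtain ⟨v', a', i'⟩ := h'
  obtain rfl : a' = a := ha
  exact ⟨c1, b2, by rw [h3, b3], b4, b5, b6, b7, b8, b9, b10⟩

/-- The nearest marked ancestor of a handle. -/
theorem runs_nmaProg (R : Handles w N n tr up mkd h) (hN : 8 * (N + 1) ≤ lim w) {u : ℕ} (hu : u ≤ n)
    (e : h.var 0 = u) :
    Runs w nmaProg h fun h' t => t ≤ 22 ∧ Handles w N n tr up mkd h' ∧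
      handlePotential N n tr h' = handlePotential N n tr h ∧
      Nearest up (fun v => v = 0 ∨ mkd v) u (h'.var 0) := by
  have hlw := lim_lt w
  have hnN := R.size_lt
  have hcu := R.cur_lt u hu
  rw [nmaProg, runs_seq, runs_set]
  simp only [AExp.Ok, AExp.ev, e, true_and]
  refine ⟨by omega, ?_⟩
  rw [runs_seq]
  have F : Forest w N tr (h.setVar 40 (h.arr aCur u)) :=
    R.forest.congr rfl (by simp) (by simp) (by simp)
  refine (F.runs_findProg hN hcu (by simp)).mono ?_
  rintro h1 t1 ⟨ht, ea, -, ev, hn, hr⟩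
  rw [runs_set]
  simp only [AExp.Ok, AExp.ev, true_and]
  refine ⟨by omega, by omega, ?_, ?_, ?_⟩
  · refine R.congr_state ea ?_ ?_ ?_ ?_ <;> simp [ev]
  · have : (h1.setVar 0 (h1.arr aOwn (h1.var 43))).arr = h.arr := ea
    unfold handlePotential
    rw [potential_congr this, this]
  · rw [AState.setVar_var, if_pos rfl, ea]
    -- The upward path from a current node runs through the current nodes of the ancestors as long
    -- as it meets no mark, and there the search ends.
    have key : ∀ j r, Nearest (h.arr aPar) (Mkd h) j r → ∀ u ≤ n, j = h.arr aCur u →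
        Nearest up (fun v => v = 0 ∨ mkd v) u (h.arr aOwn r) := by
      intro j r H
      induction H with
      | here hm =>
        rintro u hu rfl
        rw [R.own u hu]
        refine .here ?_
        rcases Nat.eq_zero_or_pos u with h0 | h0
        · exact .inl h0
        · exact .inr ((R.mkd_iff u h0 hu).1 hm)
      | step hm _ ih =>
        rintro u hu rfl
        rcases Nat.eq_zero_or_pos u with rfl | h0
        · rw [R.cur_zero] at hm
          exact absurd R.forest.micro.mkd_zero hm
        · have hmu := mt (R.mkd_iff u h0 hu).2 hm
          have := R.up_lt u h0 hu
          refine .step ?_ (ih (up u) (by omega) (R.par u h0 hu hmu))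
          rintro (h1 | h1)
          · omega
          · exact hmu h1
    exact key _ _ hn u hu rfl

theorem runs_markHandleProg (R : Handles w N n tr up mkd h) (hN : 8 * (N + 1) ≤ lim w) {u : ℕ}
    (hu : u ≤ n) (h0 : 0 < u) (e : h.var 0 = u) :
    Runs w markHandleProg h fun h' t => (∃ tr', Handles w N n tr' up (fun v => mkd v ∨ v = u) h' ∧
      t + handlePotential N n tr' h' ≤ handlePotential N n tr h + 11) ∧
      (∀ i, i < 20 ∨ 40 ≤ i → h'.var i = h.var i) ∧ h'.inp = h.inp := by
  have hlw := lim_lt w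
  have hnN := R.size_lt
  have hcu := R.cur_lt u hu
  rw [markHandleProg, runs_seq, runs_set]
  simp only [AExp.Ok, AExp.ev, e, true_and]
  refine ⟨by omega, ?_⟩
  have F : Forest w N tr (h.setVar 20 (h.arr aCur u)) :=
    R.forest.congr rfl (by simp) (by simp) (by simp)
  refine (F.runs_markProg hN hcu (by simp)).mono ?_
  rintro h1 t1 ⟨⟨tr1, F1, ht⟩, hm, ea, ev, ei⟩
  have ea' : ∀ k ∈ [aPar, aHp, aCur, aOwn], h1.arr k = h.arr k := fun k hk => by
    rw [ea k (by rintro rfl; simp at hk) (by rintro rfl; simp at hk) (by rintro rfl; simp at hk)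
      (by rintro rfl; simp at hk) (by rintro rfl; simp at hk) (by rintro rfl; simp at hk)]
    rfl
  have ec := ea' aCur (by simp)
  refine ⟨⟨tr1, ⟨F1, hnN, ?_, R.up_lt, ?_, ?_, ?_, ?_, ?_, ?_⟩, ?_⟩, fun i hi => ?_, ei⟩
  · rw [ev _ (by simp), AState.setVar_var, if_neg (by simp), R.next]
  · rw [ea' aHp (by simp)]; exact R.hp
  · rw [ec]; exact R.cur_lt
  · rw [ec, ea' aOwn (by simp)]; exact R.own
  · rw [ec]; exact R.cur_zero
  · intro v hv hvn
    rw [ec, hm _ (R.cur_lt v hvn)]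
    exact or_congr (R.mkd_iff v hv hvn) ⟨R.cur_inj hvn hu, fun e => by rw [e]⟩
  · intro v hv hvn hvm
    rw [ec, ea' aPar (by simp)]
    exact R.par v hv hvn fun h => hvm (.inl h)
  · have : potential N tr (h.setVar 20 (h.arr aCur u)) = potential N tr h := potential_congr rfl
    unfold handlePotential
    rw [ec, ea' aPar (by simp)]
    omega
  · rw [ev i hi, AState.setVar_var, if_neg (by omega)]

/-- Handles have distinct current nodes, so a new forest node is a child of at most one of them. -/
theorem sum_kids_le {N n p : ℕ} {par par' c : ℕ → ℕ} (hN : 0 < N)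
    (hc : ∀ u < n, ∀ v < n, c u = c v → u = v) (h : ∀ j < N, par' j = par j) (hp : par' N = p) :
    ∑ u ∈ Finset.range n, (kids (N + 1) par' (c u)).length ≤
      ∑ u ∈ Finset.range n, (kids N par (c u)).length + 1 := by
  have h1 : ∀ u ∈ Finset.range n, (kids (N + 1) par' (c u)).length =
      (kids N par (c u)).length + if c u = p then 1 else 0 := by
    intro u _
    rw [kids_succ hN h hp]
    split_ifs <;> simp
  rw [Finset.sum_congr rfl h1, Finset.sum_add_distrib]
  have h2 : ∑ u ∈ Finset.range n, (if c u = p then 1 else 0) ≤ 1 := by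
    rw [← Finset.sum_filter, ← Finset.card_eq_sum_ones, Finset.card_le_one]
    intro u hu v hv
    simp only [Finset.mem_filter, Finset.mem_range] at hu hv
    exact hc u hu.1 v hv.1 (hu.2.trans hv.2.symm)
  omega

theorem runs_addLeafProg (R : Handles w N n tr up mkd h) (hN : 8 * (N + 2) ≤ lim w) {u : ℕ}
    (hu : u ≤ n) (e : h.var 0 = u) :
    Runs w addLeafProg h fun h' t => (∃ tr', Handles w (N + 1) (n + 1) tr'
      (Function.update up (n + 1) u) (fun v => v ≠ n + 1 ∧ mkd v) h' ∧
      t + handlePotential (N + 1) (n + 1) tr' h' ≤ handlePotential N n tr h + 180) ∧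
      h'.var 0 = n + 1 ∧
      (∀ i, 20 ≤ i → h'.var i = h.var i) ∧ h'.inp = h.inp := by
  have hlw := lim_lt w
  have hnN := R.size_lt
  have hcu := R.cur_lt u hu
  rw [addLeafProg, runs_seq, runs_set]
  simp only [AExp.Ok, AExp.ev, e, true_and]
  refine ⟨by omega, ?_⟩
  have F : Forest w N tr (h.setVar 10 (h.arr aCur u)) :=
    R.forest.congr rfl (by simp) (by simp) (by simp)
  rw [runs_seq]
  refine (F.runs_newLeafProg hN hcu (by simp)).mono ?_
  rintro h1 t1 ⟨⟨tr1, F1, ht⟩, m1, m2, p1, p2, ea, e11, ev, ei⟩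
  have v3 : h1.var 3 = n + 1 := by rw [ev 3 (by simp), AState.setVar_var, if_neg (by simp), R.next]
  have v0 : h1.var 0 = u := by rw [ev 0 (by simp), AState.setVar_var, if_neg (by simp), e]
  simp only [runs_seq, runs_st, runs_set, AExp.Ok, AExp.ev, v3, v0, e11, true_and, and_true,
    BinOp.fits_add, BinOp.val_add, AState.setArr_var, AState.setVar_var, if_false, and_assoc,
    OfNat.ofNat_ne_zero]
  repeat refine ⟨by omega, ?_⟩
  generalize hh : ((((h1.setArr aCur (n + 1) N).setArr aOwn N (n + 1)).setArr aHp (n + 1) u).setVar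
    0 (n + 1)).setVar 3 (n + 1 + 1) = h2
  have hA : ∀ k, k ≠ aCur → k ≠ aOwn → k ≠ aHp → h2.arr k = h1.arr k := by
    intro k k1 k2 k3
    rw [← hh]; simp [k1, k2, k3]
  have hC : h2.arr aCur = Function.update (h.arr aCur) (n + 1) N := by
    rw [← hh]; simp [ea aCur (by simp)]
  have hO : h2.arr aOwn = Function.update (h.arr aOwn) N (n + 1) := by
    rw [← hh]; simp [ea aOwn (by simp)]
  have hH : h2.arr aHp = Function.update (h.arr aHp) (n + 1) u := by
    rw [← hh]; simp [ea aHp (by simp)]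
  have hP := hA aPar (by simp) (by simp) (by simp)
  have hV : ∀ i, i ≠ 0 → i ≠ 3 → h2.var i = h1.var i := by
    intro i i1 i2
    rw [← hh]; simp [i1, i2]
  have hM : ∀ j, Mkd h2 j ↔ Mkd h1 j := fun j => by
    unfold Mkd
    rw [hA aBit (by simp) (by simp) (by simp), hA aMic (by simp) (by simp) (by simp),
      hA aMk (by simp) (by simp) (by simp)]
  have hc' : ∀ v ≤ n, h2.arr aCur v = h.arr aCur v := fun v hv => by
    rw [hC, Function.update_of_ne (by omega)]
  have hcn : h2.arr aCur (n + 1) = N := by rw [hC, Function.update_self]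
  have F2 : Forest w (N + 1) tr1 h2 :=
    F1.congr_arr hA (hV _ (by simp) (by simp)) (hV _ (by simp) (by simp))
      (hV _ (by simp) (by simp))
  refine ⟨⟨tr1, ⟨F2, by omega, by rw [← hh]; simp, ?_, ?_, ?_, ?_, ?_, ?_, ?_⟩, ?_⟩, by simp,
    fun i hi => ?_, ?_⟩
  · intro v hv hvn
    rw [Function.update_apply]
    split_ifs with hvn'
    · omega
    · exact R.up_lt v hv (by omega)
  · intro v hv hvn
    rw [hH, Function.update_apply, Function.update_apply]
    split_ifs with hvn'
    · rfl
    · exact R.hp v hv (by omega)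
  · intro v hvn
    rcases Nat.lt_or_ge n v with hv | hv
    · obtain rfl : v = n + 1 := by omega
      omega
    · rw [hc' v hv]
      have := R.cur_lt v hv
      omega
  · intro v hvn
    rcases Nat.lt_or_ge n v with hv | hv
    · obtain rfl : v = n + 1 := by omega
      rw [hcn, hO, Function.update_self]
    · rw [hc' v hv, hO, Function.update_of_ne (R.cur_lt v hv).ne, R.own v hv]
  · rw [hc' 0 (by omega), R.cur_zero]
  · intro v hv0 hvn
    rcases Nat.lt_or_ge n v with hv | hv
    · obtain rfl : v = n + 1 := by omega
      rw [hcn, hM]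
      simp [m2]
    · rw [hc' v hv, hM, m1 _ (R.cur_lt v hv), and_iff_right (by omega)]
      exact R.mkd_iff v hv0 hv
  · intro v hv0 hvn hvm
    rcases Nat.lt_or_ge n v with hv | hv
    · obtain rfl : v = n + 1 := by omega
      rw [hcn, hP, p2, Function.update_self, hc' u hu]
    · have hlt := R.up_lt v hv0 hv
      rw [hc' v hv, hP, p1 _ (R.cur_lt v hv), Function.update_of_ne (by omega), hc' _ (by omega)]
      exact R.par v hv0 hv fun h => hvm ⟨by omega, h⟩
  · have h3 : potential (N + 1) tr1 h2 = potential (N + 1) tr1 h1 := potential_congr_arr hA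
    have h4 : potential N tr (h.setVar 10 (h.arr aCur u)) = potential N tr h := potential_congr rfl
    have h5 := sum_kids_le (n := n + 1) (c := h.arr aCur) R.forest.micro.pos
      (fun u hu v hv => R.cur_inj (by omega) (by omega)) p1 p2
    have h6 : (kids (N + 1) (h1.arr aPar) N).length = 0 := by
      have hpos := R.forest.micro.pos
      rw [kids_succ hpos p1 p2, if_neg hcu.ne', List.length_eq_zero_iff,
        List.eq_nil_iff_forall_not_mem]
      intro j hj
      obtain ⟨a, b, c⟩ := mem_kids.1 hj
      have := R.forest.micro.par_lt j a b
      simp only [AState.setVar_arr] at c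
      omega
    unfold handlePotential
    rw [Finset.sum_range_succ, hcn, hP, h6, h3]
    have h7 : ∑ v ∈ Finset.range (n + 1), (kids (N + 1) (h1.arr aPar) (h2.arr aCur v)).length =
        ∑ v ∈ Finset.range (n + 1), (kids (N + 1) (h1.arr aPar) (h.arr aCur v)).length :=
      Finset.sum_congr rfl fun v hv => by rw [hc' v (by simp at hv; omega)]
    rw [h7]
    simp only [AState.setVar_arr] at h5
    omega
  · rw [if_neg (by omega), if_neg (by omega), ev i (by omega), AState.setVar_var,
      if_neg (by omega)]
  · rw [← hh]; exact ei

end Handles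

theorem Forest.runs_markKidsProg {w N : ℕ} (hN : 8 * (N + 1) ≤ lim w) (R : List ℕ) :
    ∀ (tr : ℕ → Grove) (h : AState), Forest w N tr h → LinkedFrom (h.arr aSib) (h.var 52) R →
    (∀ c ∈ R, c < N) →
    Runs w markKidsProg h fun h' t => (∃ tr', Forest w N tr' h' ∧
        t + potential N tr' h' ≤ potential N tr h + 13 * R.length + 1) ∧
      (∀ j < N, Mkd h' j ↔ Mkd h j ∨ j ∈ R) ∧
      (∀ k ∈ [aPar, aOwn, aCur, aHp, aHead, aSib], h'.arr k = h.arr k) ∧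
      (∀ i, i < 20 ∨ 53 ≤ i → h'.var i = h.var i) ∧ h'.inp = h.inp := by
  have hlw := lim_lt w
  induction R with
  | nil =>
    intro tr h F hl _
    exact runs_while_of_eq trivial hl ⟨⟨tr, F, by simp; omega⟩, by simp, fun _ _ => rfl,
      fun _ _ => rfl, rfl⟩
  | cons c R ih =>
    intro tr h F hl hR
    obtain ⟨e52, hc0, hl⟩ := hl
    have hcN := hR c (by simp)
    refine runs_while_of_ne trivial (by simp only [AExp.ev]; omega) ?_
    rw [runs_seq, runs_set]
    refine ⟨trivial, ?_⟩
    rw [AExp.ev, e52, runs_seq]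
    have F0 : Forest w N tr (h.setVar 20 c) := F.congr rfl (by simp) (by simp) (by simp)
    have P0 : potential N tr (h.setVar 20 c) = potential N tr h := potential_congr rfl
    refine (F0.runs_markProg hN hcN (by simp)).mono ?_
    rintro h1 t1 ⟨⟨tr1, F1, ht⟩, hm, ea, ev, ei⟩
    have v52 : h1.var 52 = c := by rw [ev _ (by simp), AState.setVar_var, if_neg (by simp), e52]
    have ea' : ∀ k ∈ [aPar, aOwn, aCur, aHp, aHead, aSib], h1.arr k = h.arr k := fun k hk => by
      rw [ea k (by rintro rfl; simp at hk) (by rintro rfl; simp at hk) (by rintro rfl; simp at hk)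
        (by rintro rfl; simp at hk) (by rintro rfl; simp at hk) (by rintro rfl; simp at hk)]
      rfl
    rw [runs_set]
    simp only [AExp.Ok, AExp.ev, v52, true_and, ea' aSib (by simp)]
    refine ⟨by omega, ?_⟩
    have F2 : Forest w N tr1 (h1.setVar 52 (h.arr aSib c)) :=
      F1.congr rfl (by simp) (by simp) (by simp)
    have P2 : potential N tr1 (h1.setVar 52 (h.arr aSib c)) = potential N tr1 h1 :=
      potential_congr rfl
    refine (ih tr1 _ F2 (by simpa [ea' aSib (by simp)] using hl)
      fun d hd => hR d (by simp [hd])).mono ?_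
    rintro h3 t3 ⟨⟨tr3, F3, ht3⟩, hm3, ea3, ev3, ei3⟩
    refine ⟨⟨tr3, F3, by simp only [List.length_cons]; omega⟩, fun j hj => ?_, fun k hk => ?_,
      fun i hi => ?_, ?_⟩
    · rw [hm3 j hj, List.mem_cons]
      have : Mkd (h1.setVar 52 (h.arr aSib c)) j ↔ Mkd h j ∨ j = c := hm j hj
      rw [this]
      tauto
    · rw [ea3 k hk]; exact ea' k hk
    · rw [ev3 i hi, AState.setVar_var, if_neg (by omega), ev i (by omega), AState.setVar_var,
        if_neg (by omega)]
    · rw [ei3]; exact ei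

namespace Handles

variable {w N n : ℕ} {tr : ℕ → Grove} {up : ℕ → ℕ} {mkd : ℕ → Prop} {h : AState}

/-- The old node of `u` keeps its mark and is abandoned. Its children leave the sum in
`handlePotential`, as the new node has none; the `20` units for each of them pay for marking it. -/
theorem runs_demoteProg (R : Handles w N n tr up mkd h) (hN : 8 * (N + 2) ≤ lim w) {u : ℕ}
    (hu : u ≤ n) (h0 : 0 < u) (e : h.var 0 = u) :
    Runs w demoteProg h fun h' t => ∃ N' tr', N' ≤ N + 1 ∧
      Handles w N' n tr' up (fun v => (mkd u ∧ v ≠ u ∧ (mkd v ∨ up v = u)) ∨ (¬ mkd u ∧ mkd v)) h' ∧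
      t + handlePotential N' n tr' h' ≤ handlePotential N n tr h + 190 := by
  have hlw := lim_lt w
  have hnN := R.size_lt
  have hcu := R.cur_lt u hu
  have H := R.forest.micro
  have hmic := H.mic_lt hcu
  rw [demoteProg, runs_seq, runs_set]
  simp only [AExp.Ok, AExp.ev, e, true_and]
  refine ⟨by omega, ?_⟩
  by_cases hm : mkd u
  · have hmk := (R.mkd_iff u h0 hu).2 hm
    refine runs_ite_of_ne ?_ ?_ ?_
    · simp [e]; omega
    · simpa [e, Mkd] using hmk
    rw [runs_seq, runs_set]
    simp only [AExp.Ok, AExp.ev, AState.setVar_var, if_true, true_and, AState.setVar_arr]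
    refine ⟨by omega, ?_⟩
    rw [runs_seq]
    generalize hh : (h.setVar 51 (h.arr aCur u)).setVar 52 (h.arr aHead (h.arr aCur u)) = h1
    have a1 : h1.arr = h.arr := by rw [← hh]; rfl
    have F1 : Forest w N tr h1 := R.forest.congr a1 (by simp [← hh]) (by simp [← hh])
      (by simp [← hh])
    have P1 : potential N tr h1 = potential N tr h := potential_congr a1
    refine (Forest.runs_markKidsProg (by omega) (kids N (h.arr aPar) (h.arr aCur u)) tr h1 F1 ?_
      (fun c hc => (mem_kids.1 hc).1)).mono ?_
    · rw [← hh]; simpa using R.forest.kidLists _ hcu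
    rintro h2 t2 ⟨⟨tr2, F2, ht2⟩, hm2, ea2, ev2, ei2⟩
    have b0 : h2.arr aPar = h.arr aPar := by rw [ea2 _ (by simp), a1]
    have b1 : h2.arr aOwn = h.arr aOwn := by rw [ea2 _ (by simp), a1]
    have b2 : h2.arr aCur = h.arr aCur := by rw [ea2 _ (by simp), a1]
    have b3 : h2.arr aHp = h.arr aHp := by rw [ea2 _ (by simp), a1]
    have v2 : h2.var 0 = u := by rw [ev2 _ (by simp), ← hh]; simpa using e
    have v3 : h2.var 3 = n + 1 := by rw [ev2 _ (by simp), ← hh]; simpa using R.next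
    have hup := R.up_lt u h0 hu
    have hcp := R.cur_lt (up u) (by omega)
    rw [runs_seq, runs_set]
    simp only [AExp.Ok, AExp.ev, v2, true_and, b2, b3, R.hp u h0 hu]
    refine ⟨⟨by omega, by omega⟩, ?_⟩
    have F3 : Forest w N tr2 (h2.setVar 10 (h.arr aCur (up u))) :=
      F2.congr rfl (by simp) (by simp) (by simp)
    have P3 : potential N tr2 (h2.setVar 10 (h.arr aCur (up u))) = potential N tr2 h2 :=
      potential_congr rfl
    rw [runs_seq]
    refine (F3.runs_newLeafProg hN hcp (by simp)).mono ?_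
    rintro h4 t4 ⟨⟨tr4, F4, ht4⟩, m1, m2, p1, p2, ea4, e11, ev4, ei4⟩
    have v0 : h4.var 0 = u := by rw [ev4 _ (by simp), AState.setVar_var, if_neg (by simp), v2]
    simp only [runs_seq, runs_st, AExp.Ok, AExp.ev, v0, e11, true_and, and_true,
      AState.setArr_var]
    refine ⟨by omega, by omega, ?_⟩
    generalize hh' : (h4.setArr aCur u N).setArr aOwn N u = h5
    have hA : ∀ k, k ≠ aCur → k ≠ aOwn → k ≠ aHp → h5.arr k = h4.arr k := by
      intro k k1 k2 k3
      rw [← hh']; simp [k1, k2]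
    have hC : h5.arr aCur = Function.update (h.arr aCur) u N := by
      rw [← hh', ← b2]; simp [ea4 aCur (by simp)]
    have hO : h5.arr aOwn = Function.update (h.arr aOwn) N u := by
      rw [← hh', ← b1]; simp [ea4 aOwn (by simp)]
    have hH : h5.arr aHp = h.arr aHp := by
      rw [← hh', ← b3]; simp [ea4 aHp (by simp)]
    have hV : h5.var = h4.var := by rw [← hh']; rfl
    have hP := hA aPar (by simp) (by simp) (by simp)
    have p1' : ∀ j < N, h4.arr aPar j = h.arr aPar j := fun j hj => by
      rw [p1 j hj, ← b0]; rfl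
    have hM : ∀ j < N, Mkd h5 j ↔ Mkd h j ∨ j ∈ kids N (h.arr aPar) (h.arr aCur u) := by
      intro j hj
      have c1 : Mkd h5 j ↔ Mkd h4 j := by
        unfold Mkd
        rw [hA aBit (by simp) (by simp) (by simp), hA aMic (by simp) (by simp) (by simp),
          hA aMk (by simp) (by simp) (by simp)]
      have c2 : Mkd h4 j ↔ Mkd h2 j := m1 j hj
      have c3 : Mkd h1 j ↔ Mkd h j := by unfold Mkd; rw [a1]
      rw [c1, c2, hm2 j hj, c3]
    have hMN : ¬ Mkd h5 N := by
      unfold Mkd at m2 ⊢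
      rwa [hA aBit (by simp) (by simp) (by simp), hA aMic (by simp) (by simp) (by simp),
        hA aMk (by simp) (by simp) (by simp)]
    have hc' : ∀ v, v ≠ u → h5.arr aCur v = h.arr aCur v := fun v hv => by
      rw [hC, Function.update_of_ne hv]
    have hcN : h5.arr aCur u = N := by rw [hC, Function.update_self]
    have F5 : Forest w (N + 1) tr4 h5 :=
      F4.congr_arr hA (by rw [hV]) (by rw [hV]) (by rw [hV])
    have hpos := H.pos
    refine ⟨N + 1, tr4, le_rfl, ⟨F5, by omega, ?_, R.up_lt, ?_, ?_, ?_, ?_, ?_, ?_⟩, ?_⟩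
    · rw [hV, ev4 _ (by simp), AState.setVar_var, if_neg (by simp), v3]
    · rw [hH]; exact R.hp
    · intro v hv
      by_cases hvu : v = u
      · rw [hvu, hcN]; omega
      · rw [hc' v hvu]
        have := R.cur_lt v hv
        omega
    · intro v hv
      by_cases hvu : v = u
      · rw [hvu, hcN, hO, Function.update_self]
      · rw [hc' v hvu, hO, Function.update_of_ne (R.cur_lt v hv).ne, R.own v hv]
    · rw [hc' 0 (by omega), R.cur_zero]
    · intro v hv0 hv
      by_cases hvu : v = u
      · rw [hvu, hcN]; simp [hm, hMN]
      · rw [hc' v hvu, hM _ (R.cur_lt v hv), R.mkd_iff v hv0 hv, mem_kids]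
        have hpos' : 0 < h.arr aCur v := by
          rw [Nat.pos_iff_ne_zero, ← R.cur_zero]
          exact fun e => hv0.ne' (R.cur_inj hv (Nat.zero_le _) e)
        -- A marked `v` stays marked wherever its node hangs. For an unmarked `v` the node hangs
        -- below the current node of `up v`, so it has just been marked exactly if `up v = u`.
        by_cases hmv : mkd v
        · simp [hm, hmv, hvu]
        · rw [R.par v hv0 hv hmv]
          have hlt := R.up_lt v hv0 hv
          have : h.arr aCur (up v) = h.arr aCur u ↔ up v = u :=
            ⟨R.cur_inj (by omega) hu, fun e => by rw [e]⟩
          simp [hm, hmv, hvu, this, hpos', R.cur_lt v hv]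
    · intro v hv0 hv hvm
      by_cases hvu : v = u
      · rw [hvu, hcN, hP, p2, hc' _ hup.ne]
      -- An unmarked handle other than `u` is not a child of `u`, so the replacement of the node of
      -- `u` does not concern it.
      · have h1 : ¬ mkd v := fun h => hvm (.inl ⟨hm, hvu, .inl h⟩)
        have h2 : up v ≠ u := fun h => hvm (.inl ⟨hm, hvu, .inr h⟩)
        rw [hc' v hvu, hP, p1' _ (R.cur_lt v hv), hc' _ h2]
        exact R.par v hv0 hv h1
    · have h3 : potential (N + 1) tr4 h5 = potential (N + 1) tr4 h4 := potential_congr_arr hA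
      have h5' := sum_kids_le (n := n + 1) (c := h.arr aCur) hpos
        (fun u hu v hv => R.cur_inj (by omega) (by omega)) p1' p2
      have h6 : (kids (N + 1) (h4.arr aPar) N).length = 0 := by
        rw [kids_succ hpos p1' p2, if_neg hcp.ne', List.length_eq_zero_iff,
          List.eq_nil_iff_forall_not_mem]
        intro j hj
        obtain ⟨a, b, c⟩ := mem_kids.1 hj
        have := H.par_lt j a b
        omega
      have h7 : (kids N (h.arr aPar) (h.arr aCur u)).length ≤
          (kids (N + 1) (h4.arr aPar) (h.arr aCur u)).length := by
        rw [kids_succ hpos p1' p2]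
        split_ifs
        · simp
        · exact le_rfl
      -- Replaces the number of children of the old node of `u` by `0`, that of the new leaf.
      have h8 := Finset.sum_range_update (N := n + 1) (i := u) (by omega)
        (fun v => (kids (N + 1) (h4.arr aPar) (h.arr aCur v)).length) 0
      have h9 : ∑ v ∈ Finset.range (n + 1), (kids (N + 1) (h4.arr aPar) (h5.arr aCur v)).length =
          ∑ v ∈ Finset.range (n + 1), Function.update
            (fun v => (kids (N + 1) (h4.arr aPar) (h.arr aCur v)).length) u 0 v := by
        refine Finset.sum_congr rfl fun v _ => ?_
        rw [Function.update_apply, hC, Function.update_apply]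
        split_ifs with hvu
        · exact h6
        · rfl
      unfold handlePotential
      rw [hP, h9, h3]
      omega
  · refine runs_ite_of_eq ?_ ?_ ?_
    · simp [e]; omega
    · simpa [e, Mkd] using mt (R.mkd_iff u h0 hu).1 hm
    rw [runs_skip]
    refine ⟨N, tr, by omega, (R.congr (fun _ _ _ => rfl) fun v _ _ => by simp [hm]).congr_state rfl
      (by simp) (by simp) (by simp) (by simp), ?_⟩
    have : potential N tr (h.setVar 51 (h.arr aCur u)) = potential N tr h := potential_congr rfl
    unfold handlePotential
    rw [this]
    simp only [AState.setVar_arr]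
    omega

end Handles

/-! ### Setting up the data structure -/

/-- Sets up the forest that consists of the node `0`. -/
def rootProg : AProg :=
  .set 4 (.op .shl (.c 1) (.op .sub .wl (.c 7)));;
  .st aPar (.c 0) (.c 0);;
  .st aMic (.c 0) (.c 0);;
  .st aAnc (.c 0) (.v 4);;
  .st aBit (.c 0) (.v 4);;
  .st aHead (.c 0) (.c 0);;
  .st aMk (.c 0) (.v 4);;
  .st aNb (.c 0) (.op .shr (.v 4) (.c 1));;
  .st aSz (.c 0) (.c 1);;
  .st aBase (.c 0) (.c 0);;
  .st aCap (.c 0) (.c 1);;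
  .st aSlot (.c 0) (.c 0);;
  .st aIdx (.v 4) (.c 0);;
  .st aCur (.c 0) (.c 0);;
  .st aOwn (.c 0) (.c 0);;
  .set 1 (.c 1);;
  .set 2 (.c 1);;
  .set 3 (.c 1)

theorem Micro.root {B : ℕ} {h : AState} (hB : 1 < B) (h0 : h.arr aPar 0 = 0)
    (h1 : h.arr aMic 0 = 0) (h2 : h.arr aAnc 0 = 2 ^ (B - 1)) (h3 : h.arr aBit 0 = 2 ^ (B - 1))
    (h4 : h.arr aMk 0 = 2 ^ (B - 1)) (h5 : h.arr aNb 0 = 2 ^ (B - 1 - 1)) (h6 : h.arr aSz 0 = 1)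
    (h7 : h.arr aBase 0 = 0) (h8 : h.arr aCap 0 = 1) (h9 : h.arr aSlot 0 = 0)
    (h10 : h.arr aIdx (2 ^ (B - 1)) = 0) : Micro B 1 1 h := by
  constructor
  case mk_bits =>
    rintro j hj - e he
    obtain rfl : j = 0 := by omega
    rw [h4, Nat.testBit_two_pow, decide_eq_true_eq] at he
    omega
  case disj =>
    intro j hj j' hj'
    omega
  case mkd_zero => simp [Mkd, h1, h3, h4]
  case pos => omega
  case par_zero => exact h0
  case space => simp [h6, h8]
  all_goals
    intro j hj
    obtain rfl : j = 0 := by omega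
    simp [*]
  omega

/-- There are no positive handles yet, hence `up` and `mkd` are arbitrary and can be those of the
tree to be loaded. The potential `15` is that of a single covered node: `12` for the size and `3`
for the array. -/
theorem runs_rootProg {w : ℕ} (hw : 8 ≤ w) (h : AState) (up : ℕ → ℕ) (mkd : ℕ → Prop) :
    Runs w rootProg h fun h' t => t = 18 ∧ Handles w 1 0 (fun _ => .nil) up mkd h' ∧
      handlePotential 1 0 (fun _ => .nil) h' ≤ 15 ∧ (∀ i, 50 ≤ i → h'.var i = h.var i) ∧
      h'.inp = h.inp := by
  have hlw := lim_lt w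
  have e1 : 2 ^ (w - 7) < lim w := Nat.pow_lt_pow_right (by norm_num) (by omega)
  have e2 : 1 ≤ 2 ^ (w - 7) := Nat.one_le_two_pow
  simp only [rootProg, runs_seq, runs_st, runs_set, AExp.Ok, AExp.ev, true_and, and_true,
    BinOp.fits_shl, BinOp.val_shl, BinOp.fits_shr, BinOp.val_shr, BinOp.fits_sub, BinOp.val_sub,
    AState.setArr_var, AState.setVar_var, if_true, and_assoc, Nat.one_shiftLeft]
  repeat refine ⟨by omega, ?_⟩
  have hw' : w - 7 = w - 6 - 1 := by omega
  have hn : 2 ^ (w - 7) >>> 1 = 2 ^ (w - 6 - 1 - 1) := by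
    have := two_pow_shiftRight_one (B := w - 6) (s := 0) (by omega)
    rw [if_pos (by omega)] at this
    simpa [hw'] using this
  generalize hh : AState.setVar _ 3 1 = h1
  have a0 : h1.arr aPar 0 = 0 := by rw [← hh]; simp
  have a1 : h1.arr aMic 0 = 0 := by rw [← hh]; simp
  have a2 : h1.arr aAnc 0 = 2 ^ (w - 6 - 1) := by rw [← hh]; simp [hw']
  have a3 : h1.arr aBit 0 = 2 ^ (w - 6 - 1) := by rw [← hh]; simp [hw']
  have a4 : h1.arr aHead 0 = 0 := by rw [← hh]; simp
  have a8 : h1.arr aMk 0 = 2 ^ (w - 6 - 1) := by rw [← hh]; simp [hw']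
  have a9 : h1.arr aNb 0 = 2 ^ (w - 6 - 1 - 1) := by rw [← hh, ← hn]; simp
  have a10 : h1.arr aSz 0 = 1 := by rw [← hh]; simp
  have a11 : h1.arr aBase 0 = 0 := by rw [← hh]; simp
  have a14 : h1.arr aSlot 0 = 0 := by rw [← hh]; simp
  have a15 : h1.arr aIdx (2 ^ (w - 6 - 1)) = 0 := by rw [← hh]; simp [hw']
  have a20 : h1.arr aCap 0 = 1 := by rw [← hh]; simp
  have a18 : h1.arr aCur 0 = 0 := by rw [← hh]; simp
  have a6 : h1.arr aOwn 0 = 0 := by rw [← hh]; simp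
  have v2 : h1.var 2 = 1 := by rw [← hh]; simp
  have M : Micro (w - 6) 1 1 h1 := Micro.root (by omega) a0 a1 a2 a3 a8 a9 a10 a11 a20 a14 a15
  have hk : kids 1 (h1.arr aPar) 0 = [] := by simp [kids]
  have hf : ∀ M, ¬ FullM h1 1 M := by
    rintro M ⟨h2, -, h4⟩
    obtain rfl : M = 0 := by omega
    rw [a9] at h4
    exact absurd h4 (by positivity)
  refine ⟨⟨⟨by rwa [v2], by rw [← hh]; simp, by rw [← hh]; simp [hw'], ?_, ?_⟩, by omega,
    by rw [← hh]; simp, by omega, by omega, ?_, ?_, a18, by omega, by omega⟩, ?_, ?_,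
    by rw [← hh]; rfl⟩
  · intro i hi
    obtain rfl : i = 0 := by omega
    rw [hk]; exact a4
  · exact ⟨fun l M => by simp [Grove.verts, hf], fun l => List.nodup_nil,
      fun l => List.isChain_nil, fun l h => absurd rfl h, fun l h => absurd rfl h⟩
  · intro u hu
    obtain rfl : u = 0 := by omega
    omega
  · intro u hu
    obtain rfl : u = 0 := by omega
    rw [a18, a6]
  · have hc : Cov h1 0 := M.cov_of_mkd (by omega) M.mkd_zero
    simp only [handlePotential, potential, groveSum, covSum, zero_add, Finset.sum_range_one, Grove.verts,
      List.length_nil, phi_zero, hk, a18, a9, a10, a20, if_pos hc]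
    split_ifs <;> omega
  · intro i hi
    iterate 4 rw [if_neg (by omega)]

/-- Reads the nodes from `53` on. -/
def loadLoop : AProg :=
  .while (.op .lt (.v 53) (.v 54))
    (.set 0 (.inp (.op .add (.v 53) (.v 53)));;
      addLeafProg;;
      .ite (.inp (.op .add (.op .add (.v 53) (.v 53)) (.c 1))) markHandleProg (.set 53 (.v 53));;
      .set 53 (.op .add (.v 53) (.c 1)))

def initProg : AProg :=
  .set 53 (.c 0);;
  .set 54 (.v 0);;
  rootProg;;
  loadLoop

/-- The handle of the parent. -/
def MTree.upHandle (T : MTree) (u : ℕ) : ℕ := handle (T.parent? (u - 1))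

theorem MTree.IsTree.upHandle_lt {T : MTree} (H : T.IsTree) {u : ℕ} (h0 : 0 < u)
    (hu : u ≤ T.size) : T.upHandle u < u := by
  unfold MTree.upHandle MTree.parent?
  split_ifs with h
  · exact h0
  · have := H.2 (u - 1) (by omega) (by omega)
    simp only [handle]
    omega

/-- The initial tree is built by the operations themselves: a leaf insertion per node, in an order
in which parents come first, and a mark where required. -/
theorem runs_loadLoop {w : ℕ} {T : MTree} (H : T.IsTree) (hN : 8 * (T.size + 2) ≤ lim w)
    (inp : ℕ → ℕ) (h1 : ∀ v < T.size, inp (2 * v) = T.upHandle (v + 1))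
    (h2 : ∀ v < T.size, inp (2 * v + 1) = (T.marked v).toNat) :
    ∀ (f k : ℕ) (tr : ℕ → Grove) (h : AState), k + f = T.size → h.var 53 = k →
    h.var 54 = T.size → h.inp = inp →
    Handles w (k + 1) k tr T.upHandle (fun u => T.marked (u - 1) = true) h →
    Runs w loadLoop h fun h' t => ∃ tr',
      Handles w (T.size + 1) T.size tr' T.upHandle (fun u => T.marked (u - 1) = true) h' ∧
      t + handlePotential (T.size + 1) T.size tr' h' ≤ handlePotential (k + 1) k tr h + 200 * f + 1 := by
  have hlw := lim_lt w
  have hl : 2 * lim w ≤ 2 ^ (w - 1) := by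
    unfold lim
    have : 7 ≤ w := by
      by_contra hw
      have : lim w ≤ 2 ^ 0 := Nat.pow_le_pow_right (by norm_num) (by omega)
      omega
    rw [← pow_succ']
    exact Nat.pow_le_pow_right (by norm_num) (by omega)
  intro f
  induction f with
  | zero =>
    intro k tr h hk e53 e54 _ R
    obtain rfl : k = T.size := by omega
    refine runs_while_of_eq ?_ ?_ ⟨tr, R, by omega⟩
    · simp
    · simp [e53, e54]
  | succ f ih =>
    intro k tr h hk e53 e54 ei R
    refine runs_while_of_ne ?_ ?_ ?_
    · simp
    · simp [e53, e54]; omega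
    rw [runs_seq, runs_set]
    simp only [AExp.Ok, AExp.ev, e53, true_and, BinOp.fits_add, BinOp.val_add, ei, ← two_mul,
      h1 k (by omega)]
    refine ⟨⟨by omega, by omega⟩, ?_⟩
    have hup := H.upHandle_lt (u := k + 1) (by omega) (by omega)
    have R0 : Handles w (k + 1) k tr T.upHandle (fun u => T.marked (u - 1) = true)
        (h.setVar 0 (T.upHandle (k + 1))) :=
      R.congr_state rfl (by simp) (by simp) (by simp) (by simp)
    have P0 : handlePotential (k + 1) k tr (h.setVar 0 (T.upHandle (k + 1))) =
        handlePotential (k + 1) k tr h := by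
      unfold handlePotential
      rw [potential_congr (h := h) rfl]; rfl
    rw [runs_seq]
    refine (R0.runs_addLeafProg (by omega) (u := T.upHandle (k + 1)) (by omega) (by simp)).mono ?_
    rintro h3 t3 ⟨⟨tr3, R3, ht3⟩, v0, ev3, ei3⟩
    have v53 : h3.var 53 = k := by rw [ev3 _ (by simp), AState.setVar_var, if_neg (by simp), e53]
    have v54 : h3.var 54 = T.size := by
      rw [ev3 _ (by simp), AState.setVar_var, if_neg (by simp), e54]
    have ei3' : h3.inp = inp := by rw [ei3, ← ei]; rfl
    rw [runs_seq]
    have next : ∀ (h4 : AState) (tr4 : ℕ → Grove) (t4 : ℕ),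
        Handles w (k + 1 + 1) (k + 1) tr4 T.upHandle (fun u => T.marked (u - 1) = true) h4 →
        (∀ i, 50 ≤ i → h4.var i = h3.var i) → h4.inp = h3.inp →
        t4 + handlePotential (k + 1 + 1) (k + 1) tr4 h4 ≤ handlePotential (k + 1) k tr h + 198 →
        Runs w (.set 53 (.op .add (.v 53) (.c 1))) h4 fun h5 t5 => Runs w loadLoop h5 fun h' t =>
          ∃ tr', Handles w (T.size + 1) T.size tr' T.upHandle
              (fun u => T.marked (u - 1) = true) h' ∧
            t4 + t5 + t + 1 + handlePotential (T.size + 1) T.size tr' h' ≤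
              handlePotential (k + 1) k tr h + 200 * (f + 1) + 1 := by
      intro h4 tr4 t4 R4 ev4 ei4 ht4
      rw [runs_set]
      simp only [AExp.Ok, AExp.ev, ev4 53 (by simp), v53, true_and, BinOp.fits_add,
        BinOp.val_add]
      refine ⟨by omega, ?_⟩
      have P4 : handlePotential (k + 1 + 1) (k + 1) tr4 (h4.setVar 53 (k + 1)) =
          handlePotential (k + 1 + 1) (k + 1) tr4 h4 := by
        unfold handlePotential
        rw [potential_congr (h := h4) rfl]; rfl
      refine (ih (k + 1) tr4 (h4.setVar 53 (k + 1)) (by omega) (by simp) ?_ ?_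
        (R4.congr_state rfl (by simp) (by simp) (by simp) (by simp))).mono ?_
      · rw [AState.setVar_var, if_neg (by simp), ev4 _ (by simp), v54]
      · rw [← ei3', ← ei4]; rfl
      · rintro h' t ⟨tr', R', ht'⟩
        exact ⟨tr', R', by omega⟩
    have R3' : Handles w (k + 1 + 1) (k + 1) tr3 T.upHandle
        (fun u => u ≠ k + 1 ∧ T.marked (u - 1) = true) h3 :=
      R3.congr (fun u _ _ => by
        rw [Function.update_apply]; split_ifs with e
        · rw [e]
        · rfl) (fun _ _ _ => Iff.rfl)
    by_cases hm : T.marked k = true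
    · refine runs_ite_of_ne ?_ ?_ ?_
      · simp [v53]; omega
      · simp [v53, ei3', ← two_mul, h2 k (by omega), hm]
      refine (R3'.runs_markHandleProg (by omega) (u := k + 1) le_rfl (by omega) v0).mono ?_
      rintro h4 t4 ⟨⟨tr4, R4, ht4⟩, ev4, ei4⟩
      refine (next h4 tr4 (1 + (t3 + (t4 + 1))) (R4.congr (fun _ _ _ => rfl) fun u _ _ => ?_)
        (fun i hi => ev4 i (by omega)) ei4 (by omega)).mono ?_
      · by_cases e : u = k + 1
        · simp [e, hm]
        · simp [e]
      · intro h5 t5 r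
        exact r.mono fun h' t ⟨tr', a, b⟩ => ⟨tr', a, by omega⟩
    · refine runs_ite_of_eq ?_ ?_ ?_
      · simp [v53]; omega
      · simp [v53, ei3', ← two_mul, h2 k (by omega), hm]
      rw [runs_skip]
      refine (next h3 tr3 (1 + (t3 + (1 + 1))) (R3'.congr (fun _ _ _ => rfl) fun u _ _ => ?_)
        (fun _ _ => rfl) rfl (by omega)).mono ?_
      · by_cases e : u = k + 1
        · simp [e, hm]
        · simp [e]
      · intro h5 t5 r
        exact r.mono fun h' t ⟨tr', a, b⟩ => ⟨tr', a, by omega⟩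

theorem runs_initProg {w : ℕ} {T : MTree} (H : T.IsTree) (hw : 8 ≤ w)
    (hN : 8 * (T.size + 2) ≤ lim w) {h : AState} (h0 : h.var 0 = T.size)
    (h1 : ∀ v < T.size, h.inp (2 * v) = T.upHandle (v + 1))
    (h2 : ∀ v < T.size, h.inp (2 * v + 1) = (T.marked v).toNat) :
    Runs w initProg h fun h' t => ∃ tr',
      Handles w (T.size + 1) T.size tr' T.upHandle (fun u => T.marked (u - 1) = true) h' ∧
      t + handlePotential (T.size + 1) T.size tr' h' ≤ 200 * T.size + 36 := by
  rw [initProg, runs_seq, runs_set]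
  refine ⟨trivial, ?_⟩
  rw [runs_seq, runs_set]
  refine ⟨trivial, ?_⟩
  rw [runs_seq]
  refine (runs_rootProg hw _ T.upHandle (fun u => T.marked (u - 1) = true)).mono ?_
  rintro h3 _ ⟨rfl, R, hP, ev, ei⟩
  refine (runs_loadLoop H hN h.inp h1 h2 T.size 0 _ h3 (by omega) ?_ ?_ ei R).mono ?_
  · rw [ev _ (by simp)]; simp
  · rw [ev _ (by simp)]; simp [h0]
  · rintro h' t ⟨tr', R', ht⟩
    simp only [zero_add] at ht
    exact ⟨tr', R', by omega⟩

/-! ### From handles to trees, and the main theorem -/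

theorem WordRAM.AProg.Runs.exec {w : ℕ} (hw : 7 ≤ w) {p : AProg} {h : AState}
    {Q : AState → ℕ → Prop} (r : Runs w p h Q) (hp : p.Wf = true) {K : ℕ} (hK : p.factor ≤ K)
    {s : State} (V : View w s h) : ∃ s' t' h' t, Exec w p.compile s s' t' ∧ View w s' h' ∧
      t' ≤ K * t ∧ Q h' t := by
  obtain ⟨h', t, r, q⟩ := r
  obtain ⟨s', t', x, V', l⟩ := r.exec_compile hw hp hK V
  exact ⟨s', t', h', t, x, V', l, q⟩

theorem MTree.isAncestor_zero_iff {T : MTree} {u : ℕ} (h : T.IsAncestor u 0) : u = 0 := by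
  cases h with
  | refl => rfl
  | step h _ => exact absurd h.1 (lt_irrefl _)

theorem MTree.isAncestor_iff {T : MTree} {u v : ℕ} (h0 : 0 < v) (hv : v < T.size) :
    T.IsAncestor u v ↔ u = v ∨ T.IsAncestor u (T.parent v) := by
  constructor
  · intro h
    cases h with
    | refl => exact .inl rfl
    | step h h' => exact .inr (h.2.2 ▸ h')
  · rintro (rfl | h)
    · exact .refl
    · exact .step ⟨h0, hv, rfl⟩ h

/-- The node found by `Nearest` on handles is the nearest marked ancestor. -/
theorem MTree.IsTree.isNMA_of_nearest {T : MTree} (H : T.IsTree) {u r : ℕ}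
    (hn : Nearest T.upHandle (fun v => v = 0 ∨ T.marked (v - 1) = true) u r) :
    ∀ v, u = v + 1 → v < T.size → ∃ x, T.IsNMA v x ∧ r = handle x := by
  induction hn with
  | @here j hm =>
    rintro v rfl hv
    have hm : T.marked v = true := by simpa using hm
    exact ⟨some v, ⟨.refl, hm, fun x hx _ => hx⟩, rfl⟩
  | @step j r hm hr ih =>
    rintro v rfl hv
    have hm : ¬ T.marked v = true := by simpa using hm
    -- Above an unmarked tree root the search meets handle `0`, which is the null pointer.
    rcases Nat.eq_zero_or_pos v with rfl | h0
    · refine ⟨none, fun x hx => ?_, ?_⟩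
      · rw [isAncestor_zero_iff hx]; simpa using hm
      · have e : T.upHandle (0 + 1) = 0 := rfl
        rw [e] at hr
        cases hr with
        | here _ => rfl
        | step h _ => exact absurd (.inl rfl) h
    · have e : T.upHandle (v + 1) = T.parent v + 1 := by
        simp [MTree.upHandle, MTree.parent?, h0.ne', handle]
      have hp := H.2 v h0 hv
      obtain ⟨x, hx, rfl⟩ := ih (T.parent v) e (by omega)
      refine ⟨x, ?_, rfl⟩
      cases x with
      | none =>
        intro y hy
        rcases (isAncestor_iff h0 hv).1 hy with rfl | hy
        · simpa using hm
        · exact hx y hy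
      | some z =>
        refine ⟨(isAncestor_iff h0 hv).2 (.inr hx.1), hx.2.1, fun y hy hym => ?_⟩
        rcases (isAncestor_iff h0 hv).1 hy with rfl | hy
        · exact absurd hym hm
        · exact hx.2.2 y hy hym

theorem MTree.IsTree.apply {T : MTree} (H : T.IsTree) {op : TreeOp} (h : op.node < T.size) :
    (T.apply op).IsTree := by
  obtain ⟨k, u⟩ := op
  cases k with
  | nma => exact H
  | mark => exact H
  | addLeaf =>
    refine ⟨Nat.succ_pos _, fun v h0 hv => ?_⟩
    simp only [MTree.apply, MTree.addLeaf, Function.update_apply] at hv ⊢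
    split_ifs with e
    · rw [e]; exact h
    · exact H.2 v h0 (by omega)
  | demoteMark =>
    simp only [MTree.apply, MTree.demoteMark]
    split_ifs
    exacts [H, H]

theorem MTree.size_apply (T : MTree) (op : TreeOp) :
    (T.apply op).size = T.size + if op.kind = .addLeaf then 1 else 0 := by
  obtain ⟨k, u⟩ := op
  cases k <;> simp [MTree.apply, MTree.addLeaf, MTree.mark, MTree.demoteMark]
  split_ifs <;> rfl

theorem MTree.size_applyAll (T : MTree) (ops : List TreeOp) :
    (T.applyAll ops).size = T.size + (ops.map TreeOp.kind).count .addLeaf := by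
  induction ops generalizing T with
  | nil => rfl
  | cons op ops ih =>
    rw [MTree.applyAll, List.foldl_cons]
    have := ih (T.apply op)
    rw [MTree.applyAll] at this
    rw [this, MTree.size_apply, List.map_cons, List.count_cons]
    simp only [beq_iff_eq]
    omega

/-- The program of an operation. -/
def opProg : OpKind → AProg
  | .nma => nmaProg
  | .mark => markHandleProg
  | .addLeaf => addLeafProg
  | .demoteMark => demoteProg

theorem wf_opProg (k : OpKind) : (opProg k).Wf = true := by
  cases k <;> decide

theorem factor_opProg (k : OpKind) : (opProg k).factor ≤ 200 := by
  cases k <;> decide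

theorem wf_initProg : initProg.Wf = true := by decide

set_option maxRecDepth 10000 in
theorem factor_initProg : initProg.factor ≤ 200 := by decide

/-- The number of nodes that an operation may add to the forest. -/
def nodeCost (k : OpKind) : ℕ := if k = .addLeaf ∨ k = .demoteMark then 1 else 0

/-- An operation is answered correctly, and its time is paid for by the potential. -/
theorem Handles.runs_opProg {w N : ℕ} {tr : ℕ → Grove} {T : MTree} {h : AState} {op : TreeOp}
    (H : T.IsTree)
    (R : Handles w N T.size tr T.upHandle (fun u => T.marked (u - 1) = true) h)
    (hN : 8 * (N + nodeCost op.kind + 1) ≤ lim w) (hop : op.node < T.size)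
    (e : h.var 0 = op.node + 1) :
    Runs w (opProg op.kind) h fun h' t => ∃ N' tr', N' ≤ N + nodeCost op.kind ∧
      Handles w N' (T.apply op).size tr' (T.apply op).upHandle
        (fun u => (T.apply op).marked (u - 1) = true) h' ∧
      t + handlePotential N' (T.apply op).size tr' h' ≤ handlePotential N T.size tr h + 190 ∧
      CorrectAnswer T op (h'.var 0) := by
  obtain ⟨k, u⟩ := op
  cases k with
  | nma =>
    refine (R.runs_nmaProg (by simpa [nodeCost] using hN) (u := u + 1) (by simp at hop; omega) e).mono ?_
    rintro h' t ⟨ht, R', hP, hn⟩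
    refine ⟨N, tr, Nat.le_add_right _ _, R', ?_, ?_⟩
    · simp only [MTree.apply]; omega
    · exact H.isNMA_of_nearest hn u rfl hop
  | mark =>
    refine (R.runs_markHandleProg (by simpa [nodeCost] using hN) (u := u + 1)
      (by simp at hop; omega) (by omega) e).mono ?_
    rintro h' t ⟨⟨tr', R', ht⟩, -, -⟩
    refine ⟨N, tr', Nat.le_add_right _ _, R'.congr (fun _ _ _ => rfl) fun v hv _ => ?_, ?_, trivial⟩
    · simp only [MTree.apply, MTree.mark, Function.update_apply]
      have : v - 1 = u ↔ v = u + 1 := by omega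
      split_ifs with hvu
      · simp [this.1 hvu]
      · simp [mt this.2 hvu]
    · simp only [MTree.apply, MTree.mark]; omega
  | addLeaf =>
    refine (R.runs_addLeafProg (by simpa [nodeCost, add_assoc] using hN) (u := u + 1)
      (by simp at hop; omega) e).mono ?_
    rintro h' t ⟨⟨tr', R', ht⟩, hv, -, -⟩
    refine ⟨N + 1, tr', by simp [nodeCost], R'.congr (fun v hv hvn => ?_) fun v hv hvn => ?_, ?_, hv⟩
    · simp only [MTree.apply, MTree.addLeaf, MTree.upHandle, MTree.parent?, Function.update_apply]
      have := H.1
      by_cases hvs : v = T.size + 1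
      · rw [if_pos hvs, hvs]
        simp [show T.size ≠ 0 by omega, handle]
      · rw [if_neg hvs, if_neg (show ¬ v - 1 = T.size by omega)]
    · simp only [MTree.apply, MTree.addLeaf, Function.update_apply]
      by_cases hvs : v = T.size + 1
      · simp [hvs]
      · simp [hvs, show ¬ v - 1 = T.size by omega]
    · simp only [MTree.apply, MTree.addLeaf]; omega
  | demoteMark =>
    refine (R.runs_demoteProg (by simpa [nodeCost, add_assoc] using hN) (u := u + 1)
      (by simp at hop; omega) (by omega) e).mono ?_
    rintro h' t ⟨N', tr', hN', R', ht⟩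
    have hs : (T.demoteMark u).size = T.size := by unfold MTree.demoteMark; split_ifs <;> rfl
    have hp : (T.demoteMark u).parent = T.parent := by unfold MTree.demoteMark; split_ifs <;> rfl
    simp only [MTree.apply]
    rw [hs]
    refine ⟨N', tr', by simpa [nodeCost] using hN',
      R'.congr (fun v hv hvn => ?_) fun v hv hvn => ?_, ht, trivial⟩
    · simp only [MTree.upHandle, MTree.parent?, hp]
    · have e1 : v - 1 = u ↔ v = u + 1 := by omega
      have e2 : T.IsChild (v - 1) u ↔ T.upHandle v = u + 1 := by
        unfold MTree.IsChild MTree.upHandle MTree.parent?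
        split_ifs with h0
        · simp [h0, handle]
        · simp only [handle, Nat.add_right_cancel_iff]
          exact ⟨fun h => h.2.2, fun h => ⟨by omega, by omega, h⟩⟩
      unfold MTree.demoteMark
      split_ifs with hm
      · simp only [Nat.add_sub_cancel, hm, e1, e2]
        split_ifs with h1 h2
        · simp [h1]
        · simp [h1, h2]
        · simp [h1, h2]
      · simp [hm]

/-- The amortized costs telescope, and dropping the final potential bounds every prefix. The memory
condition anticipates the forest nodes of all operations still to come. -/
theorem serves_opProg {w K : ℕ} (hw : 7 ≤ w) (hK : 200 ≤ K) (init : Prog) :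
    ∀ (ops : List TreeOp) (T : MTree) (s : State) (h : AState) (N : ℕ) (tr : ℕ → Grove),
    T.IsTree → T.Admissible ops → View w s h →
    Handles w N T.size tr T.upHandle (fun u => T.marked (u - 1) = true) h →
    8 * (N + ((ops.map TreeOp.kind).map nodeCost).sum + 1) ≤ lim w →
    ∃ ts, Serves w ⟨init, fun k => (opProg k).compile⟩ T s ops ts ∧
      ∀ k ≤ ops.length, (ts.take k).sum ≤ K * (handlePotential N T.size tr h + 190 * k) := by
  have hlw := lim_lt w
  intro ops
  induction ops with
  | nil =>
    intro T s h N tr _ _ _ _ _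
    exact ⟨[], .nil _ _, fun k _ => by simp⟩
  | cons op ops ih =>
    intro T s h N tr H A V R hN
    simp only [List.map_cons, List.sum_cons] at hN
    have hsz := R.size_lt
    have hop := A.1
    have hmod : handle (some op.node) % 2 ^ w = op.node + 1 := by
      rw [handle, Nat.mod_eq_of_lt (by omega)]
    have hx : handle (some op.node) % 2 ^ w < 2 ^ w := Nat.mod_lt _ (by positivity)
    have R0 := R.congr_state (h' := h.setVar 0 (handle (some op.node) % 2 ^ w)) rfl (by simp)
      (by simp) (by simp) (by simp)
    have P0 : handlePotential N T.size tr (h.setVar 0 (handle (some op.node) % 2 ^ w)) =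
        handlePotential N T.size tr h := by
      unfold handlePotential
      rw [potential_congr (h := h) rfl]; rfl
    obtain ⟨s1, t1, h1, t, x, V1, l, N1, tr1, hN1, R1, ht, hc⟩ :=
      (R0.runs_opProg H (op := op) (by omega) hop (by simp [hmod])).exec hw
        (wf_opProg _) ((factor_opProg _).trans hK) (V.setVar hx)
    obtain ⟨ts, S, hts⟩ := ih (T.apply op) s1 h1 N1 tr1 (H.apply hop) A.2 V1 R1 (by omega)
    refine ⟨t1 :: ts, .cons x (by rw [V1.var 0 (by simp)]; exact hc) S, fun k hk => ?_⟩
    cases k with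
    | zero => simp
    | succ k =>
      have := hts k (by simpa using hk)
      rw [List.take_succ_cons, List.sum_cons]
      calc t1 + (ts.take k).sum
          ≤ K * t + K * (handlePotential N1 (T.apply op).size tr1 h1 + 190 * k) :=
            Nat.add_le_add l this
        _ = K * (t + handlePotential N1 (T.apply op).size tr1 h1 + 190 * k) := by ring
        _ ≤ K * (handlePotential N T.size tr h + 190 * (k + 1)) := by
            refine Nat.mul_le_mul_left _ ?_
            omega

theorem sum_nodeCost (L : List OpKind) :
    (L.map nodeCost).sum = L.count .addLeaf + L.count .demoteMark := by
  induction L with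
  | nil => rfl
  | cons k L ih =>
    rw [List.map_cons, List.sum_cons, ih, List.count_cons, List.count_cons]
    cases k <;> simp [nodeCost] <;> omega

/-- The state of a structured program that a machine state represents. -/
def WordRAM.AState.ofState (w : ℕ) (s : State) : AState :=
  ⟨s.reg, fun k i => s.mem (cell w k i), s.mem⟩

theorem view_start (w : ℕ) (T : MTree) : View w (start w T) (.ofState w (start w T)) where
  var _ _ := rfl
  arr _ _ _ := rfl
  inp _ _ := rfl
  reg_lt i := by
    simp only [start]
    split_ifs
    · exact Nat.mod_lt _ (by positivity)
    · positivity
  mem_lt a := by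
    simp only [start]
    split_ifs
    · exact Nat.mod_lt _ (by positivity)
    · exact Nat.mod_lt _ (by positivity)
    · positivity

theorem mainTheorem3 :
    ∃ (D : NMAStructure) (c C : ℕ),
      ∀ (T : MTree) (ops : List TreeOp) (n w : ℕ),
        T.IsTree →
        T.Admissible ops →
        n = (T.applyAll ops).size →
        (∀ k : OpKind, (ops.map TreeOp.kind).count k ≤ n) →
        2 ^ c * n ≤ 2 ^ w →
        ∃ (s : WordRAM.State) (t : ℕ) (ts : List ℕ),
          WordRAM.Exec w D.init (WordRAM.start w T) s t ∧
          Serves w D T s ops ts ∧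
          ∀ k ≤ ops.length, t + (ts.take k).sum ≤ C * (T.size + k) := by
  -- The factor `200` bounds machine steps per structured step; `236` covers `200 * T.size + 36`, as
  -- the tree is nonempty, and `190` per operation. With `c = 11` the arrays have length at least `2
  -- ^ 5 * n`.
  refine ⟨⟨initProg.compile, fun k => (opProg k).compile⟩, 11, 200 * 236, ?_⟩
  intro T ops n w H A hn hc hw
  rw [MTree.size_applyAll] at hn
  have hT := H.1
  have hlw := lim_lt w
  have hw11 : 11 ≤ w := by
    by_contra hlt
    have : 2 ^ w < 2 ^ 11 := Nat.pow_lt_pow_right (by norm_num) (by omega)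
    have : 2 ^ 11 * 1 ≤ 2 ^ 11 * n := Nat.mul_le_mul_left _ (by omega)
    omega
  have hlim : 32 * n ≤ lim w := by
    have : 2 ^ w = 64 * lim w := by
      unfold lim
      rw [show w = (w - 6) + 6 by omega, pow_add, Nat.add_sub_cancel]
      ring
    omega
  have hd := hc .demoteMark
  have inp_even : ∀ v < T.size, (start w T).mem (2 * v) = T.upHandle (v + 1) := by
    intro v hv
    have := H.upHandle_lt (u := v + 1) (by omega) (by omega)
    simp only [start]
    rw [if_pos (by omega), if_pos (by omega), show 2 * v / 2 = v by omega]
    exact Nat.mod_eq_of_lt (by simp only [MTree.upHandle, Nat.add_sub_cancel] at this; omega)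
  have inp_odd : ∀ v < T.size, (start w T).mem (2 * v + 1) = (T.marked v).toNat := by
    intro v hv
    have : (T.marked v).toNat ≤ 1 := Bool.toNat_le _
    simp only [start]
    rw [if_pos (by omega), if_neg (by omega), show (2 * v + 1) / 2 = v by omega]
    exact Nat.mod_eq_of_lt (by omega)
  obtain ⟨s, t, h, t0, x, V, l, tr, R, ht⟩ := (runs_initProg H (by omega) (by omega)
    (h := .ofState w (start w T)) (Nat.mod_eq_of_lt (by omega)) inp_even inp_odd).exec
    (by omega) wf_initProg factor_initProg (view_start w T)
  -- The forest has at most `2 * n + 1` nodes: one for handle `0`, `n` for the tree and at most `n`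
  -- for demotions. So `8 * (2 * n + 2) ≤ 32 * n ≤ lim w` suffices.
  obtain ⟨ts, S, hts⟩ := serves_opProg (w := w) (by omega) le_rfl initProg.compile ops T s h
    (T.size + 1) tr H A V R (by rw [sum_nodeCost]; omega)
  refine ⟨s, t, ts, x, S, fun k hk => ?_⟩
  have := hts k hk
  calc t + (ts.take k).sum
      ≤ 200 * t0 + 200 * (handlePotential (T.size + 1) T.size tr h + 190 * k) :=
        Nat.add_le_add l this
    _ ≤ 200 * 236 * (T.size + k) := by omega
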